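/- All maps are of class $C^\infty$ and are considered as germs at the origin. Let $f:(\mathbf R^3,0)\to(\mathbf R^4,0)$ be a frontal, i.e. there is a smooth map-germ $\nu$ with $|\nu|=1$ and $\langle df_p(X),\nu(p)\rangle=0$ for all $p$ near $0$ and all $X\in T_p\mathbf R^3$ (a unit normal vector of $f$). Let $S(f)$ be its set of singular points, i.e. of those $p$ where $df_p$ is not injective. An identifier of singularities is a function $\lambda$ which is the product of $\det(f_t,f_s,f_r,\nu)$, with $\nu$ a unit normal vector and $(t,s,r)$ the coordinates of $\mathbf R^3$, and a nowhere vanishing smooth function. A null vector field is a smooth vector field $\eta$ near $0$ with $\ker df_p=\langle\eta_p\rangle_{\mathbf R}$ for all $p\in S(f)$ near $0$. A parametrization of $S(f)$ is an immersion-germ $\Sigma:(\mathbf R^2,0)\to(\mathbf R^3,0)$ that sends the neighbourhoods of $0$ to neighbourhoods of $0$ in $S(f)$, these images forming a neighbourhood basis of $0$ in $S(f)$ (in particular $0\in S(f)$). Let $\lambda$ be an identifier of singularities and $\eta$ a null vector field with $\eta\lambda(0)\neq0$, let $\Sigma(t,r)$ be a parametrization of $S(f)$, let $\nu$ be a normal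 vector of $f$ (smooth, nowhere vanishing, orthogonal to the image of $df$, not necessarily unit), and put $\hat f=f\circ\Sigma$ and $$\psi(t,r)=\det\bigl(\hat f_t,\ \hat f_r,\ \nu(\Sigma(t,r)),\ (\eta\nu)(\Sigma(t,r))\bigr).$$ Then $f$ is a cuspidal cross cap $\times$ interval, i.e. there are diffeomorphism-germs $\phi$ of $(\mathbf R^3,0)$ and $\Phi$ of $(\mathbf R^4,0)$ such that $\Phi\circ f\circ\phi^{-1}$ is the germ at $0$ of $(t,s,r)\mapsto(t,s,r^2,sr^3)$, if and only if $\psi(0)=0$ and $d\psi_0\neq0$. Moreover, this condition is independent of all choices: if $g=\Phi\circ f\circ\phi^{-1}$ for some diffeomorphism-germs $\phi$ of $(\mathbf R^3,0)$ and $\Phi$ of $(\mathbf R^4,0)$ (for instance $g=f$), and $\nu',\lambda',\eta',\Sigma'$ are any normal vector, identifier of singularities, null vector field and parametrization of the singular set for $g$, with associated function $\psi'$, then $\eta'\lambda'(0)\neq0$, and $\psi'(0)=0$, $d\psi'_0\neq0$ hold if and only if $\psi(0)=0$, $d\psi_0\neq0$ hold. -/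

import Mathlib

open Filter Topology
open scoped ContDiff

noncomputable section

namespace FrontalCriterion

/-- Euclidean space `ℝⁿ`. Map-germs at the origin are represented by total maps of which only the
values near `0` are used. -/
abbrev E (n : ℕ) : Type := EuclideanSpace ℝ (Fin n)

/-- The `i`-th coordinate vector of `ℝⁿ`. -/
def basisVec {n : ℕ} (i : Fin n) : E n := EuclideanSpace.single i 1

/-- `f` is of class `C^∞` on a whole neighbourhood of the origin. -/
def SmoothNearZero {V W : Type*} [NormedAddCommGroup V] [NormedSpace ℝ V]
    [NormedAddCommGroup W] [NormedSpace ℝ W] (f : V → W) : Prop :=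
  ∀ᶠ p in 𝓝 (0 : V), ContDiffAt ℝ ∞ f p

/-- `f` represents a smooth map-germ `(ℝᵐ, 0) → (ℝⁿ, 0)`. -/
structure IsMapGerm {m n : ℕ} (f : E m → E n) : Prop where
  smooth : SmoothNearZero f
  map_zero : f 0 = 0

/-- `φ` represents a diffeomorphism-germ `(ℝⁿ, 0) → (ℝⁿ, 0)`. -/
def IsDiffeoGerm {n : ℕ} (φ : E n → E n) : Prop :=
  IsMapGerm φ ∧ ∃ θ : E n → E n, IsMapGerm θ ∧
    (∀ᶠ p in 𝓝 (0 : E n), θ (φ p) = p) ∧ (∀ᶠ p in 𝓝 (0 : E n), φ (θ p) = p)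

/-- `𝒜`-equivalence of map-germs: `Φ ∘ f ∘ φ⁻¹ = g` as germs, written as `Φ ∘ f = g ∘ φ`. -/
def AEquiv {m n : ℕ} (f g : E m → E n) : Prop :=
  ∃ (φ : E m → E m) (Φ : E n → E n), IsDiffeoGerm φ ∧ IsDiffeoGerm Φ ∧
    ∀ᶠ p in 𝓝 (0 : E m), Φ (f p) = g (φ p)

/-- The map `(t, s, r) ↦ (t, s, r², s r³)`. -/
def cuspidalCrossCapModel (p : E 3) : E 4 :=
  !₂[p 0, p 1, p 2 ^ 2, p 1 * p 2 ^ 3]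

/-- `f` is a cuspidal cross cap `×` interval. -/
def IsCuspidalCrossCapInterval (f : E 3 → E 4) : Prop :=
  IsMapGerm f ∧ AEquiv f cuspidalCrossCapModel

/-- The determinant of four vectors of `ℝ⁴`. -/
def det4 (a b c d : E 4) : ℝ :=
  Matrix.det (Matrix.of fun i j : Fin 4 => (![a, b, c, d] i) j)

/-- `ν` is a (smooth, nowhere vanishing, not necessarily unit) normal vector of `f` near `0`. -/
structure IsNormal (f ν : E 3 → E 4) : Prop where
  smooth : SmoothNearZero ν
  ne_zero : ∀ᶠ p in 𝓝 (0 : E 3), ν p ≠ 0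
  orthogonal : ∀ᶠ p in 𝓝 (0 : E 3), ∀ X : E 3, inner ℝ (fderiv ℝ f p X) (ν p) = 0

/-- `ν` is a unit normal vector of `f` near `0`. -/
structure IsUnitNormal (f ν : E 3 → E 4) : Prop where
  smooth : SmoothNearZero ν
  norm_eq_one : ∀ᶠ p in 𝓝 (0 : E 3), ‖ν p‖ = 1
  orthogonal : ∀ᶠ p in 𝓝 (0 : E 3), ∀ X : E 3, inner ℝ (fderiv ℝ f p X) (ν p) = 0

/-- `f : (ℝ³, 0) → (ℝ⁴, 0)` is a frontal. -/
def IsFrontal (f : E 3 → E 4) : Prop :=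
  IsMapGerm f ∧ ∃ ν : E 3 → E 4, IsUnitNormal f ν

/-- The set `S(f)` of singular points: the differential fails to be injective. -/
def singularSet (f : E 3 → E 4) : Set (E 3) :=
  {p | ¬ Function.Injective (fderiv ℝ f p)}

/-- `lam` is an identifier of singularities: near `0` it is the product of `det (f_t, f_s, f_r, ν)`,
for a unit normal vector `ν`, and a smooth function without zeros. -/
def IsSingularityIdentifier (f : E 3 → E 4) (lam : E 3 → ℝ) : Prop :=
  ∃ (ν : E 3 → E 4) (k : E 3 → ℝ), IsUnitNormal f ν ∧ SmoothNearZero k ∧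
    (∀ᶠ p in 𝓝 (0 : E 3), k p ≠ 0) ∧
    ∀ᶠ p in 𝓝 (0 : E 3),
      lam p = k p * det4 (fderiv ℝ f p (basisVec 0)) (fderiv ℝ f p (basisVec 1))
        (fderiv ℝ f p (basisVec 2)) (ν p)

/-- `η` is a null vector field: smooth near `0`, and it spans the kernel of `df` at every singular
point near `0`. -/
structure IsNullVectorField (f : E 3 → E 4) (η : E 3 → E 3) : Prop where
  smooth : SmoothNearZero η
  ker_eq_span : ∀ᶠ p in 𝓝 (0 : E 3), p ∈ singularSet f →
    LinearMap.ker (fderiv ℝ f p : E 3 →ₗ[ℝ] E 4) = Submodule.span ℝ {η p}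

/-- `sig : (ℝ², 0) → (ℝ³, 0)` is a parametrization of `S(f)` near `0`: an immersion-germ such that
the images of the neighbourhoods of `0` are neighbourhoods of `0` in `S(f)`, and generate these. -/
structure IsSingularParametrization (f : E 3 → E 4) (sig : E 2 → E 3) : Prop where
  germ : IsMapGerm sig
  immersion : Function.Injective (fderiv ℝ sig 0)
  map_nhds : Filter.map sig (𝓝 0) = 𝓝[singularSet f] 0

/-- All the choices on which the criterion is built, for a given `f`. -/
structure IsChoice (f ν : E 3 → E 4) (lam : E 3 → ℝ) (η : E 3 → E 3) (sig : E 2 → E 3) :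
    Prop where
  normal : IsNormal f ν
  identifier : IsSingularityIdentifier f lam
  null : IsNullVectorField f η
  param : IsSingularParametrization f sig

/-- The derivative `ηh` of a map `h` along a vector field `η`. -/
def vderiv {W : Type*} [NormedAddCommGroup W] [NormedSpace ℝ W]
    (η : E 3 → E 3) (h : E 3 → W) (p : E 3) : W :=
  fderiv ℝ h p (η p)

/-- `ψ = det (f̂_t, f̂_r, ν ∘ Σ, (ην) ∘ Σ)`, where `f̂ = f ∘ Σ` and `Σ` is written `sig`. -/
def psi (f ν : E 3 → E 4) (η : E 3 → E 3) (sig : E 2 → E 3) (u : E 2) : ℝ :=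
  det4 (fderiv ℝ (f ∘ sig) u (basisVec 0)) (fderiv ℝ (f ∘ sig) u (basisVec 1))
    (ν (sig u)) (vderiv η ν (sig u))

/-- The condition `ψ = 0` and `dψ ≠ 0` at the origin. -/
def PsiCondition (f ν : E 3 → E 4) (η : E 3 → E 3) (sig : E 2 → E 3) : Prop :=
  psi f ν η sig 0 = 0 ∧ fderiv ℝ (psi f ν η sig) 0 ≠ 0

end FrontalCriterion

end

open FrontalCriterion

noncomputable section

namespace FrontalCriterion

open MeasureTheory FourierTransform

/-! ### Smooth functions with bounded derivatives, and parametric integrals -/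

/-! The criterion is governed by the pairing N = ⟨dν(η), d²f(η, η)⟩ on S(f), called `normalPairing`.
The condition ηλ(0) ≠ 0 says exactly that d²f(η, η) is not in the image of df at 0
(`IsSingularityIdentifier.fderiv_ne_zero_iff`). It also makes η transversal to S(f), and
differentiating df(η) = 0 along S(f) then shows that ην is orthogonal to the image of df there
(`IsChoice.eventually_orthogonal`). A Gram determinant computation now gives ψ = (continuous
nonvanishing factor) · N∘Σ, so the condition on ψ is the condition that N∘Σ has a simple zero at 0
(`IsChoice.psiCondition_iff_normalPairing`).

N is intrinsic up to such factors. For any curve γ at a singular point with velocity η,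
differentiating ⟨(f∘γ)', ν∘γ⟩ = 0 twice yields ⟨(f∘γ)''', ν⟩ = -2N. As (f∘γ)' vanishes at that
point, a diffeomorphism Φ of the target acts on (f∘γ)''' through dΦ alone, and the functional
⟨dΦ(·), ν'⟩ kills the image of df and d²f(η, η), so it is a multiple of ⟨·, ν⟩. Hence N changes by a
factor under coordinate changes and changes of the normal, and by the cube of a factor under
rescaling of η (`NormalAt.normalPairing_map`, `IsChoice.invariance`).

It remains to test the condition on a normal form. Take Σ and η as source coordinates and f∘Σ,
d²f(η, η), ν as target coordinates. The last two components of f become z²A and z²B with A(0) > 0.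
After replacing z by z√A, Whitney's theorem splits B/A as P(x, y, z²) + z q(x, y, z²), and a shear
of the target removes P. This leaves (x, y, z², z³ q(x, y, z²)) (`IsChoice.exists_standardForm`),
for which ψ = (3/2) q(x, y, 0). If q vanishes at 0 with nonzero differential along the plane z = 0,
then q itself serves as a coordinate, in the source and in the target, and the model appears. The
model is the standard form with q = y, which gives the converse.

Whitney's theorem is proved by Fourier inversion: cos s and sin s / s are smooth functions of s²
with bounded derivatives on s² ≥ 0, so the even and odd parts of a compactly supported function are
oscillatory integrals depending smoothly on z². -/

theorem contDiff_nat_integral_of_dominated {K P : Type} [NormedAddCommGroup K] [NormedSpace ℝ K]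
    [MeasurableSpace K] [BorelSpace K] [SecondCountableTopology K] (μ : Measure K)
    [NormedAddCommGroup P] [NormedSpace ℝ P] (n : ℕ) :
    ∀ {V : Type} [NormedAddCommGroup V] [NormedSpace ℝ V] (F : K → P → V),
      ContDiff ℝ ∞ (Function.uncurry F) →
      (∀ n : ℕ, ∃ bound : K → ℝ, Integrable bound μ ∧
        ∀ᵐ κ ∂μ, ∀ p, ‖iteratedFDeriv ℝ n (F κ) p‖ ≤ bound κ) →
      ContDiff ℝ n (fun p => ∫ κ, F κ p ∂μ) := by
  have main : ∀ {V : Type} [NormedAddCommGroup V] [NormedSpace ℝ V] (F : K → P → V),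
      ContDiff ℝ ∞ (Function.uncurry F) →
      (∀ n : ℕ, ∃ bound : K → ℝ, Integrable bound μ ∧
        ∀ᵐ κ ∂μ, ∀ p, ‖iteratedFDeriv ℝ n (F κ) p‖ ≤ bound κ) →
      ContDiff ℝ ∞ (Function.uncurry fun κ p => fderiv ℝ (F κ) p) ∧
      ∀ p, HasFDerivAt (fun p => ∫ κ, F κ p ∂μ) (∫ κ, fderiv ℝ (F κ) p ∂μ) p := by
    intro V _ _ F hF hb
    have hF' : ContDiff ℝ ∞ (Function.uncurry fun κ p => fderiv ℝ (F κ) p) := by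
      have h1 : ContDiff ℝ ∞ (Function.uncurry fun (x : K × P) (p : P) => F x.1 p) :=
        hF.comp ((contDiff_fst.comp contDiff_fst).prodMk contDiff_snd)
      exact ContDiff.fderiv (n := ∞) h1 contDiff_snd (by simp)
    refine ⟨hF', fun p => ?_⟩
    obtain ⟨b0, hb0, hb0'⟩ := hb 0
    obtain ⟨b1, hb1, hb1'⟩ := hb 1
    have hmeas : ∀ p, AEStronglyMeasurable (fun κ => F κ p) μ := fun p =>
      (hF.continuous.comp (Continuous.prodMk_left p)).aestronglyMeasurable
    refine hasFDerivAt_integral_of_dominated_of_fderiv_le (𝕜 := ℝ) (F := fun p κ => F κ p)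
      (F' := fun p κ => fderiv ℝ (F κ) p) (s := Set.univ) (bound := b1) Filter.univ_mem
      (Eventually.of_forall hmeas) ?_ ?_ ?_ hb1 ?_
    · refine hb0.mono' (hmeas p) ?_
      filter_upwards [hb0'] with κ h
      simpa using h p
    · exact (hF'.continuous.comp (Continuous.prodMk_left p)).aestronglyMeasurable
    · filter_upwards [hb1'] with κ h x _
      simpa [norm_iteratedFDeriv_one] using h x
    · refine Eventually.of_forall fun κ x _ => ?_
      have h2 : ContDiff ℝ ∞ (F κ) := hF.comp (contDiff_const.prodMk contDiff_id)
      exact ((h2.differentiable (by simp)) x).hasFDerivAt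
  -- The target `V` has to vary in the induction: the derivative of the integral is the integral of
  -- a family with values in `P →L[ℝ] V`.
  induction n with
  | zero =>
    intro V _ _ F hF hb
    have := (main F hF hb).2
    exact contDiff_zero.2 (continuous_iff_continuousAt.2 fun p => (this p).continuousAt)
  | succ n ih =>
    intro V _ _ F hF hb
    obtain ⟨h1, h2⟩ := main F hF hb
    have h3 : fderiv ℝ (fun p => ∫ κ, F κ p ∂μ) = fun p => ∫ κ, fderiv ℝ (F κ) p ∂μ :=
      funext fun p => (h2 p).fderiv
    push_cast
    rw [contDiff_succ_iff_fderiv]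
    refine ⟨fun p => (h2 p).differentiableAt, by simp, ?_⟩
    rw [h3]
    refine ih _ h1 fun m => ?_
    obtain ⟨b, hb, hb'⟩ := hb (m + 1)
    refine ⟨b, hb, ?_⟩
    filter_upwards [hb'] with κ h p
    rw [norm_iteratedFDeriv_fderiv]
    exact h p

/-- A parametric integral is smooth if the derivatives of the integrand in the parameter are
dominated by integrable functions. -/
theorem contDiff_integral_of_dominated {K P V : Type} [NormedAddCommGroup K] [NormedSpace ℝ K]
    [MeasurableSpace K] [BorelSpace K] [SecondCountableTopology K] (μ : Measure K)
    [NormedAddCommGroup P] [NormedSpace ℝ P] [NormedAddCommGroup V] [NormedSpace ℝ V]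
    (F : K → P → V) (hF : ContDiff ℝ ∞ (Function.uncurry F))
    (hb : ∀ n : ℕ, ∃ bound : K → ℝ, Integrable bound μ ∧
        ∀ᵐ κ ∂μ, ∀ p, ‖iteratedFDeriv ℝ n (F κ) p‖ ≤ bound κ) :
    ContDiff ℝ ∞ (fun p => ∫ κ, F κ p ∂μ) :=
  contDiff_infty.2 fun n => contDiff_nat_integral_of_dominated μ n F hF hb

/-- Smooth functions all of whose derivatives are bounded. -/
def HasBoundedDerivs {X Y : Type*} [NormedAddCommGroup X] [NormedSpace ℝ X]
    [NormedAddCommGroup Y] [NormedSpace ℝ Y] (f : X → Y) : Prop :=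
  ContDiff ℝ ∞ f ∧ ∀ n : ℕ, ∃ M : ℝ, ∀ x, ‖iteratedFDeriv ℝ n f x‖ ≤ M

section
variable {X Y Z : Type*} [NormedAddCommGroup X] [NormedSpace ℝ X]
  [NormedAddCommGroup Y] [NormedSpace ℝ Y] [NormedAddCommGroup Z] [NormedSpace ℝ Z]

theorem HasCompactSupport.hasBoundedDerivs {f : X → Y} (h : HasCompactSupport f)
    (hf : ContDiff ℝ ∞ f) : HasBoundedDerivs f := by
  refine ⟨hf, fun n => ?_⟩
  exact (h.iteratedFDeriv (𝕜 := ℝ) n).exists_bound_of_continuous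
    (hf.continuous_iteratedFDeriv (by exact_mod_cast le_top))

theorem norm_iteratedFDeriv_comp_clm_le {f : Y → Z} (hf : ContDiff ℝ ∞ f) (L : X →L[ℝ] Y)
    (n : ℕ) (x : X) :
    ‖iteratedFDeriv ℝ n (fun x => f (L x)) x‖ ≤ ‖iteratedFDeriv ℝ n f (L x)‖ * ‖L‖ ^ n := by
  have := L.iteratedFDeriv_comp_right hf x (i := n) (by exact_mod_cast le_top)
  change ‖iteratedFDeriv ℝ n (f ∘ L) x‖ ≤ _
  rw [this]
  simpa using (iteratedFDeriv ℝ n f (L x)).norm_compContinuousLinearMap_le (fun _ => L)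

theorem HasBoundedDerivs.comp_clm {f : Y → Z} (hf : HasBoundedDerivs f) (L : X →L[ℝ] Y) :
    HasBoundedDerivs (fun x => f (L x)) := by
  refine ⟨hf.1.comp L.contDiff, fun n => ?_⟩
  obtain ⟨M, hM⟩ := hf.2 n
  exact ⟨M * ‖L‖ ^ n, fun x => (norm_iteratedFDeriv_comp_clm_le hf.1 L n x).trans
    (mul_le_mul_of_nonneg_right (hM _) (by positivity))⟩

theorem HasBoundedDerivs.mul {A : Type*} [NormedRing A] [NormedAlgebra ℝ A] {f g : X → A}
    (hf : HasBoundedDerivs f) (hg : HasBoundedDerivs g) :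
    HasBoundedDerivs (fun x => f x * g x) := by
  refine ⟨hf.1.mul hg.1, fun n => ?_⟩
  choose M hM using hf.2
  choose N hN using hg.2
  refine ⟨∑ i ∈ Finset.range (n + 1), (n.choose i : ℝ) * M i * N (n - i), fun x => ?_⟩
  refine (norm_iteratedFDeriv_mul_le hf.1 hg.1 x (by exact_mod_cast le_top)).trans ?_
  refine Finset.sum_le_sum fun i _ => ?_
  have h0 : 0 ≤ M i := (norm_nonneg _).trans (hM i x)
  gcongr
  · exact hM i x
  · exact hN (n - i) x

theorem HasBoundedDerivs.clm_comp {f : X → Y} (hf : HasBoundedDerivs f) (L : Y →L[ℝ] Z) :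
    HasBoundedDerivs (fun x => L (f x)) := by
  refine ⟨L.contDiff.comp hf.1, fun n => ?_⟩
  obtain ⟨M, hM⟩ := hf.2 n
  refine ⟨‖L‖ * M, fun x => ?_⟩
  have h1 := L.iteratedFDeriv_comp_left (x := x) (i := n) (n := ∞) hf.1.contDiffAt
    (by exact_mod_cast le_top)
  change ‖iteratedFDeriv ℝ n (L ∘ f) x‖ ≤ _
  rw [h1]
  exact (L.norm_compContinuousMultilinearMap_le _).trans
    (mul_le_mul_of_nonneg_left (hM x) (norm_nonneg _))

theorem hasBoundedDerivs_of_iteratedDeriv {f : ℝ → Y} (hf : ContDiff ℝ ∞ f)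
    (h : ∀ n : ℕ, ∃ M : ℝ, ∀ x, ‖iteratedDeriv n f x‖ ≤ M) : HasBoundedDerivs f := by
  refine ⟨hf, fun n => ?_⟩
  obtain ⟨M, hM⟩ := h n
  exact ⟨M, fun x => by rw [norm_iteratedFDeriv_eq_norm_iteratedDeriv]; exact hM x⟩

end

theorem hasBoundedDerivs_cexp_mul_I :
    HasBoundedDerivs (fun a : ℝ => Complex.exp (a * Complex.I)) := by
  have h : ∀ n : ℕ, iteratedDeriv n (fun a : ℝ => Complex.exp (a * Complex.I))
      = fun a : ℝ => Complex.I ^ n * Complex.exp (a * Complex.I) := by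
    intro n
    induction n with
    | zero => simp
    | succ n ih =>
      rw [iteratedDeriv_succ, ih]
      funext a
      have h1 : HasDerivAt (fun a : ℝ => (a : ℂ) * Complex.I) Complex.I a := by
        simpa using (Complex.ofRealCLM.hasDerivAt (x := a)).mul_const Complex.I
      have := (h1.cexp.const_mul (Complex.I ^ n)).deriv
      rw [this]; ring
  refine hasBoundedDerivs_of_iteratedDeriv ?_ fun n => ⟨1, fun a => ?_⟩
  · exact Complex.contDiff_exp.comp (Complex.ofRealCLM.contDiff.mul contDiff_const)
  · rw [h]; simp [Complex.norm_exp_ofReal_mul_I]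

/-! ### Smooth functions `C`, `S` with `C (s²) = cos s` and `s * S (s²) = sin s` -/

/-- With s = √y, the operator d/dy is (2s)⁻¹ d/ds, which preserves combinations of cos s and sin s
with coefficients polynomial in 1/s. Such expressions are bounded for y ≥ 1. -/
theorem exists_iteratedDeriv_eq_trig (f : ℝ → ℝ) (a b : Polynomial ℝ)
    (hf : ∀ y : ℝ, 0 < y → f y = a.eval (√y)⁻¹ * Real.cos √y + b.eval (√y)⁻¹ * Real.sin √y)
    (n : ℕ) :
    ∃ a b : Polynomial ℝ, ∀ y : ℝ, 0 < y →
      iteratedDeriv n f y = a.eval (√y)⁻¹ * Real.cos √y + b.eval (√y)⁻¹ * Real.sin √y := by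
  induction n with
  | zero => exact ⟨a, b, by simpa using hf⟩
  | succ n ih =>
    obtain ⟨a, b, h⟩ := ih
    refine ⟨Polynomial.C (1 / 2) * (-Polynomial.X ^ 3 * a.derivative + Polynomial.X * b),
      Polynomial.C (1 / 2) * (-Polynomial.X ^ 3 * b.derivative - Polynomial.X * a),
      fun y hy => ?_⟩
    have hs : 0 < √y := Real.sqrt_pos.2 hy
    have h1 : HasDerivAt (fun y : ℝ => √y) (1 / (2 * √y)) y := Real.hasDerivAt_sqrt hy.ne'
    have h2 := h1.inv hs.ne'
    have h3 := (a.hasDerivAt _).comp y h2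
    have h4 := (b.hasDerivAt _).comp y h2
    have h5 := (h3.mul h1.cos).add (h4.mul h1.sin)
    have h6 : iteratedDeriv n f =ᶠ[𝓝 y] fun y => a.eval (√y)⁻¹ * Real.cos √y
        + b.eval (√y)⁻¹ * Real.sin √y := by
      filter_upwards [lt_mem_nhds hy] with z hz using h z hz
    rw [iteratedDeriv_succ, h6.deriv_eq]
    refine (HasDerivAt.deriv h5).trans ?_
    simp only [Function.comp, Pi.inv_apply, Polynomial.eval_mul, Polynomial.eval_add, Polynomial.eval_sub,
      Polynomial.eval_neg, Polynomial.eval_pow, Polynomial.eval_X, Polynomial.eval_C]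
    field_simp
    ring

/-- The power series gives smoothness across y = 0, and the trigonometric formula bounds all
derivatives for y ≥ 1. A cutoff is needed on the negative side, where cos √y turns into a hyperbolic
cosine; only the values at y = s² matter. -/
theorem exists_bounded_of_entire (c : ℕ → ℝ) (hc : ∀ n, c n ≠ 0)
    (hlim : Tendsto (fun n => ‖c n.succ‖ / ‖c n‖) atTop (𝓝 0)) (a b : Polynomial ℝ)
    (h : ∀ s : ℝ, 0 < s → HasSum (fun n => c n * (s ^ 2) ^ n)
      (a.eval s⁻¹ * Real.cos s + b.eval s⁻¹ * Real.sin s)) :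
    ∃ C : ℝ → ℝ, HasBoundedDerivs C ∧
      ∀ s : ℝ, s ≠ 0 → C (s ^ 2) = a.eval |s|⁻¹ * Real.cos |s| + b.eval |s|⁻¹ * Real.sin |s| := by
  set p := FormalMultilinearSeries.ofScalars ℝ c with hp
  have hr : p.radius = ⊤ := FormalMultilinearSeries.ofScalars_radius_eq_top_of_tendsto ℝ c
    (Eventually.of_forall hc) hlim
  have hps := p.hasFPowerSeriesOnBall (by rw [hr]; exact ENNReal.zero_lt_top)
  have hsm : ContDiff ℝ ∞ p.sum := by
    refine contDiff_iff_contDiffAt.2 fun x => ?_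
    exact (hps.analyticAt_of_mem (by rw [hr]; simp)).contDiffAt
  have hval : ∀ s : ℝ, 0 < s → p.sum (s ^ 2) = a.eval s⁻¹ * Real.cos s + b.eval s⁻¹ * Real.sin s := by
    intro s hs
    rw [← (h s hs).tsum_eq]
    change FormalMultilinearSeries.sum (FormalMultilinearSeries.ofScalars ℝ c) (s ^ 2) = _
    rw [FormalMultilinearSeries.sum]
    refine tsum_congr fun n => ?_
    simp [mul_comm]
  -- The cutoff is 1 on y ≥ 0 and 0 on y ≤ -1.
  set χ : ℝ → ℝ := fun y => Real.smoothTransition (y + 1) with hχ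
  have hχs : ContDiff ℝ ∞ χ :=
    Real.smoothTransition.contDiff.comp (contDiff_id.add contDiff_const)
  have hχ1 : ∀ y, 0 ≤ y → χ y = 1 := fun y hy => Real.smoothTransition.one_of_one_le (by linarith)
  have hχ0 : ∀ y, y ≤ -1 → χ y = 0 := fun y hy => Real.smoothTransition.zero_of_nonpos (by linarith)
  set C : ℝ → ℝ := fun y => χ y * p.sum y with hC
  have hCs : ContDiff ℝ ∞ C := hχs.mul hsm
  refine ⟨C, hasBoundedDerivs_of_iteratedDeriv hCs fun n => ?_, ?_⟩
  · have hf : ∀ y : ℝ, 0 < y → C y =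
        a.eval (√y)⁻¹ * Real.cos √y + b.eval (√y)⁻¹ * Real.sin √y := by
      intro y hy
      have := hval (√y) (Real.sqrt_pos.2 hy)
      rw [Real.sq_sqrt hy.le] at this
      simp only [hC, hχ1 y hy.le, one_mul, this]
    obtain ⟨a', b', h'⟩ := exists_iteratedDeriv_eq_trig C a b hf n
    have hbd : ∀ q : Polynomial ℝ, ∃ M, ∀ x ∈ Set.Icc (0 : ℝ) 1, ‖q.eval x‖ ≤ M := fun q =>
      isCompact_Icc.exists_bound_of_continuousOn q.continuous.continuousOn
    obtain ⟨Ma, hMa⟩ := hbd a'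
    obtain ⟨Mb, hMb⟩ := hbd b'
    obtain ⟨M, hM⟩ := (isCompact_Icc (a := (-1 : ℝ)) (b := 1)).exists_bound_of_continuousOn
      (f := iteratedDeriv n C)
      (hCs.continuous_iteratedDeriv n (by exact_mod_cast le_top)).continuousOn
    refine ⟨max M (Ma + Mb), fun x => ?_⟩
    rcases lt_or_ge x (-1) with hx | hx
    · have h0 : C =ᶠ[𝓝 x] fun _ => 0 := by
        filter_upwards [gt_mem_nhds hx] with z hz
        simp [hC, hχ0 z hz.le]
      rw [h0.iteratedDeriv_eq]
      have : 0 ≤ M := (norm_nonneg _).trans (hM 0 (by simp))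
      simp [this]
    rcases le_or_gt x 1 with hx1 | hx1
    · exact (hM x ⟨hx, hx1⟩).trans (le_max_left _ _)
    · rw [h' x (by linarith)]
      have hmem : (√x)⁻¹ ∈ Set.Icc (0 : ℝ) 1 :=
        ⟨by positivity, inv_le_one_of_one_le₀ (Real.one_le_sqrt.2 hx1.le)⟩
      refine le_trans ?_ (le_max_right _ _)
      refine (norm_add_le _ _).trans (add_le_add ?_ ?_)
      · rw [norm_mul]
        exact (mul_le_of_le_one_right (norm_nonneg _) (Real.abs_cos_le_one _)).trans (hMa _ hmem)
      · rw [norm_mul]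
        exact (mul_le_of_le_one_right (norm_nonneg _) (Real.abs_sin_le_one _)).trans (hMb _ hmem)
  · intro s hs
    have := hval |s| (abs_pos.2 hs)
    rw [sq_abs] at this
    simp only [hC, hχ1 (s ^ 2) (sq_nonneg s), one_mul, this]

theorem tendsto_zero_of_le_one_div (u : ℕ → ℝ) (hu : ∀ n, 0 ≤ u n)
    (h : ∀ n : ℕ, u n ≤ 1 / ((n : ℝ) + 1)) :
    Tendsto u atTop (𝓝 0) :=
  squeeze_zero hu h tendsto_one_div_add_atTop_nhds_zero_nat

theorem exists_cos_sqrt :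
    ∃ C : ℝ → ℝ, HasBoundedDerivs C ∧ ∀ s : ℝ, C (s ^ 2) = Real.cos s := by
  obtain ⟨C, hC, h⟩ := exists_bounded_of_entire (fun n => (-1) ^ n / ((2 * n).factorial : ℝ))
    (fun n => by positivity) (by
      refine tendsto_zero_of_le_one_div _ (fun n => by positivity) fun n => ?_
      simp only [norm_div, norm_pow, norm_neg, norm_one, one_pow, Real.norm_natCast]
      rw [show 2 * n.succ = 2 * n + 1 + 1 by simp; ring, Nat.factorial_succ, Nat.factorial_succ]
      push_cast
      have : (0 : ℝ) < (2 * n).factorial := by positivity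
      rw [show 1 / ((2 * (n : ℝ) + 1 + 1) * ((2 * n + 1) * ((2 * n).factorial : ℝ))) /
        (1 / ((2 * n).factorial : ℝ)) = 1 / ((2 * n + 1 + 1) * (2 * n + 1)) by field_simp]
      gcongr
      nlinarith [(Nat.cast_nonneg n : (0 : ℝ) ≤ n)]) 1 0 (by
      intro s hs
      have := Real.hasSum_cos s
      simp only [Polynomial.eval_one, one_mul, Polynomial.eval_zero, zero_mul, add_zero]
      refine this.congr_fun ?_
      intro n; rw [pow_mul]; ring)
  refine ⟨C, hC, fun s => ?_⟩
  have h1 : ∀ s : ℝ, s ≠ 0 → C (s ^ 2) = Real.cos s := fun s hs => by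
    rw [h s hs]; simp
  -- The general lemma excludes s = 0; that value follows by continuity.
  have h2 : Set.EqOn (fun s => C (s ^ 2)) Real.cos {0}ᶜ := fun s hs => h1 s hs
  have := Continuous.ext_on (dense_compl_singleton (0 : ℝ))
    (hC.1.continuous.comp (continuous_pow 2)) Real.continuous_cos h2
  exact congrFun this s

theorem exists_sin_sqrt :
    ∃ S : ℝ → ℝ, HasBoundedDerivs S ∧ ∀ s : ℝ, s * S (s ^ 2) = Real.sin s := by
  -- The coefficient polynomials `0` and `Polynomial.X` encode the function sin s / s.
  obtain ⟨S, hS, h⟩ := exists_bounded_of_entire (fun n => (-1) ^ n / ((2 * n + 1).factorial : ℝ))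
    (fun n => by positivity) (by
      refine tendsto_zero_of_le_one_div _ (fun n => by positivity) fun n => ?_
      simp only [norm_div, norm_pow, norm_neg, norm_one, one_pow, Real.norm_natCast]
      rw [show 2 * n.succ + 1 = 2 * n + 1 + 1 + 1 by simp; ring, Nat.factorial_succ,
        Nat.factorial_succ]
      push_cast
      have : (0 : ℝ) < (2 * n + 1).factorial := by positivity
      rw [show 1 / ((2 * (n : ℝ) + 2 + 1) * ((2 * n + 1 + 1) * ((2 * n + 1).factorial : ℝ))) /
        (1 / ((2 * n + 1).factorial : ℝ)) = 1 / ((2 * n + 2 + 1) * (2 * n + 1 + 1)) by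
          field_simp]
      gcongr
      nlinarith [(Nat.cast_nonneg n : (0 : ℝ) ≤ n)]) 0 Polynomial.X (by
      intro s hs
      have := (Real.hasSum_sin s).mul_left s⁻¹
      simp only [Polynomial.eval_X, Polynomial.eval_zero, zero_mul, zero_add]
      refine this.congr_fun ?_
      intro n; rw [pow_succ s (2 * n), pow_mul]; field_simp)
  refine ⟨S, hS, fun s => ?_⟩
  rcases eq_or_ne s 0 with rfl | hs
  · simp
  rw [h s hs]
  rcases abs_cases s with ⟨h1, _⟩ | ⟨h1, _⟩ <;> rw [h1] <;> simp <;> field_simp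

/-! ### Whitney's theorem on even and odd parts, and Hadamard's lemma -/

theorem SmoothNearZero.exists_compactSupport {n : ℕ} {W : Type*} [NormedAddCommGroup W]
    [NormedSpace ℝ W] {f : E n → W} (hf : SmoothNearZero f) :
    ∃ g : E n → W, ContDiff ℝ ∞ g ∧ HasCompactSupport g ∧ g =ᶠ[𝓝 0] f := by
  obtain ⟨ε, hε, h⟩ := Metric.eventually_nhds_iff_ball.1 hf
  let b : ContDiffBump (0 : E n) := ⟨ε / 4, ε / 2, by positivity, by linarith⟩
  refine ⟨fun x => b x • f x, ?_, b.hasCompactSupport.smul_right, ?_⟩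
  · refine contDiff_iff_contDiffAt.2 fun x => ?_
    by_cases hx : x ∈ tsupport b
    · refine b.contDiff.contDiffAt.smul (h x ?_)
      rw [b.tsupport_eq] at hx
      exact Metric.closedBall_subset_ball (show ε / 2 < ε by linarith) hx
    · have := notMem_tsupport_iff_eventuallyEq.1 hx
      refine (contDiffAt_const (c := (0 : W))).congr_of_eventuallyEq ?_
      filter_upwards [this] with y hy
      simp [hy]
  · filter_upwards [b.eventuallyEq_one] with x hx
    simp [hx]

theorem abs_coord_le_norm {n : ℕ} (x : E n) (i : Fin n) : |x i| ≤ ‖x‖ := by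
  simpa using PiLp.norm_apply_le x i

/-- The linear map `y ↦ (2π (κ₀ y₀ + κ₁ y₁), (2π κ₂)² y₂)`. -/
def phaseMap (κ : E 3) : E 3 →L[ℝ] ℝ × ℝ :=
  ((2 * Real.pi * κ 0) • (EuclideanSpace.proj 0 : E 3 →L[ℝ] ℝ) +
    (2 * Real.pi * κ 1) • (EuclideanSpace.proj 1 : E 3 →L[ℝ] ℝ)).prod
    ((2 * Real.pi * κ 2) ^ 2 • (EuclideanSpace.proj 2 : E 3 →L[ℝ] ℝ))

theorem phaseMap_apply (κ y : E 3) : phaseMap κ y =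
    (2 * Real.pi * κ 0 * y 0 + 2 * Real.pi * κ 1 * y 1, (2 * Real.pi * κ 2) ^ 2 * y 2) := by
  simp [phaseMap]

/-- Only the quadratic growth in κ matters. The two components are bounded by 16‖κ‖ and 64‖κ‖², and
100 is a generous common constant. -/
theorem norm_phaseMap_le (κ : E 3) : ‖phaseMap κ‖ ≤ 100 * (1 + ‖κ‖ ^ 2) := by
  refine ContinuousLinearMap.opNorm_le_bound _ (by positivity) fun y => ?_
  rw [phaseMap_apply, Prod.norm_def, max_le_iff, Real.norm_eq_abs, Real.norm_eq_abs]
  have hk := abs_coord_le_norm κ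
  have hy := abs_coord_le_norm y
  have h4 := Real.pi_le_four
  have h0 := Real.pi_pos
  have hn := norm_nonneg κ
  have hb : ∀ i j, |2 * Real.pi * κ i * y j| ≤ 8 * ‖κ‖ * ‖y‖ := fun i j => by
    rw [abs_mul, abs_mul, abs_of_pos (by positivity : (0 : ℝ) < 2 * Real.pi)]
    gcongr
    · linarith
    · exact hk i
    · exact hy j
  constructor
  · refine (abs_add_le _ _).trans ((add_le_add (hb 0 0) (hb 1 1)).trans ?_)
    have : 8 * ‖κ‖ + 8 * ‖κ‖ ≤ 100 * (1 + ‖κ‖ ^ 2) := by nlinarith [sq_nonneg (‖κ‖ - 1)]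
    nlinarith [norm_nonneg y]
  · rw [abs_mul, abs_of_nonneg (sq_nonneg (2 * Real.pi * κ 2)), mul_pow, mul_pow, ← sq_abs (κ 2)]
    have h1 : Real.pi ^ 2 ≤ 16 := by nlinarith
    have h2 : |κ 2| ^ 2 ≤ ‖κ‖ ^ 2 := by gcongr; exact hk 2
    have h3 : 2 ^ 2 * Real.pi ^ 2 * |κ 2| ^ 2 ≤ 2 ^ 2 * 16 * ‖κ‖ ^ 2 := by gcongr
    calc _ ≤ 2 ^ 2 * 16 * ‖κ‖ ^ 2 * ‖y‖ := by gcongr; exact hy 2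
      _ ≤ _ := by gcongr <;> nlinarith [sq_nonneg ‖κ‖]

/-- Each derivative in y costs one factor ‖`phaseMap κ`‖ = O(1 + ‖κ‖²), and all moments of m are
integrable, so the derivatives are dominated uniformly in y. -/
theorem contDiff_oscillatory_integral (m : E 3 → ℂ) (hm : ContDiff ℝ ∞ m)
    (hint : ∀ k : ℕ, Integrable (fun κ => ‖κ‖ ^ k * ‖m κ‖)) {G : ℝ × ℝ → ℂ}
    (hG : HasBoundedDerivs G) :
    ContDiff ℝ ∞ (fun y => ∫ κ, m κ * G (phaseMap κ y)) ∧
      ∀ y, Integrable (fun κ => m κ * G (phaseMap κ y)) := by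
  have hjoint : ContDiff ℝ ∞ (Function.uncurry fun κ y => m κ * G (phaseMap κ y)) := by
    refine (hm.comp contDiff_fst).mul (hG.1.comp ?_)
    have : (fun x : E 3 × E 3 => phaseMap x.1 x.2) = fun x => (2 * Real.pi * x.1 0 * x.2 0 +
        2 * Real.pi * x.1 1 * x.2 1, (2 * Real.pi * x.1 2) ^ 2 * x.2 2) :=
      funext fun x => phaseMap_apply _ _
    rw [this]
    have h1 : ∀ i : Fin 3, ContDiff ℝ ∞ fun x : E 3 × E 3 => x.1 i := fun i =>
      (EuclideanSpace.proj i : E 3 →L[ℝ] ℝ).contDiff.comp contDiff_fst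
    have h2 : ∀ i : Fin 3, ContDiff ℝ ∞ fun x : E 3 × E 3 => x.2 i := fun i =>
      (EuclideanSpace.proj i : E 3 →L[ℝ] ℝ).contDiff.comp contDiff_snd
    fun_prop
  have hbound : ∀ n : ℕ, ∃ bound : E 3 → ℝ, Integrable bound ∧
      ∀ κ p, ‖iteratedFDeriv ℝ n (fun y => m κ * G (phaseMap κ y)) p‖ ≤ bound κ := by
    intro n
    obtain ⟨M, hM⟩ := hG.2 n
    have hM0 : 0 ≤ M := (norm_nonneg _).trans (hM 0)
    refine ⟨fun κ => M * 100 ^ n * 2 ^ (n - 1) * (‖κ‖ ^ 0 * ‖m κ‖ + ‖κ‖ ^ (2 * n) * ‖m κ‖),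
      ((hint 0).add (hint (2 * n))).const_mul _, fun κ p => ?_⟩
    have h1 : ContDiffAt ℝ n (fun y => G (phaseMap κ y)) p :=
      ((hG.1.comp (phaseMap κ).contDiff).contDiffAt).of_le (by exact_mod_cast le_top)
    have h2 : iteratedFDeriv ℝ n (fun y => m κ * G (phaseMap κ y)) p
        = m κ • iteratedFDeriv ℝ n (fun y => G (phaseMap κ y)) p :=
      iteratedFDeriv_const_smul_apply (a := m κ) h1
    rw [h2, norm_smul]
    have h3 := (norm_iteratedFDeriv_comp_clm_le hG.1 (phaseMap κ) n p).trans
      (mul_le_mul (hM _) (pow_le_pow_left₀ (norm_nonneg _) (norm_phaseMap_le κ) n)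
        (by positivity) hM0)
    have h4 : (1 + ‖κ‖ ^ 2) ^ n ≤ 2 ^ (n - 1) * (1 + ‖κ‖ ^ (2 * n)) := by
      have := add_pow_le zero_le_one (sq_nonneg ‖κ‖) n
      rwa [one_pow, ← pow_mul] at this
    rw [mul_pow] at h3
    calc _ ≤ ‖m κ‖ * (M * (100 ^ n * (1 + ‖κ‖ ^ 2) ^ n)) := by gcongr
      _ ≤ ‖m κ‖ * (M * (100 ^ n * (2 ^ (n - 1) * (1 + ‖κ‖ ^ (2 * n))))) := by gcongr
      _ = _ := by ring
  refine ⟨contDiff_integral_of_dominated _ _ hjoint fun n => ?_, fun y => ?_⟩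
  · obtain ⟨b, h1, h2⟩ := hbound n
    exact ⟨b, h1, Eventually.of_forall h2⟩
  · obtain ⟨b, h1, h2⟩ := hbound 0
    refine h1.mono' (hjoint.continuous.comp (Continuous.prodMk_left y)).aestronglyMeasurable
      (Eventually.of_forall fun κ => ?_)
    simpa using h2 κ y

/-- A smooth function germ decomposes as `p (x, y, z²) + z * q (x, y, z²)`. -/
theorem SmoothNearZero.exists_even_odd {b : E 3 → ℝ} (hb : SmoothNearZero b) :
    ∃ p q : E 3 → ℝ, ContDiff ℝ ∞ p ∧ ContDiff ℝ ∞ q ∧ ∀ᶠ x in 𝓝 (0 : E 3),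
      b x = p !₂[x 0, x 1, x 2 ^ 2] + x 2 * q !₂[x 0, x 1, x 2 ^ 2] := by
  obtain ⟨g, hg, hgc, hgb⟩ := hb.exists_compactSupport
  obtain ⟨C, hC, hC'⟩ := exists_cos_sqrt
  obtain ⟨S, hS, hS'⟩ := exists_sin_sqrt
  have hgc' : HasCompactSupport fun x => (g x : ℂ) := hgc.comp_left Complex.ofReal_zero
  have hg' : ContDiff ℝ ∞ fun x => (g x : ℂ) := Complex.ofRealCLM.contDiff.comp hg
  let φ : SchwartzMap (E 3) ℂ := hgc'.toSchwartzMap hg'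
  let m : SchwartzMap (E 3) ℂ := 𝓕 φ
  have hinv : ∀ x, (g x : ℂ) = ∫ v, Complex.exp (↑(2 * Real.pi * inner ℝ v x) * Complex.I) • m v := by
    intro x
    have h1 : 𝓕⁻ m = φ := FourierPair.fourierInv_fourier_eq φ
    have h2 : (φ x : ℂ) = g x := rfl
    rw [← h2, ← h1, SchwartzMap.fourierInv_coe, Real.fourierInv_eq']
  have hkernel : ∀ {D : ℝ → ℝ}, HasBoundedDerivs D → HasBoundedDerivs fun a : ℝ × ℝ =>
      Complex.exp (a.1 * Complex.I) * (D a.2 : ℂ) := fun hD =>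
    (hasBoundedDerivs_cexp_mul_I.comp_clm (ContinuousLinearMap.fst ℝ ℝ ℝ)).mul
      ((hD.comp_clm (ContinuousLinearMap.snd ℝ ℝ ℝ)).clm_comp Complex.ofRealCLM)
  have hmint := fun k => m.integrable_pow_mul volume k
  obtain ⟨hp, hpi⟩ := contDiff_oscillatory_integral m m.smooth' hmint (hkernel hC)
  -- In i sin(2πκ₂z) = z · (2πκ₂ i) · S((2πκ₂z)²) the factor z is pulled out of the integral, and
  -- the remaining 2πκ₂ i is absorbed in the amplitude, at the cost of one moment.
  let m' : E 3 → ℂ := fun κ => m κ * ((2 * Real.pi * κ 2 : ℝ) * Complex.I)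
  have hm' : ContDiff ℝ ∞ m' := by
    refine m.smooth'.mul ((Complex.ofRealCLM.contDiff.comp ?_).mul contDiff_const)
    exact contDiff_const.mul (EuclideanSpace.proj 2 : E 3 →L[ℝ] ℝ).contDiff
  have hm'int : ∀ k : ℕ, Integrable (fun κ => ‖κ‖ ^ k * ‖m' κ‖) := by
    intro k
    refine ((hmint (k + 1)).const_mul (2 * Real.pi)).mono'
      ((continuous_norm.pow k).mul hm'.continuous.norm).aestronglyMeasurable
      (Eventually.of_forall fun κ => ?_)
    have h1 := abs_coord_le_norm κ 2
    have h2 : ‖m' κ‖ = ‖m κ‖ * (2 * Real.pi * |κ 2|) := by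
      simp only [m', norm_mul, Complex.norm_real, Complex.norm_I, mul_one, Real.norm_eq_abs, abs_two,
        abs_of_pos Real.pi_pos]
    rw [Real.norm_of_nonneg (by positivity), h2]
    calc ‖κ‖ ^ k * (‖m κ‖ * (2 * Real.pi * |κ 2|))
        ≤ ‖κ‖ ^ k * (‖m κ‖ * (2 * Real.pi * ‖κ‖)) := by gcongr
      _ = _ := by ring
  obtain ⟨hq, hqi⟩ := contDiff_oscillatory_integral m' hm' hm'int (hkernel hS)
  refine ⟨_, _, Complex.reCLM.contDiff.comp hp, Complex.reCLM.contDiff.comp hq, ?_⟩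
  filter_upwards [hgb] with x hx
  rw [← hx]
  set y : E 3 := !₂[x 0, x 1, x 2 ^ 2] with hy
  have h1 : (g x : ℂ) = (∫ κ, m κ * (Complex.exp ((phaseMap κ y).1 * Complex.I) *
      (C (phaseMap κ y).2 : ℂ))) + (x 2 : ℂ) * ∫ κ, m' κ * (Complex.exp
        ((phaseMap κ y).1 * Complex.I) * (S (phaseMap κ y).2 : ℂ)) := by
    rw [hinv x, ← integral_const_mul, ← integral_add (hpi y) ((hqi y).const_mul _)]
    refine integral_congr_ae (Eventually.of_forall fun κ => ?_)
    have e1 : (phaseMap κ y).1 = 2 * Real.pi * κ 0 * x 0 + 2 * Real.pi * κ 1 * x 1 := by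
      rw [phaseMap_apply]; simp [hy]
    have e2 : (phaseMap κ y).2 = (2 * Real.pi * κ 2 * x 2) ^ 2 := by
      rw [phaseMap_apply]; simp [hy]; ring
    have e3 : 2 * Real.pi * inner ℝ κ x = (phaseMap κ y).1 + 2 * Real.pi * κ 2 * x 2 := by
      rw [e1, PiLp.inner_apply, Fin.sum_univ_three]
      simp; ring
    -- Euler's formula with cos s = C(s²) and sin s = s S(s²): apart from the explicit factor s, the
    -- coordinate z enters only through z².
    have e4 : Complex.exp ((2 * Real.pi * κ 2 * x 2 : ℝ) * Complex.I) =
        (C (phaseMap κ y).2 : ℂ) +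
          ((2 * Real.pi * κ 2 * x 2 : ℝ) : ℂ) * (S (phaseMap κ y).2 : ℂ) * Complex.I := by
      rw [e2, hC', ← Complex.ofReal_mul, hS', Complex.exp_mul_I, Complex.ofReal_cos,
        Complex.ofReal_sin]
    simp only [smul_eq_mul]
    rw [e3, Complex.ofReal_add, add_mul, Complex.exp_add, e4]
    simp only [m']
    push_cast
    ring
  have h2 := congrArg Complex.re h1
  rw [Complex.ofReal_re, Complex.add_re, Complex.re_ofReal_mul] at h2
  exact h2

/-- Hadamard's lemma in the last variable. -/
theorem SmoothNearZero.exists_hadamard {b : E 3 → ℝ} (hb : SmoothNearZero b)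
    (h0 : ∀ᶠ x in 𝓝 (0 : E 3), b !₂[x 0, x 1, 0] = 0) :
    ∃ c : E 3 → ℝ, ContDiff ℝ ∞ c ∧ ∀ᶠ x in 𝓝 (0 : E 3), b x = x 2 * c x := by
  obtain ⟨g, hg, hgc, hgb⟩ := hb.exists_compactSupport
  let e : E 3 := basisVec 2
  -- The map `L t` multiplies the last coordinate by t and fixes the others, and `c` is the integral
  -- over t of ∂_z g (x, y, tz).
  let P : E 3 →L[ℝ] E 3 := ContinuousLinearMap.id ℝ (E 3) -
    (EuclideanSpace.proj 2 : E 3 →L[ℝ] ℝ).smulRight e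
  let Q : E 3 →L[ℝ] E 3 := (EuclideanSpace.proj 2 : E 3 →L[ℝ] ℝ).smulRight e
  let L : ℝ → E 3 →L[ℝ] E 3 := fun t => P + t • Q
  let d : E 3 → ℝ := fun x => fderiv ℝ g x e
  have hd : HasBoundedDerivs d := by
    refine HasCompactSupport.hasBoundedDerivs ?_ (hg.fderiv_right (m := ∞) (by simp) |>.clm_apply contDiff_const)
    exact (hgc.fderiv (𝕜 := ℝ)).comp_left (g := fun l : E 3 →L[ℝ] ℝ => l e) (by simp)
  let c : E 3 → ℝ := fun x => ∫ t in Set.Ioc (0 : ℝ) 1, d (L t x)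
  have hc : ContDiff ℝ ∞ c := by
    refine contDiff_integral_of_dominated _ _ ?_ fun n => ?_
    · refine hd.1.comp ?_
      exact (P.contDiff.comp contDiff_snd).add (contDiff_fst.smul (Q.contDiff.comp contDiff_snd))
    · obtain ⟨M, hM⟩ := hd.2 n
      have hM0 : 0 ≤ M := (norm_nonneg _).trans (hM 0)
      refine ⟨fun _ => M * (‖P‖ + ‖Q‖) ^ n, integrable_const _, ?_⟩
      filter_upwards [ae_restrict_mem measurableSet_Ioc] with t ht p
      refine (norm_iteratedFDeriv_comp_clm_le hd.1 (L t) n p).trans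
        (mul_le_mul (hM _) (pow_le_pow_left₀ (norm_nonneg _) ?_ n) (by positivity) hM0)
      refine (norm_add_le _ _).trans (add_le_add le_rfl ?_)
      rw [norm_smul, Real.norm_of_nonneg ht.1.le]
      exact mul_le_of_le_one_left (norm_nonneg _) ht.2
  refine ⟨c, hc, ?_⟩
  have hL1 : ∀ x, L 1 x = x := fun x => by simp [L, P, Q]
  have hL0 : ∀ x, L 0 x = !₂[x 0, x 1, 0] := fun x => by
    ext i; fin_cases i <;> simp [L, P, e, basisVec]
  have hL0' : Tendsto (fun x : E 3 => (!₂[x 0, x 1, 0] : E 3)) (𝓝 0) (𝓝 0) := by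
    have := (L 0).continuous.tendsto 0
    simp only [map_zero] at this
    exact this.congr hL0
  filter_upwards [hgb, h0, hL0'.eventually hgb] with x h1 h2 h3
  rw [h2] at h3
  have hder : ∀ t ∈ Set.uIcc (0 : ℝ) 1, HasDerivAt (fun t => g (L t x)) (x 2 * d (L t x)) t := by
    intro t _
    have e1 : HasDerivAt (fun t => L t x) (x 2 • e) t := by
      have := ((hasDerivAt_id t).smul_const (Q x)).const_add (P x)
      simpa [L, Q] using this
    have e2 := ((hg.differentiable (by simp)) (L t x)).hasFDerivAt.comp_hasDerivAt t e1
    have e3 : fderiv ℝ g (L t x) (x 2 • e) = x 2 * d (L t x) := by simp [d]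
    rwa [e3] at e2
  have hcont : Continuous fun t => x 2 * d (L t x) := by
    refine continuous_const.mul (hd.1.continuous.comp ?_)
    exact continuous_const.add (continuous_id.smul continuous_const)
  have := intervalIntegral.integral_eq_sub_of_hasDerivAt hder (hcont.intervalIntegrable 0 1)
  rw [hL1, hL0, h3, sub_zero, h1, intervalIntegral.integral_const_mul,
    intervalIntegral.integral_of_le zero_le_one] at this
  exact this.symm

/-! ### Map-germs and diffeomorphism-germs -/

section
variable {V W Z : Type*} [NormedAddCommGroup V] [NormedSpace ℝ V] [NormedAddCommGroup W]
  [NormedSpace ℝ W] [NormedAddCommGroup Z] [NormedSpace ℝ Z]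

theorem SmoothNearZero.at_zero {f : V → W} (hf : SmoothNearZero f) : ContDiffAt ℝ ∞ f 0 :=
  hf.self_of_nhds

theorem SmoothNearZero.continuousAt {f : V → W} (hf : SmoothNearZero f) : ContinuousAt f 0 :=
  hf.at_zero.continuousAt

theorem SmoothNearZero.differentiableAt {f : V → W} (hf : SmoothNearZero f) :
    DifferentiableAt ℝ f 0 :=
  hf.at_zero.differentiableAt (by simp)

theorem SmoothNearZero.congr {f g : V → W} (hf : SmoothNearZero f) (h : g =ᶠ[𝓝 0] f) :
    SmoothNearZero g := by
  filter_upwards [hf, h.eventuallyEq_nhds] with p h1 h2 using h1.congr_of_eventuallyEq h2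

theorem _root_.ContDiff.smoothNearZero {f : V → W} (hf : ContDiff ℝ ∞ f) : SmoothNearZero f :=
  Eventually.of_forall fun _ => hf.contDiffAt

theorem SmoothNearZero.comp {g : W → Z} {f : V → W} (hg : SmoothNearZero g)
    (hf : SmoothNearZero f) (h0 : f 0 = 0) : SmoothNearZero (fun p => g (f p)) := by
  have ht : Tendsto f (𝓝 0) (𝓝 0) := by simpa [ContinuousAt, h0] using hf.continuousAt
  filter_upwards [hf, ht.eventually hg] with p h1 h2 using h2.comp p h1

theorem _root_.ContDiffAt.fderiv_infty {f : V → W} {p : V} (hf : ContDiffAt ℝ ∞ f p) :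
    ContDiffAt ℝ ∞ (fderiv ℝ f) p :=
  hf.fderiv_right (by simp)

theorem SmoothNearZero.fderiv {f : V → W} (hf : SmoothNearZero f) :
    SmoothNearZero (fderiv ℝ f) := by
  filter_upwards [hf] with p h using h.fderiv_infty

theorem SmoothNearZero.clm_apply {f : V → W →L[ℝ] Z} {g : V → W} (hf : SmoothNearZero f)
    (hg : SmoothNearZero g) : SmoothNearZero (fun p => f p (g p)) := by
  filter_upwards [hf, hg] with p h1 h2 using h1.clm_apply h2

theorem SmoothNearZero.inner {n : ℕ} {f g : V → E n} (hf : SmoothNearZero f)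
    (hg : SmoothNearZero g) : SmoothNearZero (fun p => inner ℝ (f p) (g p)) := by
  filter_upwards [hf, hg] with p h1 h2 using h1.inner ℝ h2

theorem SmoothNearZero.mul {f g : V → ℝ} (hf : SmoothNearZero f)
    (hg : SmoothNearZero g) : SmoothNearZero (fun p => f p * g p) := by
  filter_upwards [hf, hg] with p h1 h2 using h1.mul h2

theorem SmoothNearZero.coord {n : ℕ} {f : V → E n} (hf : SmoothNearZero f) (i : Fin n) :
    SmoothNearZero (fun p => f p i) := by
  filter_upwards [hf] with p h using contDiffAt_euclidean.1 h i

theorem smoothNearZero_euclidean {n : ℕ} {f : V → E n} :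
    SmoothNearZero f ↔ ∀ i, SmoothNearZero (fun p => f p i) := by
  refine ⟨fun h i => h.coord i, fun h => ?_⟩
  filter_upwards [eventually_all.2 h] with p hp using contDiffAt_euclidean.2 hp

end

theorem IsMapGerm.tendsto {m n : ℕ} {f : E m → E n} (hf : IsMapGerm f) :
    Tendsto f (𝓝 0) (𝓝 0) := by
  simpa [ContinuousAt, hf.map_zero] using hf.smooth.continuousAt

theorem IsMapGerm.comp {l m n : ℕ} {g : E m → E n} {f : E l → E m} (hg : IsMapGerm g)
    (hf : IsMapGerm f) : IsMapGerm (fun p => g (f p)) :=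
  ⟨hg.smooth.comp hf.smooth hf.map_zero, by rw [hf.map_zero, hg.map_zero]⟩

theorem IsMapGerm.hasFDerivAt {m n : ℕ} {f : E m → E n} (hf : IsMapGerm f) :
    HasFDerivAt f (fderiv ℝ f 0) 0 :=
  hf.smooth.differentiableAt.hasFDerivAt

theorem IsMapGerm.hasFDerivAt_comp {l m n : ℕ} {g : E m → E n} {f : E l → E m}
    (hg : IsMapGerm g) (hf : IsMapGerm f) :
    HasFDerivAt (fun p => g (f p)) ((fderiv ℝ g 0).comp (fderiv ℝ f 0)) 0 := by
  have h := hg.hasFDerivAt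
  rw [← hf.map_zero] at h
  have := h.comp 0 hf.hasFDerivAt
  rwa [hf.map_zero] at this

theorem eventually_injective_fderiv {m n : ℕ} {f : E m → E n} (hf : SmoothNearZero f)
    (hinj : Function.Injective (fderiv ℝ f 0)) :
    ∀ᶠ p in 𝓝 (0 : E m), Function.Injective (fderiv ℝ f p) :=
  hf.fderiv.continuousAt.eventually
    ((ContinuousLinearMap.isOpen_injective (𝕜 := ℝ)).mem_nhds hinj)

theorem exists_equiv_of_injective {n : ℕ} {L : E n →L[ℝ] E n} (h : Function.Injective L) :
    ∃ e : E n ≃L[ℝ] E n, (e : E n →L[ℝ] E n) = L :=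
  ⟨(LinearEquiv.ofInjectiveEndo (L : E n →ₗ[ℝ] E n) h).toContinuousLinearEquiv, by ext; rfl⟩

/-- The inverse function theorem for germs. -/
theorem IsMapGerm.isDiffeoGerm {n : ℕ} {h : E n → E n} (hh : IsMapGerm h)
    (hinj : Function.Injective (fderiv ℝ h 0)) : IsDiffeoGerm h := by
  obtain ⟨e, he⟩ := exists_equiv_of_injective hinj
  have hd : HasFDerivAt h (e : E n →L[ℝ] E n) 0 := by rw [he]; exact hh.hasFDerivAt
  let o := ContDiffAt.toOpenPartialHomeomorph h hh.smooth.at_zero hd (by simp)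
  have ho : ∀ p, o p = h p := fun p => rfl
  have hs : (0 : E n) ∈ o.source :=
    ContDiffAt.mem_toOpenPartialHomeomorph_source hh.smooth.at_zero hd (by simp)
  have h0 : o 0 = 0 := by rw [ho, hh.map_zero]
  have ht : (0 : E n) ∈ o.target := by rw [← h0]; exact o.map_source hs
  have h0' : o.symm 0 = 0 := by
    have := o.left_inv hs
    rwa [h0] at this
  have htend : Tendsto o.symm (𝓝 0) (𝓝 0) := by
    have := o.symm.continuousAt (x := 0) ht
    rwa [ContinuousAt, h0'] at this
  refine ⟨hh, o.symm, ⟨?_, h0'⟩, ?_, ?_⟩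
  · filter_upwards [o.open_target.mem_nhds ht, htend.eventually hh.smooth,
      htend.eventually (eventually_injective_fderiv hh.smooth hinj)] with y h1 h2 h3
    obtain ⟨e', he'⟩ := exists_equiv_of_injective h3
    refine o.contDiffAt_symm (f₀' := e') h1 ?_ h2
    rw [he']
    exact (h2.differentiableAt (by simp)).hasFDerivAt
  · filter_upwards [o.open_source.mem_nhds hs] with p hp using o.left_inv hp
  · filter_upwards [o.open_target.mem_nhds ht] with p hp using o.right_inv hp

theorem IsDiffeoGerm.injective_fderiv {n : ℕ} {φ : E n → E n} (hφ : IsDiffeoGerm φ) :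
    Function.Injective (fderiv ℝ φ 0) := by
  obtain ⟨h1, θ, h2, h3, -⟩ := hφ
  have hd := h2.hasFDerivAt_comp h1
  have he : (fun p => θ (φ p)) =ᶠ[𝓝 0] id := h3
  have := hd.unique ((hasFDerivAt_id (𝕜 := ℝ) (0 : E n)).congr_of_eventuallyEq he)
  intro x y hxy
  have hx := congrArg (fun L : E n →L[ℝ] E n => L x) this
  have hy := congrArg (fun L : E n →L[ℝ] E n => L y) this
  simp only [ContinuousLinearMap.comp_apply, ContinuousLinearMap.id_apply] at hx hy
  rw [← hx, ← hy, hxy]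

theorem IsDiffeoGerm.comp {n : ℕ} {ψ φ : E n → E n} (hψ : IsDiffeoGerm ψ) (hφ : IsDiffeoGerm φ) :
    IsDiffeoGerm (fun p => ψ (φ p)) := by
  refine (hψ.1.comp hφ.1).isDiffeoGerm ?_
  rw [(hψ.1.hasFDerivAt_comp hφ.1).fderiv]
  exact hψ.injective_fderiv.comp hφ.injective_fderiv

theorem isDiffeoGerm_id (n : ℕ) : IsDiffeoGerm (fun p : E n => p) :=
  ⟨⟨contDiff_id.smoothNearZero, rfl⟩, fun p => p, ⟨contDiff_id.smoothNearZero, rfl⟩, by simp,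
    by simp⟩

theorem AEquiv.trans {m n : ℕ} {f g k : E m → E n} (h1 : AEquiv f g) (h2 : AEquiv g k) :
    AEquiv f k := by
  obtain ⟨φ, Φ, hφ, hΦ, h⟩ := h1
  obtain ⟨φ', Φ', hφ', hΦ', h'⟩ := h2
  refine ⟨_, _, hφ'.comp hφ, hΦ'.comp hΦ, ?_⟩
  filter_upwards [h, hφ.1.tendsto.eventually h'] with p e1 e2
  rw [e1, e2]

/-- Near 0 the map g agrees with Φ ∘ f ∘ φ⁻¹, so smoothness and the base point need not be assumed
for g. -/
theorem AEquiv.isMapGerm {m n : ℕ} {f g : E m → E n} (hf : IsMapGerm f) (h : AEquiv f g) :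
    IsMapGerm g := by
  obtain ⟨φ, Φ, ⟨hφ, θ, hθ, h1, h2⟩, hΦ, h⟩ := h
  refine ⟨(hΦ.1.comp (hf.comp hθ)).smooth.congr ?_, ?_⟩
  · filter_upwards [h2, hθ.tendsto.eventually h] with p e1 e2
    rw [e2, e1]
  · have := h.self_of_nhds
    rw [hf.map_zero, hΦ.1.map_zero, hφ.map_zero] at this
    exact this.symm

theorem AEquiv.symm {m n : ℕ} {f g : E m → E n} (hf : IsMapGerm f) (h : AEquiv f g) :
    AEquiv g f := by
  obtain ⟨φ, Φ, ⟨hφ, θ, hθ, h1, h2⟩, ⟨hΦ, Θ, hΘ, h3, h4⟩, h⟩ := h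
  refine ⟨θ, Θ, ⟨hθ, φ, hφ, h2, h1⟩, ⟨hΘ, Φ, hΦ, h4, h3⟩, ?_⟩
  filter_upwards [h2, hθ.tendsto.eventually h, (hf.tendsto.comp hθ.tendsto).eventually h3]
    with p e1 e2 e3
  rw [e1] at e2
  rw [← e2]
  exact e3

/-- Changing coordinates in the target. -/
theorem aEquiv_of_target {m n : ℕ} {f : E m → E n} {Φ : E n → E n} (hΦ : IsDiffeoGerm Φ) :
    AEquiv f (fun p => Φ (f p)) :=
  ⟨_, Φ, isDiffeoGerm_id m, hΦ, Eventually.of_forall fun _ => rfl⟩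

/-- Changing coordinates in the source. -/
theorem aEquiv_of_source {m n : ℕ} {g : E m → E n} {φ : E m → E m} (hφ : IsDiffeoGerm φ) :
    AEquiv (fun p => g (φ p)) g :=
  ⟨φ, _, hφ, isDiffeoGerm_id n, Eventually.of_forall fun _ => rfl⟩

theorem AEquiv.of_eventuallyEq {m n : ℕ} {f g : E m → E n} (h : f =ᶠ[𝓝 0] g) : AEquiv f g :=
  ⟨_, _, isDiffeoGerm_id m, isDiffeoGerm_id n, h⟩

/-! ### Determinants of four vectors -/

theorem det4_ne_zero_iff (a b c d : E 4) :
    det4 a b c d ≠ 0 ↔ LinearIndependent ℝ ![a, b, c, d] := by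
  rw [det4, ← isUnit_iff_ne_zero, ← Matrix.isUnit_iff_isUnit_det,
    ← Matrix.linearIndependent_rows_iff_isUnit]
  have h := (EuclideanSpace.equiv (Fin 4) ℝ).toLinearEquiv.toLinearMap.linearIndependent_iff
    (v := ![a, b, c, d]) (LinearEquiv.ker _)
  rw [← h]
  exact Iff.rfl

theorem linearMap_eq_zero_of_det4 {V : Type*} [AddCommGroup V] [Module ℝ V] {a b c d : E 4}
    (h : det4 a b c d ≠ 0) (l : E 4 →ₗ[ℝ] V) (ha : l a = 0) (hb : l b = 0)
    (hc : l c = 0) (hd : l d = 0) : l = 0 := by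
  have hli := (det4_ne_zero_iff a b c d).1 h
  have hspan := hli.span_eq_top_of_card_eq_finrank (by simp)
  refine LinearMap.ext_on hspan ?_
  rintro _ ⟨i, rfl⟩
  fin_cases i <;> simp [ha, hb, hc, hd]

/-- The vector n is orthogonal to the span of the other three, so only the independence of a, b, c
has to be checked. -/
theorem det4_ne_zero_of_orthogonal {a b c n : E 4} (hn : n ≠ 0) (ha : inner ℝ a n = 0)
    (hb : inner ℝ b n = 0) (hc : inner ℝ c n = 0)
    (hab : ∀ s t : ℝ, s • a + t • b = 0 → s = 0 ∧ t = 0)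
    (habc : ∀ s t : ℝ, c ≠ s • a + t • b) : det4 a b c n ≠ 0 := by
  rw [det4_ne_zero_iff, Fintype.linearIndependent_iff]
  intro s hs
  simp only [Fin.sum_univ_four, Matrix.cons_val] at hs
  have h3 : s 3 = 0 := by
    have := congrArg (fun x => inner ℝ x n) hs
    simp only [inner_add_left, inner_smul_left, ha, hb, hc, inner_zero_left] at this
    simpa [hn] using this
  have h2 : s 2 = 0 := by
    by_contra h
    refine habc (-(s 2)⁻¹ * s 0) (-(s 2)⁻¹ * s 1) ?_
    have e : s 2 • c = -(s 0 • a + s 1 • b) := by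
      rw [h3] at hs
      rw [← sub_eq_zero, ← hs]; module
    calc c = (s 2)⁻¹ • (s 2 • c) := by rw [smul_smul, inv_mul_cancel₀ h, one_smul]
      _ = _ := by rw [e]; module
  obtain ⟨h0, h1⟩ := hab (s 0) (s 1) (by rw [← hs, h2, h3]; module)
  intro i; fin_cases i <;> assumption

theorem det4_add_smul_third (a b d : E 4) (s t : ℝ) : det4 a b (s • a + t • b) d = 0 := by
  by_contra h
  have := (det4_ne_zero_iff _ _ _ _).1 h
  rw [Fintype.linearIndependent_iff] at this
  have := this ![s, t, -1, 0] (by simp only [Fin.sum_univ_four, Matrix.cons_val]; module) 2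
  simp at this

theorem det4_smul_third (a b c d : E 4) (r : ℝ) : det4 a b (r • c) d = r * det4 a b c d := by
  simp [det4, Matrix.det_succ_row_zero, Fin.sum_univ_succ, Fin.succAbove]
  ring

theorem continuous_det4 : Continuous fun x : E 4 × E 4 × E 4 × E 4 =>
    det4 x.1 x.2.1 x.2.2.1 x.2.2.2 := by
  refine Continuous.matrix_det (continuous_matrix fun i j => ?_)
  fin_cases i <;> simp <;> fun_prop

theorem contDiff_det4 : ContDiff ℝ ∞ fun x : E 4 × E 4 × E 4 × E 4 =>
    det4 x.1 x.2.1 x.2.2.1 x.2.2.2 := by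
  have h : ∀ {g : E 4 × E 4 × E 4 × E 4 → E 4}, ContDiff ℝ ∞ g → ∀ k, ContDiff ℝ ∞ fun x => g x k :=
    fun hg k => contDiff_euclidean.1 hg k
  have hentry : ∀ i k : Fin 4, ContDiff ℝ ∞ fun x : E 4 × E 4 × E 4 × E 4 =>
      (![x.1, x.2.1, x.2.2.1, x.2.2.2] i) k := by
    intro i k
    fin_cases i
    · exact h contDiff_fst k
    · exact h (contDiff_fst.comp contDiff_snd) k
    · exact h (contDiff_fst.comp (contDiff_snd.comp contDiff_snd)) k
    · exact h (contDiff_snd.comp (contDiff_snd.comp contDiff_snd)) k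
  have e : (fun x : E 4 × E 4 × E 4 × E 4 => det4 x.1 x.2.1 x.2.2.1 x.2.2.2) = fun x =>
      ∑ σ : Equiv.Perm (Fin 4), ((Equiv.Perm.sign σ : ℤ) : ℝ) *
        ∏ i, (![x.1, x.2.1, x.2.2.1, x.2.2.2] (σ i)) i := by
    funext x
    rw [det4, Matrix.det_apply']
    rfl
  rw [e]
  exact ContDiff.sum fun σ _ => contDiff_const.mul (contDiff_prod fun i _ => hentry (σ i) i)

theorem smoothNearZero_det4 {V : Type*} [NormedAddCommGroup V] [NormedSpace ℝ V]
    {a b c d : V → E 4} (ha : SmoothNearZero a) (hb : SmoothNearZero b) (hc : SmoothNearZero c)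
    (hd : SmoothNearZero d) : SmoothNearZero (fun p => det4 (a p) (b p) (c p) (d p)) := by
  filter_upwards [ha, hb, hc, hd] with p h1 h2 h3 h4
  exact ContDiffAt.comp (g := fun x : E 4 × E 4 × E 4 × E 4 => det4 x.1 x.2.1 x.2.2.1 x.2.2.2)
    (f := fun p => (a p, b p, c p, d p)) p contDiff_det4.contDiffAt
    (h1.prodMk (h2.prodMk (h3.prodMk h4)))

/-- The product is the determinant of the matrix of inner products of the two frames, which is
nearly block triangular by orthogonality. With m = ην and c = d²f(η, η) it turns ψ into a multiple
of the pairing ⟨ην, d²f(η, η)⟩. -/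
theorem det4_mul_det4_of_orthogonal {a b c n m : E 4} (ha : inner ℝ a n = 0)
    (hb : inner ℝ b n = 0) (hc : inner ℝ c n = 0) (ham : inner ℝ a m = 0)
    (hbm : inner ℝ b m = 0) :
    det4 a b n m * det4 a b c n =
      -(inner ℝ a a * inner ℝ b b - inner ℝ a b ^ 2) * inner ℝ n n * inner ℝ m c := by
  have key : (Matrix.of fun i j : Fin 4 => (![a, b, n, m] i) j) *
      (Matrix.of fun i j : Fin 4 => (![a, b, c, n] i) j).transpose =
      !![inner ℝ a a, inner ℝ a b, inner ℝ a c, 0; inner ℝ a b, inner ℝ b b, inner ℝ b c, 0;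
        0, 0, 0, inner ℝ n n; 0, 0, inner ℝ m c, inner ℝ m n] := by
    have e : ∀ x y : E 4, ∑ k, x k * y k = inner ℝ x y := fun x y => by
      rw [real_inner_comm, PiLp.inner_apply]; rfl
    ext i j
    rw [Matrix.mul_apply]
    simp only [Matrix.transpose_apply, Matrix.of_apply]
    rw [e]
    fin_cases i <;> fin_cases j <;> simp [ha, hb, real_inner_comm, hc, ham, hbm]
  rw [det4, det4, ← Matrix.det_transpose (Matrix.of fun i j : Fin 4 => (![a, b, c, n] i) j),
    ← Matrix.det_mul, key]
  simp [Matrix.det_succ_row_zero, Fin.sum_univ_succ, Fin.succAbove]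
  ring

/-- The vector ⟨b, b⟩a - ⟨a, b⟩b has squared norm ⟨b, b⟩ times the Gram determinant. -/
theorem gram_ne_zero {a b : E 4} (hab : ∀ s t : ℝ, s • a + t • b = 0 → s = 0 ∧ t = 0) :
    inner ℝ a a * inner ℝ b b - inner ℝ a b ^ 2 ≠ 0 := by
  intro h
  have h1 : (inner ℝ b b : ℝ) • a + (-inner ℝ a b : ℝ) • b = 0 := by
    rw [← inner_self_eq_zero (𝕜 := ℝ)]
    have e : (inner ℝ b a : ℝ) = inner ℝ a b := real_inner_comm a b
    simp only [inner_add_left, inner_add_right, real_inner_smul_left, real_inner_smul_right, e]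
    linear_combination (inner ℝ b b) * h
  have h2 := (hab _ _ h1).1
  rw [inner_self_eq_zero] at h2
  have := (hab 0 1 (by simp [h2])).2
  norm_num at this

/-! ### Determinants of frames in the source -/

/-- The determinant of three vectors of `ℝ³`. -/
def det3 (a b c : E 3) : ℝ :=
  Matrix.det (Matrix.of fun i j : Fin 3 => (![a, b, c] i) j)

theorem eq_sum_basisVec (X : E 3) :
    X = X 0 • basisVec 0 + X 1 • basisVec 1 + X 2 • basisVec 2 := by
  ext i; fin_cases i <;> simp [basisVec]

/-- This replaces the coordinate frame in the definition of λ by a frame whose last vector is the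
null direction. -/
theorem det4_map_eq (L : E 3 →L[ℝ] E 4) (X Y Z : E 3) (n : E 4) :
    det4 (L X) (L Y) (L Z) n =
      det3 X Y Z * det4 (L (basisVec 0)) (L (basisVec 1)) (L (basisVec 2)) n := by
  have key : (Matrix.of fun i j : Fin 4 => (![L X, L Y, L Z, n] i) j) =
      !![X 0, X 1, X 2, 0; Y 0, Y 1, Y 2, 0; Z 0, Z 1, Z 2, 0; 0, 0, 0, 1] *
      (Matrix.of fun i j : Fin 4 =>
        (![L (basisVec 0), L (basisVec 1), L (basisVec 2), n] i) j) := by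
    have e : ∀ (X : E 3) (j : Fin 4), L X j = X 0 * L (basisVec 0) j + X 1 * L (basisVec 1) j +
        X 2 * L (basisVec 2) j := fun X j => by
      conv_lhs => rw [eq_sum_basisVec X]
      simp
    ext i j
    rw [Matrix.mul_apply, Fin.sum_univ_four]
    fin_cases i
    · simpa using e X j
    · simpa using e Y j
    · simpa using e Z j
    · simp
  rw [det4, key, Matrix.det_mul, det4, det3]
  congr 1
  simp [Matrix.det_succ_row_zero, Fin.sum_univ_succ, Fin.succAbove]

theorem exists_det3_ne_zero {v : E 3} (hv : v ≠ 0) : ∃ X Y : E 3, det3 X Y v ≠ 0 := by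
  have : ∃ i, v i ≠ 0 := by
    by_contra! h
    exact hv (by ext i; simpa using h i)
  obtain ⟨i, hi⟩ := this
  fin_cases i
  · exact ⟨basisVec 1, basisVec 2, by simpa [det3, Matrix.det_fin_three, basisVec] using hi⟩
  · exact ⟨basisVec 0, basisVec 2, by simpa [det3, Matrix.det_fin_three, basisVec] using hi⟩
  · exact ⟨basisVec 0, basisVec 1, by simpa [det3, Matrix.det_fin_three, basisVec] using hi⟩

theorem linearIndependent_of_det3_ne_zero {X Y v : E 3} (h : det3 X Y v ≠ 0) :
    LinearIndependent ℝ ![X, Y, v] := by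
  rw [det3, ← isUnit_iff_ne_zero, ← Matrix.isUnit_iff_isUnit_det,
    ← Matrix.linearIndependent_rows_iff_isUnit] at h
  exact ((EuclideanSpace.equiv (Fin 3) ℝ).toLinearEquiv.toLinearMap.linearIndependent_iff
    (v := ![X, Y, v]) (LinearEquiv.ker _)).1 h

theorem exists_eq_of_det3_ne_zero {X Y v : E 3} (h : det3 X Y v ≠ 0) (Z : E 3) :
    ∃ r s t : ℝ, Z = r • X + s • Y + t • v := by
  have hspan := (linearIndependent_of_det3_ne_zero h).span_eq_top_of_card_eq_finrank (by simp)
  have : Z ∈ Submodule.span ℝ (Set.range ![X, Y, v]) := by rw [hspan]; trivial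
  obtain ⟨c, rfl⟩ := (Submodule.mem_span_range_iff_exists_fun ℝ).1 this
  exact ⟨c 0, c 1, c 2, by simp [Fin.sum_univ_three]⟩

/-! ### Derivatives along curves -/

section
variable {V W Z : Type*} [NormedAddCommGroup V] [NormedSpace ℝ V] [NormedAddCommGroup W]
  [NormedSpace ℝ W] [NormedAddCommGroup Z] [NormedSpace ℝ Z]

theorem SmoothNearZero.deriv {a : ℝ → V} (ha : SmoothNearZero a) : SmoothNearZero (deriv a) :=
  ha.fderiv.clm_apply (contDiff_const (c := (1 : ℝ))).smoothNearZero

theorem SmoothNearZero.hasDerivAt {a : ℝ → V} (ha : SmoothNearZero a) :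
    ∀ᶠ t in 𝓝 (0 : ℝ), HasDerivAt a (_root_.deriv a t) t := by
  filter_upwards [ha] with t h using (h.differentiableAt (by simp)).hasDerivAt

theorem hasDerivAt_bilinear (B : V →L[ℝ] W →L[ℝ] Z) {a : ℝ → V} {b : ℝ → W} {a' : V} {b' : W}
    {t : ℝ} (ha : HasDerivAt a a' t) (hb : HasDerivAt b b' t) :
    HasDerivAt (fun t => B (a t) (b t)) (B (a t) b' + B a' (b t)) t := by
  rw [add_comm]
  exact (B.hasFDerivAt.comp_hasDerivAt t ha).clm_apply hb

theorem deriv_bilinear (B : V →L[ℝ] W →L[ℝ] Z) {a : ℝ → V} {b : ℝ → W} (ha : SmoothNearZero a)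
    (hb : SmoothNearZero b) : deriv (fun t => B (a t) (b t)) =ᶠ[𝓝 0]
      fun t => B (a t) (deriv b t) + B (deriv a t) (b t) := by
  filter_upwards [ha.hasDerivAt, hb.hasDerivAt] with t h1 h2
  exact (hasDerivAt_bilinear B h1 h2).deriv

theorem deriv_deriv_bilinear (B : V →L[ℝ] W →L[ℝ] Z) {a : ℝ → V} {b : ℝ → W}
    (ha : SmoothNearZero a) (hb : SmoothNearZero b) :
    deriv (deriv (fun t => B (a t) (b t))) 0 = B (a 0) (deriv (deriv b) 0) +
      (2 : ℝ) • B (deriv a 0) (deriv b 0) + B (deriv (deriv a) 0) (b 0) := by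
  rw [(deriv_bilinear B ha hb).deriv_eq]
  have h1 := hasDerivAt_bilinear B ha.hasDerivAt.self_of_nhds hb.deriv.hasDerivAt.self_of_nhds
  have h2 := hasDerivAt_bilinear B ha.deriv.hasDerivAt.self_of_nhds hb.hasDerivAt.self_of_nhds
  have h3 : HasDerivAt (fun t => B (a t) (deriv b t) + B (deriv a t) (b t)) _ 0 := h1.add h2
  rw [h3.deriv]
  module

theorem smoothNearZero_comp_curve {f : V → W} {γ : ℝ → V}
    (hf : ∀ᶠ q in 𝓝 (γ 0), ContDiffAt ℝ ∞ f q) (hγ : SmoothNearZero γ) :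
    SmoothNearZero (fun t => f (γ t)) := by
  filter_upwards [hγ, hγ.continuousAt.eventually hf] with t h1 h2 using h2.comp t h1

theorem deriv_comp_curve {f : V → W} {γ : ℝ → V}
    (hf : ∀ᶠ q in 𝓝 (γ 0), ContDiffAt ℝ ∞ f q) (hγ : SmoothNearZero γ) :
    deriv (fun t => f (γ t)) =ᶠ[𝓝 0] fun t => fderiv ℝ f (γ t) (deriv γ t) := by
  filter_upwards [hγ.hasDerivAt, hγ.continuousAt.eventually hf] with t h1 h2
  exact ((h2.differentiableAt (by simp)).hasFDerivAt.comp_hasDerivAt t h1).deriv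

theorem deriv_comp_curve_zero {f : V → W} {γ : ℝ → V}
    (hf : ∀ᶠ q in 𝓝 (γ 0), ContDiffAt ℝ ∞ f q) (hγ : SmoothNearZero γ) :
    deriv (fun t => f (γ t)) 0 = fderiv ℝ f (γ 0) (deriv γ 0) :=
  (deriv_comp_curve hf hγ).self_of_nhds

theorem deriv_deriv_comp_curve {f : V → W} {γ : ℝ → V}
    (hf : ∀ᶠ q in 𝓝 (γ 0), ContDiffAt ℝ ∞ f q) (hγ : SmoothNearZero γ) :
    deriv (deriv (fun t => f (γ t))) 0 =
      fderiv ℝ (fderiv ℝ f) (γ 0) (deriv γ 0) (deriv γ 0) +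
        fderiv ℝ f (γ 0) (deriv (deriv γ) 0) := by
  have hf' : ∀ᶠ q in 𝓝 (γ 0), ContDiffAt ℝ ∞ (fderiv ℝ f) q := by
    filter_upwards [hf] with q h using h.fderiv_infty
  rw [(deriv_comp_curve hf hγ).deriv_eq]
  have h := (deriv_bilinear (ContinuousLinearMap.id ℝ (V →L[ℝ] W))
    (smoothNearZero_comp_curve hf' hγ) hγ.deriv).self_of_nhds
  simp only [ContinuousLinearMap.id_apply] at h
  rw [h, deriv_comp_curve_zero hf' hγ, add_comm]

/-- The third derivative along a curve with vanishing velocity. -/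
theorem deriv3_comp_curve {f : V → W} {γ : ℝ → V}
    (hf : ∀ᶠ q in 𝓝 (γ 0), ContDiffAt ℝ ∞ f q) (hγ : SmoothNearZero γ) (h0 : deriv γ 0 = 0) :
    deriv (deriv (deriv (fun t => f (γ t)))) 0 =
      fderiv ℝ f (γ 0) (deriv (deriv (deriv γ)) 0) := by
  have hf' : ∀ᶠ q in 𝓝 (γ 0), ContDiffAt ℝ ∞ (fderiv ℝ f) q := by
    filter_upwards [hf] with q h using h.fderiv_infty
  rw [(deriv_comp_curve hf hγ).deriv.deriv_eq]
  have h := deriv_deriv_bilinear (ContinuousLinearMap.id ℝ (V →L[ℝ] W))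
    (smoothNearZero_comp_curve hf' hγ) hγ.deriv
  simp only [ContinuousLinearMap.id_apply] at h
  rw [h, deriv_comp_curve_zero hf' hγ, h0]
  simp

/-- The line through `p` with direction `v`. -/
def lineAt (p v : V) (t : ℝ) : V := p + t • v

theorem lineAt_zero (p v : V) : lineAt p v 0 = p := by simp [lineAt]

theorem smoothNearZero_lineAt (p v : V) : SmoothNearZero (lineAt p v) :=
  (contDiff_const.add (contDiff_id.smul contDiff_const)).smoothNearZero

theorem deriv_lineAt (p v : V) : deriv (lineAt p v) = fun _ => v := by
  funext t
  have : HasDerivAt (lineAt p v) ((1 : ℝ) • v) t := ((hasDerivAt_id t).smul_const v).const_add p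
  rw [this.deriv, one_smul]

end

/-! ### The pairing of the normal with second derivatives, and its transformation rule -/

/-- The inner product as a continuous bilinear map. -/
def innerCLM : E 4 →L[ℝ] E 4 →L[ℝ] ℝ := innerSL ℝ

theorem innerCLM_apply (x y : E 4) : innerCLM x y = inner ℝ x y := rfl

/-- `f` and `ν` are smooth near `p` and `ν` is normal to the image of `df` there. -/
structure NormalAt (f ν : E 3 → E 4) (p : E 3) : Prop where
  smooth : ∀ᶠ q in 𝓝 p, ContDiffAt ℝ ∞ f q
  smooth_normal : ∀ᶠ q in 𝓝 p, ContDiffAt ℝ ∞ ν q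
  orthogonal : ∀ᶠ q in 𝓝 p, ∀ X : E 3, inner ℝ (fderiv ℝ f q X) (ν q) = 0

theorem IsNormal.normalAt {f ν : E 3 → E 4} (hf : IsMapGerm f) (hν : IsNormal f ν) :
    ∀ᶠ p in 𝓝 (0 : E 3), NormalAt f ν p := by
  filter_upwards [hf.smooth.eventually_nhds, hν.smooth.eventually_nhds,
    hν.orthogonal.eventually_nhds] with p h1 h2 h3 using ⟨h1, h2, h3⟩

/-- The pairing of the derivative of the normal with the second derivative of `f`, in the
direction `v`. -/
def normalPairing (f ν : E 3 → E 4) (p v : E 3) : ℝ :=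
  inner ℝ (fderiv ℝ ν p v) (fderiv ℝ (fderiv ℝ f) p v v)

theorem normalPairing_smul (f ν : E 3 → E 4) (p v : E 3) (a : ℝ) :
    normalPairing f ν p (a • v) = a ^ 3 * normalPairing f ν p v := by
  simp only [normalPairing, map_smul, smul_apply, real_inner_smul_left, real_inner_smul_right]
  ring

namespace NormalAt
variable {f ν : E 3 → E 4} {p v : E 3}

/-- With α = f∘γ, two derivatives of ⟨α', ν∘γ⟩ = 0 give ⟨α', (ν∘γ)''⟩ + 2⟨α'', (ν∘γ)'⟩ + ⟨α''', ν⟩ =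
0. The first term vanishes since α' = 0, and in the second the acceleration of γ drops out because
dν(γ') is orthogonal to the image of df. General curves are needed because a diffeomorphism bends
lines. -/
theorem inner_deriv_curve (h : NormalAt f ν p) {γ : ℝ → E 3} (hγ : SmoothNearZero γ)
    (h0 : γ 0 = p) (hv : fderiv ℝ f p (deriv γ 0) = 0)
    (hX : ∀ X, inner ℝ (fderiv ℝ f p X) (fderiv ℝ ν p (deriv γ 0)) = 0) :
    inner ℝ (deriv (deriv (deriv fun t => f (γ t))) 0) (ν p) =
      -2 * normalPairing f ν p (deriv γ 0) := by
  subst h0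
  have hα := smoothNearZero_comp_curve h.smooth hγ
  have hn := smoothNearZero_comp_curve h.smooth_normal hγ
  have hz : (fun t => innerCLM (deriv (fun t => f (γ t)) t) (ν (γ t))) =ᶠ[𝓝 0] fun _ => 0 := by
    filter_upwards [deriv_comp_curve h.smooth hγ, hγ.continuousAt.eventually h.orthogonal]
      with t h1 h2
    rw [innerCLM_apply, h1]
    exact h2 _
  have h2 := deriv_deriv_bilinear innerCLM hα.deriv hn
  rw [hz.deriv.deriv_eq, deriv_comp_curve_zero h.smooth hγ, hv,
    deriv_comp_curve_zero h.smooth_normal hγ, deriv_deriv_comp_curve h.smooth hγ] at h2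
  simp only [deriv_const', innerCLM_apply, inner_zero_left, inner_add_left, hX, smul_eq_mul] at h2
  rw [normalPairing, real_inner_comm]
  rw [real_inner_comm (fderiv ℝ ν (γ 0) (deriv γ 0))] at h2
  rw [real_inner_comm]
  linarith

/-- This is the derivative along v of ⟨df(X), ν⟩ = 0 for a constant vector X. -/
theorem inner_fderiv_add (h : NormalAt f ν p) (v X : E 3) :
    inner ℝ (fderiv ℝ f p X) (fderiv ℝ ν p v) +
      inner ℝ (fderiv ℝ (fderiv ℝ f) p v X) (ν p) = 0 := by
  have hz : (fun q => inner ℝ (fderiv ℝ f q X) (ν q)) =ᶠ[𝓝 p] fun _ => (0 : ℝ) := by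
    filter_upwards [h.orthogonal] with q hq using hq X
  have h1 : HasFDerivAt (fderiv ℝ f) (fderiv ℝ (fderiv ℝ f) p) p :=
    (h.smooth.self_of_nhds.fderiv_infty.differentiableAt (by simp)).hasFDerivAt
  have h2 := h1.clm_apply (hasFDerivAt_const X p)
  have h3 : HasFDerivAt ν (fderiv ℝ ν p) p :=
    (h.smooth_normal.self_of_nhds.differentiableAt (by simp)).hasFDerivAt
  have h4 := (h2.inner ℝ h3).congr_of_eventuallyEq hz.symm
  have h5 := congrArg (fun L : E 3 →L[ℝ] ℝ => L v) (h4.unique (hasFDerivAt_const (0 : ℝ) p))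
  simpa using h5

/-- If `d²f (X, v)` is in the image of `df` then the derivative of the normal along `v` is
orthogonal to `df (X)`. -/
theorem inner_fderiv_eq_zero (h : NormalAt f ν p) {X Y : E 3}
    (hXY : fderiv ℝ (fderiv ℝ f) p X v = fderiv ℝ f p Y) :
    inner ℝ (fderiv ℝ f p X) (fderiv ℝ ν p v) = 0 := by
  have h1 := h.inner_fderiv_add v X
  have hs : IsSymmSndFDerivAt ℝ f p := h.smooth.self_of_nhds.isSymmSndFDerivAt
    (by simpa using (WithTop.coe_le_coe.2 le_top : ((2 : ℕ∞) : ℕ∞ω) ≤ ∞))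
  rw [hs.eq, hXY, h.orthogonal.self_of_nhds Y, add_zero] at h1
  exact h1

theorem inner_snd_fderiv (h : NormalAt f ν p) (hv : fderiv ℝ f p v = 0) :
    inner ℝ (fderiv ℝ (fderiv ℝ f) p v v) (ν p) = 0 := by
  have h1 := h.inner_fderiv_add v v
  rwa [hv, inner_zero_left, zero_add] at h1

/-- How the pairing transforms under changes of coordinates. -/
theorem normalPairing_map {g ν' : E 3 → E 4} {φ : E 3 → E 3} {Φ : E 4 → E 4}
    (h : NormalAt f ν p) (h' : NormalAt g ν' (φ p))
    (hφ : ∀ᶠ q in 𝓝 p, ContDiffAt ℝ ∞ φ q) (hΦ : ∀ᶠ q in 𝓝 (f p), ContDiffAt ℝ ∞ Φ q)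
    (he : ∀ᶠ q in 𝓝 p, Φ (f q) = g (φ q)) (hv : fderiv ℝ f p v = 0)
    (hX : ∀ X, inner ℝ (fderiv ℝ f p X) (fderiv ℝ ν p v) = 0)
    (hX' : ∀ X, inner ℝ (fderiv ℝ g (φ p) X) (fderiv ℝ ν' (φ p) (fderiv ℝ φ p v)) = 0)
    {a b : E 3} (hdet : det4 (fderiv ℝ f p a) (fderiv ℝ f p b)
      (fderiv ℝ (fderiv ℝ f) p v v) (ν p) ≠ 0) :
    normalPairing g ν' (φ p) (fderiv ℝ φ p v) =
      inner ℝ (fderiv ℝ Φ (f p) (ν p)) (ν' (φ p)) / inner ℝ (ν p) (ν p) *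
        normalPairing f ν p v ∧
    ∀ y, inner ℝ (fderiv ℝ Φ (f p) y) (ν' (φ p)) =
      inner ℝ (fderiv ℝ Φ (f p) (ν p)) (ν' (φ p)) / inner ℝ (ν p) (ν p) * inner ℝ y (ν p) := by
  set γ := lineAt p v with hγdef
  have hγ : SmoothNearZero γ := smoothNearZero_lineAt p v
  have hγ0 : γ 0 = p := lineAt_zero p v
  have hγ' : deriv γ 0 = v := by rw [hγdef, deriv_lineAt]
  have hγ'' : deriv (deriv γ) 0 = 0 := by rw [hγdef, deriv_lineAt]; simp
  set α := fun t => f (γ t) with hα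
  have hfγ : ∀ᶠ q in 𝓝 (γ 0), ContDiffAt ℝ ∞ f q := by rw [hγ0]; exact h.smooth
  have hφγ : ∀ᶠ q in 𝓝 (γ 0), ContDiffAt ℝ ∞ φ q := by rw [hγ0]; exact hφ
  have hα0 : α 0 = f p := by rw [hα]; simp only [hγ0]
  have hαs : SmoothNearZero α := smoothNearZero_comp_curve hfγ hγ
  have hα1 : deriv α 0 = 0 := by
    rw [hα, deriv_comp_curve_zero hfγ hγ, hγ', hγ0, hv]
  have hα2 : deriv (deriv α) 0 = fderiv ℝ (fderiv ℝ f) p v v := by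
    rw [hα, deriv_deriv_comp_curve hfγ hγ, hγ', hγ0, hγ'']; simp
  set β := fun t => φ (γ t) with hβ
  have hβs : SmoothNearZero β := smoothNearZero_comp_curve hφγ hγ
  have hβ0 : β 0 = φ p := by rw [hβ]; simp only [hγ0]
  have hβ1 : deriv β 0 = fderiv ℝ φ p v := by
    rw [hβ, deriv_comp_curve_zero hφγ hγ, hγ', hγ0]
  have hΦα : ∀ᶠ q in 𝓝 (α 0), ContDiffAt ℝ ∞ Φ q := by rw [hα0]; exact hΦ
  have hgβ : ∀ᶠ q in 𝓝 (β 0), ContDiffAt ℝ ∞ g q := by rw [hβ0]; exact h'.smooth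
  have hcurve : (fun t => Φ (α t)) =ᶠ[𝓝 0] fun t => g (β t) := by
    have : ∀ᶠ q in 𝓝 (γ 0), Φ (f q) = g (φ q) := by rw [hγ0]; exact he
    exact hγ.continuousAt.eventually this
  have hL : ∀ X, ∃ Y, fderiv ℝ Φ (f p) (fderiv ℝ f p X) = fderiv ℝ g (φ p) Y := by
    intro X
    have d1 := (hΦ.self_of_nhds.differentiableAt (by simp)).hasFDerivAt.comp p
      (h.smooth.self_of_nhds.differentiableAt (by simp)).hasFDerivAt
    have d2 := (h'.smooth.self_of_nhds.differentiableAt (by simp)).hasFDerivAt.comp p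
      (hφ.self_of_nhds.differentiableAt (by simp)).hasFDerivAt
    have := d1.unique (d2.congr_of_eventuallyEq he)
    exact ⟨fderiv ℝ φ p X, congrArg (fun L : E 3 →L[ℝ] E 4 => L X) this⟩
  have hv' : fderiv ℝ g (φ p) (fderiv ℝ φ p v) = 0 := by
    have h1 := deriv_comp_curve_zero hgβ hβs
    rw [← hcurve.deriv_eq, deriv_comp_curve_zero hΦα hαs, hα1, hβ0, hβ1] at h1
    simpa using h1.symm
  have horth : ∀ X, inner ℝ (fderiv ℝ Φ (f p) (fderiv ℝ f p X)) (ν' (φ p)) = 0 := fun X => by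
    obtain ⟨Y, hY⟩ := hL X
    rw [hY]; exact h'.orthogonal.self_of_nhds Y
  -- Since α' = 0 at the point, the second derivative of Φ∘α there is dΦ(d²f(v, v)). Computed
  -- through g∘β it is d²g(β', β') + dg(β''), with β' in the kernel of dg, so both terms are
  -- orthogonal to ν'.
  have horth2 : inner ℝ (fderiv ℝ Φ (f p) (fderiv ℝ (fderiv ℝ f) p v v)) (ν' (φ p)) = 0 := by
    have h1 := deriv_deriv_comp_curve hgβ hβs
    rw [← hcurve.deriv.deriv_eq, deriv_deriv_comp_curve hΦα hαs, hα1, hα2, hα0, hβ0, hβ1] at h1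
    simp only [map_zero, zero_add] at h1
    rw [h1, inner_add_left, h'.inner_snd_fderiv hv', h'.orthogonal.self_of_nhds, add_zero]
  have hνp : ν p ≠ 0 := fun h0 => by
    have := (det4_ne_zero_iff _ _ _ _).1 hdet
    exact this.ne_zero 3 (by simpa using h0)
  have hνν : (inner ℝ (ν p) (ν p) : ℝ) ≠ 0 := by simpa using hνp
  set c : ℝ := inner ℝ (fderiv ℝ Φ (f p) (ν p)) (ν' (φ p)) / inner ℝ (ν p) (ν p) with hc
  -- The constant c is chosen so that l kills ν; l also kills the other three vectors of the frame
  -- in `hdet`, hence l = 0.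
  let l : E 4 →L[ℝ] ℝ := (innerSL ℝ (ν' (φ p))).comp (fderiv ℝ Φ (f p)) - c • innerSL ℝ (ν p)
  have hl : ∀ y, l y = inner ℝ (fderiv ℝ Φ (f p) y) (ν' (φ p)) - c * inner ℝ y (ν p) := fun y => by
    simp [l, real_inner_comm]
  have hl0 := linearMap_eq_zero_of_det4 hdet (l : E 4 →ₗ[ℝ] ℝ)
    (by rw [ContinuousLinearMap.coe_coe, hl, horth, h.orthogonal.self_of_nhds]; simp)
    (by rw [ContinuousLinearMap.coe_coe, hl, horth, h.orthogonal.self_of_nhds]; simp)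
    (by rw [ContinuousLinearMap.coe_coe, hl, horth2, h.inner_snd_fderiv hv]; simp)
    (by rw [ContinuousLinearMap.coe_coe, hl, hc]; field_simp; simp)
  have k1 := h.inner_deriv_curve hγ hγ0 (by rw [hγ', hv]) (by rw [hγ']; exact hX)
  have k2 := h'.inner_deriv_curve hβs hβ0 (by rw [hβ1, hv']) (by rw [hβ1]; exact hX')
  -- The third derivative of g∘β equals that of Φ∘α, which is dΦ(α''') because α' = 0. The factors
  -- -2 on the two sides then cancel.
  rw [← hcurve.deriv.deriv.deriv_eq, deriv3_comp_curve hΦα hαs hα1, hα0, hβ1] at k2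
  have hy : ∀ y, inner ℝ (fderiv ℝ Φ (f p) y) (ν' (φ p)) = c * inner ℝ y (ν p) := fun y => by
    have k3 := congrArg (fun L : E 4 →ₗ[ℝ] ℝ => L y) hl0
    simp only [ContinuousLinearMap.coe_coe, hl, LinearMap.zero_apply] at k3
    linarith
  refine ⟨?_, hy⟩
  have k3 := hy (deriv (deriv (deriv α)) 0)
  rw [hγ'] at k1
  rw [k2, k1] at k3
  linarith

end NormalAt

/-! ### Nondegenerate singularities -/

theorem exists_ne_zero_of_mem_singularSet {f : E 3 → E 4} {p : E 3} (hp : p ∈ singularSet f) :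
    ∃ v, v ≠ 0 ∧ fderiv ℝ f p v = 0 := by
  by_contra! h
  exact hp ((injective_iff_map_eq_zero _).2 fun v hv => by
    by_contra h0
    exact h v h0 hv)

theorem mem_singularSet_of_eq_zero {f : E 3 → E 4} {p v : E 3} (hv : v ≠ 0)
    (h : fderiv ℝ f p v = 0) : p ∈ singularSet f := fun hinj =>
  hv ((injective_iff_map_eq_zero _).1 hinj v h)

namespace IsSingularityIdentifier
variable {f : E 3 → E 4} {lam : E 3 → ℝ}

theorem smooth (h : IsSingularityIdentifier f lam) (hf : IsMapGerm f) : SmoothNearZero lam := by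
  obtain ⟨ν, k, hν, hk, -, he⟩ := h
  have hd : ∀ i : Fin 3, SmoothNearZero fun p => fderiv ℝ f p (basisVec i) := fun i =>
    hf.smooth.fderiv.clm_apply contDiff_const.smoothNearZero
  exact (hk.mul (smoothNearZero_det4 (hd 0) (hd 1) (hd 2) hν.smooth)).congr he

theorem eventually_eq_zero (h : IsSingularityIdentifier f lam) :
    ∀ᶠ p in 𝓝 (0 : E 3), p ∈ singularSet f → lam p = 0 := by
  obtain ⟨ν, k, hν, hk, -, he⟩ := h
  filter_upwards [he] with p hp hS
  obtain ⟨v, hv, hv0⟩ := exists_ne_zero_of_mem_singularSet hS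
  obtain ⟨X, Y, hXY⟩ := exists_det3_ne_zero hv
  have h1 := det4_map_eq (fderiv ℝ f p) X Y v (ν p)
  have h2 := det4_smul_third (fderiv ℝ f p X) (fderiv ℝ f p Y) 0 (ν p) 0
  rw [hv0] at h1
  rw [zero_smul, zero_mul] at h2
  rw [h2] at h1
  rw [hp, (mul_eq_zero.1 h1.symm).resolve_left hXY, mul_zero]

/-- The derivative of an identifier of singularities in a null direction does not vanish if and
only if the second derivative of `f` in this direction is not tangent to the image of `df`. -/
theorem fderiv_ne_zero_iff (h : IsSingularityIdentifier f lam) (hf : IsMapGerm f) {v : E 3}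
    (hv : v ≠ 0) (hker : LinearMap.ker (fderiv ℝ f 0 : E 3 →ₗ[ℝ] E 4) = Submodule.span ℝ {v}) :
    fderiv ℝ lam 0 v ≠ 0 ↔ ∀ Z, fderiv ℝ (fderiv ℝ f) 0 v v ≠ fderiv ℝ f 0 Z := by
  have hsm := h.smooth hf
  obtain ⟨ν, k, hν, hk, hk0, he⟩ := h
  have hνn : IsNormal f ν := ⟨hν.smooth, hν.norm_eq_one.mono fun p hp h0 => by simp [h0] at hp,
    hν.orthogonal⟩
  have hN : NormalAt f ν 0 := (hνn.normalAt hf).self_of_nhds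
  have hv0 : fderiv ℝ f 0 v = 0 := by
    have : v ∈ LinearMap.ker (fderiv ℝ f 0 : E 3 →ₗ[ℝ] E 4) := by
      rw [hker]; exact Submodule.mem_span_singleton_self v
    simpa using this
  obtain ⟨X, Y, hXY⟩ := exists_det3_ne_zero hv
  set F := fderiv ℝ f with hF
  have hFs : SmoothNearZero F := hf.smooth.fderiv
  -- the curve along the null direction
  have hγ : SmoothNearZero (lineAt 0 v) := smoothNearZero_lineAt 0 v
  have hγt : Tendsto (lineAt 0 v) (𝓝 0) (𝓝 0) := by
    have := hγ.continuousAt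
    rwa [ContinuousAt, lineAt_zero] at this
  have hcF : ∀ Z, Tendsto (fun t => F (lineAt 0 v t) Z) (𝓝[≠] 0) (𝓝 (F 0 Z)) := fun Z => by
    have h1 : Tendsto F (𝓝 0) (𝓝 (F 0)) := hFs.continuousAt
    have h2 := (ContinuousLinearMap.apply ℝ (E 4) Z).continuous.continuousAt.tendsto.comp
      (h1.comp hγt)
    exact h2.mono_left nhdsWithin_le_nhds
  have hslope : Tendsto (fun t : ℝ => t⁻¹ • F (lineAt 0 v t) v) (𝓝[≠] 0)
      (𝓝 (fderiv ℝ F 0 v v)) := by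
    have h1 : HasDerivAt (fun t => F (lineAt 0 v t) v) (fderiv ℝ F 0 v v) 0 := by
      have hd : HasFDerivAt F (fderiv ℝ F 0) (lineAt 0 v 0) := by
        rw [lineAt_zero]; exact hFs.differentiableAt.hasFDerivAt
      have h2 := hd.comp_hasDerivAt 0 hγ.hasDerivAt.self_of_nhds
      rw [deriv_lineAt] at h2
      simpa using h2.clm_apply (hasDerivAt_const 0 v)
    have h2 := hasDerivAt_iff_tendsto_slope_zero.1 h1
    simpa [lineAt_zero, hv0] using h2
  have hlam0 : lam 0 = 0 := by
    have h1 := det4_map_eq (F 0) X Y v (ν 0)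
    have h2 := det4_smul_third (F 0 X) (F 0 Y) 0 (ν 0) 0
    rw [hv0] at h1
    rw [zero_smul, zero_mul] at h2
    rw [h2] at h1
    rw [he.self_of_nhds, (mul_eq_zero.1 h1.symm).resolve_left hXY, mul_zero]
  have hlam : HasDerivAt (fun t => lam (lineAt 0 v t)) (fderiv ℝ lam 0 v) 0 := by
    have hd : HasFDerivAt lam (fderiv ℝ lam 0) (lineAt 0 v 0) := by
      rw [lineAt_zero]; exact hsm.differentiableAt.hasFDerivAt
    have h2 := hd.comp_hasDerivAt 0 hγ.hasDerivAt.self_of_nhds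
    rw [deriv_lineAt] at h2
    exact h2
  have hs1 := hasDerivAt_iff_tendsto_slope_zero.1 hlam
  simp only [zero_add, lineAt_zero, hlam0, sub_zero, smul_eq_mul] at hs1
  have hνt : Tendsto (fun t => ν (lineAt 0 v t)) (𝓝[≠] 0) (𝓝 (ν 0)) :=
    (hν.smooth.continuousAt.tendsto.comp hγt).mono_left nhdsWithin_le_nhds
  have hkt : Tendsto (fun t => k (lineAt 0 v t)) (𝓝[≠] 0) (𝓝 (k 0)) :=
    (hk.continuousAt.tendsto.comp hγt).mono_left nhdsWithin_le_nhds
  have hs2 := hkt.mul ((continuous_det4.tendsto (F 0 X, F 0 Y, fderiv ℝ F 0 v v, ν 0)).comp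
    ((hcF X).prodMk_nhds ((hcF Y).prodMk_nhds (hslope.prodMk_nhds hνt))))
  have hs3 := hs1.const_mul (det3 X Y v)
  -- Along the line t ↦ tv one has det(X, Y, v) · λ = k · det(df X, df Y, df v, ν). Both sides are
  -- divided by t, and df(v)/t tends to d²f(v, v) because df(v) = 0 at t = 0.
  have heq : det3 X Y v * fderiv ℝ lam 0 v = k 0 * det4 (F 0 X) (F 0 Y) (fderiv ℝ F 0 v v) (ν 0) := by
    refine tendsto_nhds_unique hs3 (hs2.congr' ?_)
    filter_upwards [(hγt.eventually he).filter_mono nhdsWithin_le_nhds] with t ht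
    simp only [Function.comp]
    rw [det4_smul_third, det4_map_eq, ht]
    ring
  have hiff : fderiv ℝ lam 0 v ≠ 0 ↔ det4 (F 0 X) (F 0 Y) (fderiv ℝ F 0 v v) (ν 0) ≠ 0 := by
    have : k 0 ≠ 0 := hk0.self_of_nhds
    constructor
    · intro h1 h2
      rw [h2, mul_zero] at heq
      exact (mul_ne_zero hXY h1) heq
    · intro h1 h2
      rw [h2, mul_zero] at heq
      exact (mul_ne_zero this h1) heq.symm
  have hind : ∀ s t : ℝ, s • F 0 X + t • F 0 Y = 0 → s = 0 ∧ t = 0 := by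
    intro s t hst
    have h1 : s • X + t • Y ∈ LinearMap.ker (F 0 : E 3 →ₗ[ℝ] E 4) := by
      simpa using hst
    rw [hker, Submodule.mem_span_singleton] at h1
    obtain ⟨c, hc⟩ := h1
    have hli : LinearIndependent ℝ ![X, Y, v] := linearIndependent_of_det3_ne_zero hXY
    rw [Fintype.linearIndependent_iff] at hli
    have := hli ![s, t, -c] (by
      simp only [Fin.sum_univ_three, Matrix.cons_val]
      rw [← hc]; module)
    exact ⟨this 0, this 1⟩
  rw [hiff]
  constructor
  · intro hne Z hZ
    obtain ⟨r, s, t, rfl⟩ := exists_eq_of_det3_ne_zero hXY Z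
    rw [hZ] at hne
    simp only [map_add, map_smul, hv0, smul_zero, add_zero] at hne
    exact hne (det4_add_smul_third _ _ _ _ _)
  · intro hZ
    refine det4_ne_zero_of_orthogonal hνn.ne_zero.self_of_nhds (hN.orthogonal.self_of_nhds X)
      (hN.orthogonal.self_of_nhds Y) (hN.inner_snd_fderiv hv0) hind fun s t hst => ?_
    exact hZ (s • X + t • Y) (by rw [hst]; simp)

end IsSingularityIdentifier

namespace IsSingularParametrization
variable {f : E 3 → E 4} {sig : E 2 → E 3}

theorem eventually_mem (h : IsSingularParametrization f sig) :
    ∀ᶠ u in 𝓝 (0 : E 2), sig u ∈ singularSet f := by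
  have : ∀ᶠ p in Filter.map sig (𝓝 0), p ∈ singularSet f := by
    rw [h.map_nhds]; exact eventually_mem_nhdsWithin
  exact this

theorem zero_mem (h : IsSingularParametrization f sig) : (0 : E 3) ∈ singularSet f := by
  have := h.eventually_mem.self_of_nhds
  rwa [h.germ.map_zero] at this

/-- The images of neighbourhoods under Σ are neighbourhoods in S(f), so a property that holds along
Σ holds at every singular point near 0. -/
theorem eventually_exists (h : IsSingularParametrization f sig) {P : E 2 → Prop}
    (hP : ∀ᶠ u in 𝓝 (0 : E 2), P u) :
    ∀ᶠ p in 𝓝 (0 : E 3), p ∈ singularSet f → ∃ u, sig u = p ∧ P u := by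
  have : sig '' {u | P u} ∈ Filter.map sig (𝓝 0) := Filter.image_mem_map hP
  rw [h.map_nhds, mem_nhdsWithin_iff_eventually] at this
  filter_upwards [this] with p hp hS
  obtain ⟨u, hu, rfl⟩ := hp hS
  exact ⟨u, rfl, hu⟩

end IsSingularParametrization

theorem IsNullVectorField.eventually_ne_zero {f : E 3 → E 4} {η : E 3 → E 3}
    (h : IsNullVectorField f η) :
    ∀ᶠ p in 𝓝 (0 : E 3), p ∈ singularSet f → fderiv ℝ f p (η p) = 0 ∧ η p ≠ 0 := by
  filter_upwards [h.ker_eq_span] with p hp hS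
  have h1 : η p ∈ LinearMap.ker (fderiv ℝ f p : E 3 →ₗ[ℝ] E 4) := by
    rw [hp hS]; exact Submodule.mem_span_singleton_self _
  refine ⟨by simpa using h1, fun h0 => ?_⟩
  obtain ⟨v, hv, hv0⟩ := exists_ne_zero_of_mem_singularSet hS
  have h2 : v ∈ LinearMap.ker (fderiv ℝ f p : E 3 →ₗ[ℝ] E 4) := by simpa using hv0
  rw [hp hS, h0] at h2
  exact hv (by simpa using h2)

namespace IsChoice
variable {f ν : E 3 → E 4} {lam : E 3 → ℝ} {η : E 3 → E 3} {sig : E 2 → E 3}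

theorem null_zero (h : IsChoice f ν lam η sig) : fderiv ℝ f 0 (η 0) = 0 ∧ η 0 ≠ 0 :=
  h.null.eventually_ne_zero.self_of_nhds h.param.zero_mem

theorem nondegenerate_iff (h : IsChoice f ν lam η sig) (hf : IsMapGerm f) :
    vderiv η lam 0 ≠ 0 ↔
      ∀ Z, fderiv ℝ (fderiv ℝ f) 0 (η 0) (η 0) ≠ fderiv ℝ f 0 Z :=
  h.identifier.fderiv_ne_zero_iff hf h.null_zero.2
    (h.null.ker_eq_span.self_of_nhds h.param.zero_mem)

theorem fderiv_lam_comp (h : IsChoice f ν lam η sig) (hf : IsMapGerm f) (w : E 2) :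
    fderiv ℝ lam 0 (fderiv ℝ sig 0 w) = 0 := by
  have hz : (fun u => lam (sig u)) =ᶠ[𝓝 0] fun _ => 0 := by
    filter_upwards [h.param.germ.tendsto.eventually h.identifier.eventually_eq_zero,
      h.param.eventually_mem] with u h1 h2 using h1 h2
  have hd : HasFDerivAt lam (fderiv ℝ lam 0) (sig 0) := by
    rw [h.param.germ.map_zero]; exact (h.identifier.smooth hf).differentiableAt.hasFDerivAt
  have h1 := (hd.comp 0 h.param.germ.hasFDerivAt).congr_of_eventuallyEq hz.symm
  exact congrArg (fun L : E 2 →L[ℝ] ℝ => L w) (h1.unique (hasFDerivAt_const 0 0))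

/-- The differential dλ kills the tangent plane of Σ, since λ vanishes on S(f), but it does not kill
η. -/
theorem transversal (h : IsChoice f ν lam η sig) (hf : IsMapGerm f)
    (hnd : vderiv η lam 0 ≠ 0) {w : E 2} {c : ℝ} (hw : fderiv ℝ sig 0 w + c • η 0 = 0) :
    w = 0 ∧ c = 0 := by
  have h1 := congrArg (fderiv ℝ lam 0) hw
  rw [map_add, h.fderiv_lam_comp hf, map_smul, map_zero, zero_add, smul_eq_mul] at h1
  have hc : c = 0 := (mul_eq_zero.1 h1).resolve_right hnd
  rw [hc, zero_smul, add_zero] at hw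
  exact ⟨(injective_iff_map_eq_zero _).1 h.param.immersion w hw, hc⟩

/-- Transversality at 0 is injectivity of the map (w, c) ↦ dΣ(w) + cη. This is an open condition,
and between spaces of dimension 3 it implies surjectivity. -/
theorem eventually_cover (h : IsChoice f ν lam η sig) (hf : IsMapGerm f)
    (hnd : vderiv η lam 0 ≠ 0) :
    ∀ᶠ u in 𝓝 (0 : E 2), ∀ X, ∃ (w : E 2) (c : ℝ), X = fderiv ℝ sig u w + c • η (sig u) := by
  let L : E 2 → (E 2 × ℝ) →L[ℝ] E 3 := fun u => (fderiv ℝ sig u).coprod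
    (ContinuousLinearMap.toSpanSingleton ℝ (η (sig u)))
  have hLc : ContinuousAt L 0 := by
    have h1 : ContinuousAt (fun u => fderiv ℝ sig u) 0 := h.param.germ.smooth.fderiv.continuousAt
    have h2 : ContinuousAt (fun u => η (sig u)) 0 :=
      (h.null.smooth.comp h.param.germ.smooth h.param.germ.map_zero).continuousAt
    have e : L = fun u => (fderiv ℝ sig u).comp (ContinuousLinearMap.fst ℝ (E 2) ℝ) +
        (ContinuousLinearMap.snd ℝ (E 2) ℝ).smulRight (η (sig u)) := by
      funext u; ext x <;> simp [L]
    rw [e]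
    refine (h1.clm_comp continuousAt_const).add ?_
    exact ((ContinuousLinearMap.smulRightL ℝ (E 2 × ℝ) (E 3)
      (ContinuousLinearMap.snd ℝ (E 2) ℝ)).continuous.continuousAt).comp h2
  have hinj : Function.Injective (L 0) := by
    refine (injective_iff_map_eq_zero _).2 fun x hx => ?_
    simp only [L, ContinuousLinearMap.coprod_apply, ContinuousLinearMap.toSpanSingleton_apply, h.param.germ.map_zero] at hx
    obtain ⟨h1, h2⟩ := h.transversal hf hnd hx
    exact Prod.ext h1 h2
  filter_upwards [hLc.eventually
    ((ContinuousLinearMap.isOpen_injective (𝕜 := ℝ)).mem_nhds hinj)] with u hu X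
  have hs : Function.Surjective (L u : (E 2 × ℝ) →ₗ[ℝ] E 3) :=
    (LinearMap.injective_iff_surjective_of_finrank_eq_finrank (by simp)).1 hu
  obtain ⟨x, hx⟩ := hs X
  exact ⟨x.1, x.2, by rw [← hx]; simp [L]⟩

/-- Differentiating df(η) = 0 along S(f) puts d²f(X, η) in the image of df for every X tangent to
S(f), which makes ην orthogonal to df(X). The remaining direction η is killed by df. -/
theorem eventually_orthogonal (h : IsChoice f ν lam η sig) (hf : IsMapGerm f)
    (hnd : vderiv η lam 0 ≠ 0) :
    ∀ᶠ u in 𝓝 (0 : E 2), ∀ X,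
      inner ℝ (fderiv ℝ f (sig u) X) (fderiv ℝ ν (sig u) (η (sig u))) = 0 := by
  have hnull : ∀ᶠ u in 𝓝 (0 : E 2), fderiv ℝ f (sig u) (η (sig u)) = 0 := by
    filter_upwards [h.param.germ.tendsto.eventually h.null.eventually_ne_zero,
      h.param.eventually_mem] with u h1 h2 using (h1 h2).1
  filter_upwards [h.eventually_cover hf hnd, hnull.eventually_nhds, h.param.germ.smooth,
    h.param.germ.tendsto.eventually (h.normal.normalAt hf),
    h.param.germ.tendsto.eventually h.null.smooth] with u h1 h2 h3 h4 h5 X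
  obtain ⟨w, c, rfl⟩ := h1 X
  rw [map_add, map_smul, h2.self_of_nhds, smul_zero, add_zero]
  have hs := (h3.differentiableAt (by simp)).hasFDerivAt
  have d1 := ((h4.smooth.self_of_nhds.fderiv_infty.differentiableAt
    (by simp)).hasFDerivAt.comp u hs).clm_apply
    ((h5.differentiableAt (by simp)).hasFDerivAt.comp u hs)
  have d2 := d1.unique ((hasFDerivAt_const (0 : E 4) u).congr_of_eventuallyEq h2)
  have d3 := congrArg (fun L : E 2 →L[ℝ] E 4 => L w) d2
  simp only [add_apply, ContinuousLinearMap.comp_apply,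
    ContinuousLinearMap.flip_apply, zero_apply, Function.comp] at d3
  refine h4.inner_fderiv_eq_zero (Y := -(fderiv ℝ η (sig u) (fderiv ℝ sig u w))) ?_
  rw [map_neg]
  exact eq_neg_of_add_eq_zero_right d3

/-- The determinant that controls nondegeneracy along the singular set. -/
def frameDet (f ν : E 3 → E 4) (η : E 3 → E 3) (sig : E 2 → E 3) (u : E 2) : ℝ :=
  det4 (fderiv ℝ f (sig u) (fderiv ℝ sig u (basisVec 0)))
    (fderiv ℝ f (sig u) (fderiv ℝ sig u (basisVec 1)))
    (fderiv ℝ (fderiv ℝ f) (sig u) (η (sig u)) (η (sig u))) (ν (sig u))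

/-- A combination in the kernel of df would be tangent to S(f) and a multiple of η, against
transversality. -/
theorem independent_tangent (h : IsChoice f ν lam η sig) (hf : IsMapGerm f)
    (hnd : vderiv η lam 0 ≠ 0) (s t : ℝ)
    (hst : s • fderiv ℝ f 0 (fderiv ℝ sig 0 (basisVec 0)) +
      t • fderiv ℝ f 0 (fderiv ℝ sig 0 (basisVec 1)) = 0) : s = 0 ∧ t = 0 := by
  have h1 : fderiv ℝ sig 0 (s • basisVec 0 + t • basisVec 1) ∈
      LinearMap.ker (fderiv ℝ f 0 : E 3 →ₗ[ℝ] E 4) := by simpa using hst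
  rw [h.null.ker_eq_span.self_of_nhds h.param.zero_mem, Submodule.mem_span_singleton] at h1
  obtain ⟨c, hc⟩ := h1
  have h2 := (h.transversal hf hnd (c := -c)
    (w := s • basisVec 0 + t • basisVec 1) (by rw [← hc]; module)).1
  have h3 := congrArg (fun x : E 2 => x 0) h2
  have h4 := congrArg (fun x : E 2 => x 1) h2
  simp [basisVec] at h3 h4
  exact ⟨h3, h4⟩

theorem frameDet_zero (h : IsChoice f ν lam η sig) (hf : IsMapGerm f)
    (hnd : vderiv η lam 0 ≠ 0) : frameDet f ν η sig 0 ≠ 0 := by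
  have hN := (h.normal.normalAt hf).self_of_nhds
  rw [frameDet, h.param.germ.map_zero]
  refine det4_ne_zero_of_orthogonal h.normal.ne_zero.self_of_nhds (hN.orthogonal.self_of_nhds _)
      (hN.orthogonal.self_of_nhds _) (hN.inner_snd_fderiv h.null_zero.1)
      (h.independent_tangent hf hnd) fun s t hst => ?_
  exact (h.nondegenerate_iff hf).1 hnd (s • fderiv ℝ sig 0 (basisVec 0) +
    t • fderiv ℝ sig 0 (basisVec 1)) (by rw [hst]; simp)

theorem smooth_tangent (h : IsChoice f ν lam η sig) (hf : IsMapGerm f) (i : Fin 2) :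
    SmoothNearZero fun u => fderiv ℝ f (sig u) (fderiv ℝ sig u (basisVec i)) :=
  (hf.smooth.fderiv.comp h.param.germ.smooth h.param.germ.map_zero).clm_apply
    (h.param.germ.smooth.fderiv.clm_apply contDiff_const.smoothNearZero)

theorem smooth_frameDet (h : IsChoice f ν lam η sig) (hf : IsMapGerm f) :
    SmoothNearZero (frameDet f ν η sig) := by
  have hη := h.null.smooth.comp h.param.germ.smooth h.param.germ.map_zero
  exact smoothNearZero_det4 (h.smooth_tangent hf 0) (h.smooth_tangent hf 1)
    (((hf.smooth.fderiv.fderiv.comp h.param.germ.smooth h.param.germ.map_zero).clm_apply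
      hη).clm_apply hη) (h.normal.smooth.comp h.param.germ.smooth h.param.germ.map_zero)

theorem smooth_normalPairing (h : IsChoice f ν lam η sig) (hf : IsMapGerm f) :
    SmoothNearZero fun p => normalPairing f ν p (η p) :=
  (h.normal.smooth.fderiv.clm_apply h.null.smooth).inner
    ((hf.smooth.fderiv.fderiv.clm_apply h.null.smooth).clm_apply h.null.smooth)

end IsChoice

/-! ### Invariance of the condition on `ψ` -/

/-- Multiplying by a continuous unit does not change the order-one vanishing of a function. -/
theorem simpleZero_congr {F G c : E 2 → ℝ} (h : ∀ᶠ u in 𝓝 (0 : E 2), F u = c u * G u)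
    (hc : ContinuousAt c 0) (hc0 : c 0 ≠ 0) (hG : DifferentiableAt ℝ G 0) :
    (F 0 = 0 ∧ fderiv ℝ F 0 ≠ 0) ↔ (G 0 = 0 ∧ fderiv ℝ G 0 ≠ 0) := by
  have h0 := h.self_of_nhds
  by_cases hG0 : G 0 = 0
  -- At a zero of G the product cG has derivative c(0) dG even when c is only continuous: cG - c(0)
  -- dG = c (G - dG) + (c - c(0)) dG, with dG taken at 0.
  · have hd : HasFDerivAt F (c 0 • fderiv ℝ G 0) 0 := by
      refine HasFDerivAt.congr_of_eventuallyEq ?_ h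
      have h1 := hG.hasFDerivAt
      rw [hasFDerivAt_iff_isLittleO_nhds_zero] at h1 ⊢
      simp only [zero_add, hG0, mul_zero, sub_zero] at h1 ⊢
      have h2 : (fun u => c u * (G u - fderiv ℝ G 0 u)) =o[𝓝 0] fun u => u := by
        have := hc.tendsto.isBigO_one ℝ |>.mul_isLittleO h1.norm_right
        exact Asymptotics.IsLittleO.of_norm_right (by simpa using this)
      have h3 : (fun u => (c u - c 0) * fderiv ℝ G 0 u) =o[𝓝 0] fun u => u := by
        have h4 : (fun u => c u - c 0) =o[𝓝 0] fun _ => (1 : ℝ) := by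
          rw [Asymptotics.isLittleO_one_iff]
          simpa using hc.tendsto.sub_const (c 0)
        have := h4.mul_isBigO ((fderiv ℝ G 0).isBigO_id (𝓝 0)).norm_right
        exact Asymptotics.IsLittleO.of_norm_right (by simpa using this)
      refine (h2.add h3).congr_left fun u => ?_
      simp only [smul_apply, smul_eq_mul]
      ring
    rw [hd.fderiv, h0, hG0]
    simp [hc0]
  · simp [h0, hG0, hc0]

/-- Both ranges are the 2-dimensional kernel of l. -/
theorem range_eq_of_comp_eq_zero {A B : E 2 →L[ℝ] E 3} {l : E 3 →L[ℝ] ℝ} (hl : l ≠ 0)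
    (hA : Function.Injective A) (hB : Function.Injective B) (hlA : ∀ w, l (A w) = 0)
    (hlB : ∀ w, l (B w) = 0) :
    LinearMap.range (A : E 2 →ₗ[ℝ] E 3) = LinearMap.range (B : E 2 →ₗ[ℝ] E 3) := by
  have hker : Module.finrank ℝ (LinearMap.ker (l : E 3 →ₗ[ℝ] ℝ)) = 2 := by
    have h1 := LinearMap.finrank_range_add_finrank_ker (l : E 3 →ₗ[ℝ] ℝ)
    have h2 : LinearMap.range (l : E 3 →ₗ[ℝ] ℝ) = ⊤ := by
      rw [LinearMap.range_eq_top]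
      exact LinearMap.surjective (by
        intro h; exact hl (by ext x; simpa using congrArg (fun L : E 3 →ₗ[ℝ] ℝ => L x) h))
    rw [h2] at h1
    simp at h1
    omega
  have key : ∀ A : E 2 →L[ℝ] E 3, Function.Injective A → (∀ w, l (A w) = 0) →
      LinearMap.range (A : E 2 →ₗ[ℝ] E 3) = LinearMap.ker (l : E 3 →ₗ[ℝ] ℝ) := by
    intro A hA hlA
    refine Submodule.eq_of_le_of_finrank_eq ?_ ?_
    · rintro _ ⟨w, rfl⟩
      simpa using hlA w
    · rw [hker, LinearMap.finrank_range_of_inj hA]; simp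
  rw [key A hA hlA, key B hB hlB]

namespace IsChoice
variable {f ν : E 3 → E 4} {lam : E 3 → ℝ} {η : E 3 → E 3} {sig : E 2 → E 3}

/-- By `det4_mul_det4_of_orthogonal`, ψ times the nonvanishing `frameDet` is N∘Σ times the Gram
determinant of the tangent vectors and |ν|², up to sign. A nonvanishing continuous factor does not
affect a simple zero. -/
theorem psiCondition_iff_normalPairing (h : IsChoice f ν lam η sig) (hf : IsMapGerm f)
    (hnd : vderiv η lam 0 ≠ 0) :
    PsiCondition f ν η sig ↔ (normalPairing f ν (sig 0) (η (sig 0)) = 0 ∧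
      fderiv ℝ (fun u => normalPairing f ν (sig u) (η (sig u))) 0 ≠ 0) := by
  set a : Fin 2 → E 2 → E 4 := fun i u => fderiv ℝ f (sig u) (fderiv ℝ sig u (basisVec i)) with ha
  have has : ∀ i, SmoothNearZero (a i) := h.smooth_tangent hf
  have hνs := h.normal.smooth.comp h.param.germ.smooth h.param.germ.map_zero
  have hδ := h.frameDet_zero hf hnd
  have hδc := (h.smooth_frameDet hf).continuousAt
  set G : E 2 → ℝ := fun u => inner ℝ (a 0 u) (a 0 u) * inner ℝ (a 1 u) (a 1 u) -
    inner ℝ (a 0 u) (a 1 u) ^ 2 with hG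
  have hGc : ContinuousAt G 0 :=
    (((has 0).inner (has 0)).continuousAt.mul ((has 1).inner (has 1)).continuousAt).sub
      (((has 0).inner (has 1)).continuousAt.pow 2)
  have hG0 : G 0 ≠ 0 := by
    refine gram_ne_zero ?_
    simp only [ha, h.param.germ.map_zero]
    exact h.independent_tangent hf hnd
  have hν0 : (inner ℝ (ν (sig 0)) (ν (sig 0)) : ℝ) ≠ 0 := by
    rw [h.param.germ.map_zero]
    simpa using h.normal.ne_zero.self_of_nhds
  refine simpleZero_congr
    (c := fun u => -(G u) * inner ℝ (ν (sig u)) (ν (sig u)) / frameDet f ν η sig u) ?_ ?_ ?_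
    ((h.smooth_normalPairing hf).comp h.param.germ.smooth h.param.germ.map_zero).differentiableAt
  · filter_upwards [hδc.eventually_ne hδ, h.param.germ.tendsto.eventually (h.normal.normalAt hf),
      h.eventually_orthogonal hf hnd, h.param.germ.smooth,
      h.param.germ.tendsto.eventually h.null.eventually_ne_zero, h.param.eventually_mem]
      with u h1 h2 h3 h4 h5 h6
    have hN := h2.orthogonal.self_of_nhds
    have hcomp : ∀ i, fderiv ℝ (f ∘ sig) u (basisVec i) = a i u := fun i => by
      rw [((h2.smooth.self_of_nhds.differentiableAt (by simp)).hasFDerivAt.comp u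
        (h4.differentiableAt (by simp)).hasFDerivAt).fderiv]
      rfl
    have key := det4_mul_det4_of_orthogonal (a := a 0 u) (b := a 1 u)
      (c := fderiv ℝ (fderiv ℝ f) (sig u) (η (sig u)) (η (sig u))) (n := ν (sig u))
      (m := vderiv η ν (sig u)) (hN _) (hN _) (h2.inner_snd_fderiv (h5 h6).1) (h3 _) (h3 _)
    rw [psi, hcomp, hcomp, div_mul_eq_mul_div, eq_div_iff h1]
    exact key
  · exact ((hGc.neg.mul (hνs.inner hνs).continuousAt).div hδc hδ)
  · exact div_ne_zero (mul_ne_zero (neg_ne_zero.2 hG0) hν0) hδ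

end IsChoice

section
variable {f g : E 3 → E 4} {φ : E 3 → E 3} {Φ : E 4 → E 4}

theorem fderiv_comp_eq (hf : IsMapGerm f) (hg : IsMapGerm g) (hφ : IsDiffeoGerm φ)
    (hΦ : IsDiffeoGerm Φ) (he : ∀ᶠ p in 𝓝 (0 : E 3), Φ (f p) = g (φ p)) :
    ∀ᶠ p in 𝓝 (0 : E 3), ∀ X,
      fderiv ℝ Φ (f p) (fderiv ℝ f p X) = fderiv ℝ g (φ p) (fderiv ℝ φ p X) := by
  filter_upwards [hf.smooth, hφ.1.smooth, hf.tendsto.eventually hΦ.1.smooth,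
    hφ.1.tendsto.eventually hg.smooth, he.eventually_nhds] with p h1 h2 h3 h4 h5 X
  have d1 := (h3.differentiableAt (by simp)).hasFDerivAt.comp p
    (h1.differentiableAt (by simp)).hasFDerivAt
  have d2 := (h4.differentiableAt (by simp)).hasFDerivAt.comp p
    (h2.differentiableAt (by simp)).hasFDerivAt
  exact congrArg (fun L : E 3 →L[ℝ] E 4 => L X) (d1.unique (d2.congr_of_eventuallyEq h5))

theorem mem_singularSet_iff (hf : IsMapGerm f) (hg : IsMapGerm g) (hφ : IsDiffeoGerm φ)
    (hΦ : IsDiffeoGerm Φ) (he : ∀ᶠ p in 𝓝 (0 : E 3), Φ (f p) = g (φ p)) :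
    ∀ᶠ p in 𝓝 (0 : E 3), p ∈ singularSet f ↔ φ p ∈ singularSet g := by
  filter_upwards [fderiv_comp_eq hf hg hφ hΦ he,
    eventually_injective_fderiv hφ.1.smooth hφ.injective_fderiv,
    hf.tendsto.eventually (eventually_injective_fderiv hΦ.1.smooth hΦ.injective_fderiv)]
    with p h1 h2 h3
  constructor <;> intro hS
  · obtain ⟨v, hv, hv0⟩ := exists_ne_zero_of_mem_singularSet hS
    refine mem_singularSet_of_eq_zero (v := fderiv ℝ φ p v) ?_ (by rw [← h1, hv0, map_zero])
    exact fun h => hv ((injective_iff_map_eq_zero _).1 h2 v h)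
  · obtain ⟨v, hv, hv0⟩ := exists_ne_zero_of_mem_singularSet hS
    obtain ⟨e, he⟩ := exists_equiv_of_injective h2
    have hw : fderiv ℝ φ p (e.symm v) = v := by rw [← he]; simp
    refine mem_singularSet_of_eq_zero (v := e.symm v) (by simpa using hv) ?_
    refine (injective_iff_map_eq_zero _).1 h3 _ ?_
    rw [h1, hw, hv0]

/-- Along a line with velocity v in the kernel of df, the second derivative of Φ∘f is dΦ(d²f(v, v)),
and it equals d²g(dφ v, dφ v) up to a vector in the image of dg. The isomorphism dΦ matches the
images of df and dg. -/
theorem snd_fderiv_comp_ne (hf : IsMapGerm f) (hg : IsMapGerm g) (hφ : IsDiffeoGerm φ)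
    (hΦ : IsDiffeoGerm Φ) (he : ∀ᶠ p in 𝓝 (0 : E 3), Φ (f p) = g (φ p)) {v : E 3}
    (hv : fderiv ℝ f 0 v = 0)
    (h : ∀ Z, fderiv ℝ (fderiv ℝ f) 0 v v ≠ fderiv ℝ f 0 Z) (Z : E 3) :
    fderiv ℝ (fderiv ℝ g) 0 (fderiv ℝ φ 0 v) (fderiv ℝ φ 0 v) ≠ fderiv ℝ g 0 Z := by
  intro hZ
  set γ := lineAt (0 : E 3) v with hγdef
  have hγ : SmoothNearZero γ := smoothNearZero_lineAt 0 v
  have hγ0 : γ 0 = 0 := lineAt_zero 0 v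
  have hγ' : deriv γ 0 = v := by rw [hγdef, deriv_lineAt]
  have hγ'' : deriv (deriv γ) 0 = 0 := by rw [hγdef, deriv_lineAt]; simp
  have e1 := deriv_deriv_comp_curve (f := f) (γ := γ) (by rw [hγ0]; exact hf.smooth) hγ
  have e2 := deriv_comp_curve_zero (f := f) (γ := γ) (by rw [hγ0]; exact hf.smooth) hγ
  have e3 := deriv_deriv_comp_curve (f := Φ) (γ := fun t => f (γ t))
    (by simp only [hγ0, hf.map_zero]; exact hΦ.1.smooth) (hf.smooth.comp hγ hγ0)
  have e4 := deriv_comp_curve_zero (f := φ) (γ := γ) (by rw [hγ0]; exact hφ.1.smooth) hγ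
  have e5 := deriv_deriv_comp_curve (f := g) (γ := fun t => φ (γ t))
    (by simp only [hγ0, hφ.1.map_zero]; exact hg.smooth) (hφ.1.smooth.comp hγ hγ0)
  have hcurve : (fun t => Φ (f (γ t))) =ᶠ[𝓝 0] fun t => g (φ (γ t)) := by
    have : ∀ᶠ q in 𝓝 (γ 0), Φ (f q) = g (φ q) := by rw [hγ0]; exact he
    exact hγ.continuousAt.eventually this
  rw [hγ', hγ0, hv] at e2
  rw [e1, e2, ← e1] at e3
  rw [e4, hγ', ← hcurve.deriv.deriv_eq, e3, e1, hγ', hγ'', hγ0, hf.map_zero, hφ.1.map_zero, hZ] at e5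
  simp only [map_zero, zero_add, add_zero] at e5
  rw [← map_add] at e5
  obtain ⟨e, hequiv⟩ := exists_equiv_of_injective hφ.injective_fderiv
  set Y := Z + deriv (deriv fun t => φ (γ t)) 0 with hY
  have hw : fderiv ℝ φ 0 (e.symm Y) = Y := by rw [← hequiv]; simp
  have k := (fderiv_comp_eq hf hg hφ hΦ he).self_of_nhds (e.symm Y)
  rw [hw, hφ.1.map_zero, hf.map_zero, ← e5] at k
  exact h _ (hΦ.injective_fderiv k.symm)

end

/-- The nondegeneracy condition and the condition on `ψ` are invariant under `𝒜`-equivalence and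
independent of all choices. -/
theorem IsChoice.invariance {f ν g ν' : E 3 → E 4} {lam lam' : E 3 → ℝ} {η η' : E 3 → E 3}
    {sig sig' : E 2 → E 3} (hf : IsMapGerm f) (h : IsChoice f ν lam η sig)
    (hnd : vderiv η lam 0 ≠ 0) (hfg : AEquiv f g) (h' : IsChoice g ν' lam' η' sig') :
    vderiv η' lam' 0 ≠ 0 ∧ (PsiCondition g ν' η' sig' ↔ PsiCondition f ν η sig) := by
  have hg := hfg.isMapGerm hf
  obtain ⟨φ, Φ, hφ, hΦ, he⟩ := hfg
  have hS := mem_singularSet_iff hf hg hφ hΦ he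
  have hD := fderiv_comp_eq hf hg hφ hΦ he
  -- the null direction of `g` at the image of a singular point
  have hnull : ∀ᶠ p in 𝓝 (0 : E 3), p ∈ singularSet f → φ p ∈ singularSet g ∧
      fderiv ℝ φ p (η p) ≠ 0 ∧ fderiv ℝ φ p (η p) =
      ((inner ℝ (fderiv ℝ φ p (η p)) (η' (φ p)) : ℝ) / inner ℝ (η' (φ p)) (η' (φ p))) • η' (φ p) := by
    filter_upwards [hS, hD, h.null.eventually_ne_zero,
      eventually_injective_fderiv hφ.1.smooth hφ.injective_fderiv,
      hφ.1.tendsto.eventually h'.null.ker_eq_span,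
      hφ.1.tendsto.eventually h'.null.eventually_ne_zero] with p h1 h2 h3 h4 h5 h6 hp
    have hp' := h1.1 hp
    refine ⟨hp', fun h0 => (h3 hp).2 ((injective_iff_map_eq_zero _).1 h4 _ h0), ?_⟩
    have hk : fderiv ℝ φ p (η p) ∈ LinearMap.ker (fderiv ℝ g (φ p) : E 3 →ₗ[ℝ] E 4) := by
      rw [LinearMap.mem_ker, ContinuousLinearMap.coe_coe, ← h2, (h3 hp).1, map_zero]
    rw [h5 hp', Submodule.mem_span_singleton] at hk
    obtain ⟨c, hc⟩ := hk
    have hne : (inner ℝ (η' (φ p)) (η' (φ p)) : ℝ) ≠ 0 := by simpa using (h6 hp').2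
    rw [← hc, real_inner_smul_left, mul_div_assoc, div_self hne, mul_one]
  have hnd' : vderiv η' lam' 0 ≠ 0 := by
    rw [h'.nondegenerate_iff hg]
    have h1 := (h.nondegenerate_iff hf).1 hnd
    obtain ⟨-, h2, h3⟩ := hnull.self_of_nhds h.param.zero_mem
    have h4 := snd_fderiv_comp_ne hf hg hφ hΦ he h.null_zero.1 h1
    rw [hφ.1.map_zero] at h3
    intro Z hZ
    set a : ℝ := (inner ℝ (fderiv ℝ φ 0 (η 0)) (η' 0) : ℝ) / inner ℝ (η' 0) (η' 0)
    refine h4 (a ^ 2 • Z) ?_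
    rw [h3]
    simp only [map_smul, smul_apply, hZ, smul_smul, sq]
  refine ⟨hnd', ?_⟩
  rw [h.psiCondition_iff_normalPairing hf hnd, h'.psiCondition_iff_normalPairing hg hnd']
  have hsig0 := h.param.germ.map_zero
  have hsig0' := h'.param.germ.map_zero
  have hφ0 := hφ.1.map_zero
  set R : E 3 → ℝ := fun q => normalPairing g ν' q (η' q) with hR
  have hRs : SmoothNearZero R := h'.smooth_normalPairing hg
  -- comparison along the singular set of `f`
  have hφsig : IsMapGerm fun u => φ (sig u) := hφ.1.comp h.param.germ
  set w : E 2 → E 3 := fun u => fderiv ℝ φ (sig u) (η (sig u)) with hw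
  have hws : SmoothNearZero w :=
    (hφ.1.smooth.fderiv.clm_apply h.null.smooth).comp h.param.germ.smooth hsig0
  have hη's : SmoothNearZero fun u => η' (φ (sig u)) := h'.null.smooth.comp hφsig.smooth (by rw [hsig0, hφ0])
  -- The ratio of dφ(η) to η' is written with inner products so that its continuity in u is visible;
  -- the same is done below for the factor c of the normals.
  set a : E 2 → ℝ := fun u => inner ℝ (w u) (η' (φ (sig u))) /
    inner ℝ (η' (φ (sig u))) (η' (φ (sig u))) with ha
  have hac : ContinuousAt a 0 := by
    refine (hws.inner hη's).continuousAt.div (hη's.inner hη's).continuousAt ?_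
    rw [hsig0, hφ0]
    simpa using h'.null_zero.2
  have ha0 : a 0 ≠ 0 := by
    intro h0
    obtain ⟨-, h2, h3⟩ := hnull.self_of_nhds h.param.zero_mem
    rw [h3] at h2
    simp only [ha, hw, hsig0] at h0
    rw [h0, zero_smul] at h2
    exact h2 rfl
  have hνs := h.normal.smooth.comp h.param.germ.smooth hsig0
  set c : E 2 → ℝ := fun u => inner ℝ (fderiv ℝ Φ (f (sig u)) (ν (sig u))) (ν' (φ (sig u))) /
    inner ℝ (ν (sig u)) (ν (sig u)) with hc
  have hcc : ContinuousAt c 0 := by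
    have h1 : SmoothNearZero fun u => fderiv ℝ Φ (f (sig u)) :=
      hΦ.1.smooth.fderiv.comp (hf.comp h.param.germ).smooth (hf.comp h.param.germ).map_zero
    have h2 : SmoothNearZero fun u => ν' (φ (sig u)) :=
      h'.normal.smooth.comp hφsig.smooth (by rw [hsig0, hφ0])
    refine ((h1.clm_apply hνs).inner h2).continuousAt.div (hνs.inner hνs).continuousAt ?_
    rw [hsig0]
    simpa using h.normal.ne_zero.self_of_nhds
  -- The orthogonality is known along Σ' but needed at the points φ(Σ(u)), hence it is extended to
  -- all points of S(g) near 0.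
  have horth' : ∀ᶠ q in 𝓝 (0 : E 3), q ∈ singularSet g → ∀ X,
      inner ℝ (fderiv ℝ g q X) (fderiv ℝ ν' q (η' q)) = 0 := by
    filter_upwards [h'.param.eventually_exists (h'.eventually_orthogonal hg hnd')] with q hq hqS
    obtain ⟨u, rfl, hu⟩ := hq hqS
    exact hu
  have hkey : ∀ᶠ u in 𝓝 (0 : E 2),
      normalPairing f ν (sig u) (η (sig u)) * c u = a u ^ 3 * R (φ (sig u)) ∧
      ∀ y, inner ℝ (fderiv ℝ Φ (f (sig u)) y) (ν' (φ (sig u))) = c u * inner ℝ y (ν (sig u)) := by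
    filter_upwards [h.param.eventually_mem, h.param.germ.tendsto.eventually hnull,
      h.param.germ.tendsto.eventually (h.normal.normalAt hf),
      hφsig.tendsto.eventually (h'.normal.normalAt hg),
      h.param.germ.tendsto.eventually hφ.1.smooth.eventually_nhds,
      (hf.comp h.param.germ).tendsto.eventually hΦ.1.smooth.eventually_nhds,
      h.param.germ.tendsto.eventually he.eventually_nhds,
      h.param.germ.tendsto.eventually h.null.eventually_ne_zero,
      h.eventually_orthogonal hf hnd, hφsig.tendsto.eventually horth',
      (h.smooth_frameDet hf).continuousAt.eventually_ne (h.frameDet_zero hf hnd)]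
      with u k1 k2 k3 k4 k5 k6 k7 k8 k9 k10 k11
    obtain ⟨m1, -, m3⟩ := k2 k1
    have m4 : fderiv ℝ φ (sig u) (η (sig u)) = a u • η' (φ (sig u)) := m3
    have key := k3.normalPairing_map k4 k5 k6 k7 (k8 k1).1 k9 (fun X => by
      rw [m4, map_smul, real_inner_smul_right, k10 m1, mul_zero]) k11
    refine ⟨?_, key.2⟩
    have k := key.1
    rw [m4, normalPairing_smul] at k
    rw [hR, k]
    exact mul_comm _ _
  -- If c(0) were 0, then ν'(0) would be orthogonal to the image of the surjective dΦ, hence zero.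
  have hc0 : c 0 ≠ 0 := by
    intro h0
    have h1 := hkey.self_of_nhds.2
    rw [h0, hsig0, hφ0, hf.map_zero] at h1
    obtain ⟨e, hequiv⟩ := exists_equiv_of_injective hΦ.injective_fderiv
    have h2 := h1 (e.symm (ν' 0))
    rw [← hequiv] at h2
    simp only [ContinuousLinearEquiv.coe_coe, ContinuousLinearEquiv.apply_symm_apply, zero_mul,
      inner_self_eq_zero] at h2
    exact h'.normal.ne_zero.self_of_nhds h2
  have hRφ : SmoothNearZero fun u => R (φ (sig u)) := hRs.comp hφsig.smooth (by rw [hsig0, hφ0])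
  have hstep := simpleZero_congr (F := fun u => normalPairing f ν (sig u) (η (sig u)))
    (G := fun u => R (φ (sig u))) (c := fun u => a u ^ 3 / c u) (by
      filter_upwards [hkey, hcc.eventually_ne hc0] with u k1 k2
      rw [div_mul_eq_mul_div, eq_div_iff k2]
      exact k1.1) ((hac.pow 3).div hcc hc0) (div_ne_zero (pow_ne_zero 3 ha0) hc0)
    hRφ.differentiableAt
  rw [hstep]
  -- comparison of the two parametrizations of the singular set of `g`
  obtain ⟨-, θ, hθ, hθφ, hφθ⟩ := id hφ
  have hR0 : HasFDerivAt R (fderiv ℝ R 0) 0 := hRs.differentiableAt.hasFDerivAt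
  have d1 : fderiv ℝ (fun u => R (φ (sig u))) 0 =
      (fderiv ℝ R 0).comp ((fderiv ℝ φ 0).comp (fderiv ℝ sig 0)) := by
    have k1 := hφ.1.hasFDerivAt_comp h.param.germ
    have k2 : HasFDerivAt R (fderiv ℝ R 0) (φ (sig 0)) := by rw [hsig0, hφ0]; exact hR0
    exact (k2.comp 0 k1).fderiv
  have hθsig := hθ.hasFDerivAt_comp h'.param.germ
  have d2 : fderiv ℝ (fun u => R (sig' u)) 0 =
      (fderiv ℝ R 0).comp ((fderiv ℝ φ 0).comp ((fderiv ℝ θ 0).comp (fderiv ℝ sig' 0))) := by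
    have hd : HasFDerivAt φ (fderiv ℝ φ 0) (θ (sig' 0)) := by
      rw [hsig0', hθ.map_zero]; exact hφ.1.hasFDerivAt
    have k1 := hd.comp 0 hθsig
    have k2 : HasFDerivAt R (fderiv ℝ R 0) (φ (θ (sig' 0))) := by
      rw [hsig0', hθ.map_zero, hφ0]; exact hR0
    refine ((k2.comp 0 k1).congr_of_eventuallyEq ?_).fderiv
    filter_upwards [h'.param.germ.tendsto.eventually hφθ] with u hu
    simp only [Function.comp]
    rw [hu]
  have hθinj : Function.Injective (fderiv ℝ θ 0) :=
    IsDiffeoGerm.injective_fderiv ⟨hθ, φ, hφ.1, hφθ, hθφ⟩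
  have hl : fderiv ℝ lam 0 ≠ 0 := fun h0 => hnd (by rw [vderiv, h0]; rfl)
  -- No smooth reparametrization between φ∘Σ and Σ' is needed: λ vanishes along Σ and along θ∘Σ', so
  -- at 0 both have the tangent plane ker dλ, and the differentials of R∘φ∘Σ and R∘Σ' vanish
  -- together.
  have hrange := range_eq_of_comp_eq_zero hl h.param.immersion
    (B := (fderiv ℝ θ 0).comp (fderiv ℝ sig' 0)) (hθinj.comp h'.param.immersion)
    (h.fderiv_lam_comp hf) (by
      intro x
      have hz : (fun u => lam (θ (sig' u))) =ᶠ[𝓝 0] fun _ => 0 := by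
        filter_upwards [(hθ.comp h'.param.germ).tendsto.eventually h.identifier.eventually_eq_zero,
          h'.param.eventually_mem, (hθ.comp h'.param.germ).tendsto.eventually hS,
          h'.param.germ.tendsto.eventually hφθ] with u k1 k2 k3 k4
        exact k1 (k3.2 (by rw [k4]; exact k2))
      have hd : HasFDerivAt lam (fderiv ℝ lam 0) (θ (sig' 0)) := by
        rw [hsig0', hθ.map_zero]; exact (h.identifier.smooth hf).differentiableAt.hasFDerivAt
      have k := ((hd.comp 0 hθsig).congr_of_eventuallyEq hz.symm).unique
        (hasFDerivAt_const (0 : ℝ) (0 : E 2))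
      exact congrArg (fun L : E 2 →L[ℝ] ℝ => L x) k)
  have hzero : fderiv ℝ (fun u => R (sig' u)) 0 = 0 ↔ fderiv ℝ (fun u => R (φ (sig u))) 0 = 0 := by
    rw [d1, d2]
    have gen : ∀ A : E 2 →L[ℝ] E 3, (fderiv ℝ R 0).comp ((fderiv ℝ φ 0).comp A) = 0 ↔
        ∀ x ∈ LinearMap.range (A : E 2 →ₗ[ℝ] E 3), fderiv ℝ R 0 (fderiv ℝ φ 0 x) = 0 := by
      intro A
      constructor
      · rintro hA _ ⟨x, rfl⟩
        exact congrArg (fun L : E 2 →L[ℝ] ℝ => L x) hA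
      · intro hA
        ext x
        exact hA _ ⟨x, rfl⟩
    rw [gen, gen, hrange]
  refine and_congr ?_ (not_congr hzero)
  rw [hsig0, hsig0', hφ0]

/-! ### The standard form `(x, y, z², z³ q (x, y, z²))` -/

theorem fderiv_coord {V : Type*} [NormedAddCommGroup V] [NormedSpace ℝ V] {n : ℕ} {f : V → E n}
    {p : V} (hf : DifferentiableAt ℝ f p) (X : V) (i : Fin n) :
    fderiv ℝ f p X i = fderiv ℝ (fun p => f p i) p X := by
  have h := (EuclideanSpace.proj i : E n →L[ℝ] ℝ).hasFDerivAt.comp p hf.hasFDerivAt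
  have h2 : HasFDerivAt (fun p => f p i) _ p := h
  rw [h2.fderiv]
  rfl

/-- The inclusion of `ℝ²` in `ℝ³` as the plane `z = 0`. -/
def planeIncl : E 2 →L[ℝ] E 3 :=
  (EuclideanSpace.proj 0 : E 2 →L[ℝ] ℝ).smulRight (basisVec 0) +
    (EuclideanSpace.proj 1 : E 2 →L[ℝ] ℝ).smulRight (basisVec 1)

theorem planeIncl_apply (u : E 2) : planeIncl u = !₂[u 0, u 1, 0] := by
  ext i; fin_cases i <;> simp [planeIncl, basisVec]

/-- The map `(x, y, z) ↦ (x, y, z²)`. -/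
def fold (p : E 3) : E 3 := !₂[p 0, p 1, p 2 ^ 2]

theorem contDiff_coord {n : ℕ} (i : Fin n) : ContDiff ℝ ∞ fun p : E n => p i :=
  (EuclideanSpace.proj i : E n →L[ℝ] ℝ).contDiff

theorem fderiv_coord_apply {n : ℕ} (i : Fin n) (p X : E n) : fderiv ℝ (fun p : E n => p i) p X = X i := by
  have : HasFDerivAt (fun p : E n => p i) (EuclideanSpace.proj i : E n →L[ℝ] ℝ) p :=
    (EuclideanSpace.proj i : E n →L[ℝ] ℝ).hasFDerivAt
  rw [this.fderiv]; rfl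

theorem contDiff_fold : ContDiff ℝ ∞ fold := by
  refine contDiff_euclidean.2 fun i => ?_
  fin_cases i
  · exact contDiff_coord 0
  · exact contDiff_coord 1
  · exact (contDiff_coord 2).pow 2

theorem fderiv_fold (p X : E 3) : fderiv ℝ fold p X = !₂[X 0, X 1, 2 * p 2 * X 2] := by
  have hd := contDiff_fold.contDiffAt.differentiableAt (x := p) (by simp)
  ext i
  rw [fderiv_coord hd]
  fin_cases i
  · exact fderiv_coord_apply 0 p X
  · exact fderiv_coord_apply 1 p X
  · have h := ((contDiff_coord (2 : Fin 3)).contDiffAt (x := p)).differentiableAt (by simp)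
      |>.hasFDerivAt.pow 2
    have h2 : HasFDerivAt (fun p : E 3 => fold p 2) _ p := h
    change fderiv ℝ (fun p : E 3 => fold p 2) p X = _
    rw [h2.fderiv]
    simp [fderiv_coord_apply]

/-- The map `(x, y, z) ↦ (x, y, z², z³ q (x, y, z²))`. -/
def standardForm (q : E 3 → ℝ) (p : E 3) : E 4 :=
  !₂[p 0, p 1, p 2 ^ 2, p 2 ^ 3 * q (fold p)]

section
variable {q : E 3 → ℝ}

theorem contDiff_standardForm (hq : ContDiff ℝ ∞ q) : ContDiff ℝ ∞ (standardForm q) := by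
  refine contDiff_euclidean.2 fun i => ?_
  fin_cases i
  · exact contDiff_coord 0
  · exact contDiff_coord 1
  · exact (contDiff_coord 2).pow 2
  · exact ((contDiff_coord 2).pow 3).mul (hq.comp contDiff_fold)

theorem fderiv_comp_fold (hq : ContDiff ℝ ∞ q) (p X : E 3) :
    fderiv ℝ (fun p => q (fold p)) p X = fderiv ℝ q (fold p) !₂[X 0, X 1, 2 * p 2 * X 2] := by
  have h := ((hq.contDiffAt.differentiableAt (x := fold p) (by simp)).hasFDerivAt.comp p
    (contDiff_fold.contDiffAt.differentiableAt (by simp)).hasFDerivAt)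
  have h2 : HasFDerivAt (fun p => q (fold p)) _ p := h
  rw [h2.fderiv, ← fderiv_fold]
  rfl

theorem fderiv_apply_eq_sum (l : E 3 →L[ℝ] ℝ) (a b c : ℝ) :
    l !₂[a, b, c] = a * l (basisVec 0) + b * l (basisVec 1) + c * l (basisVec 2) := by
  rw [eq_sum_basisVec !₂[a, b, c]]
  simp

theorem fderiv_standardForm (hq : ContDiff ℝ ∞ q) (p X : E 3) :
    fderiv ℝ (standardForm q) p X = !₂[X 0, X 1, 2 * p 2 * X 2,
      3 * p 2 ^ 2 * X 2 * q (fold p) + p 2 ^ 3 * (X 0 * fderiv ℝ q (fold p) (basisVec 0) +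
        X 1 * fderiv ℝ q (fold p) (basisVec 1) +
        2 * p 2 * X 2 * fderiv ℝ q (fold p) (basisVec 2))] := by
  have hd := (contDiff_standardForm hq).contDiffAt.differentiableAt (x := p) (by simp)
  have h2 := ((contDiff_coord (2 : Fin 3)).contDiffAt (x := p)).differentiableAt (by simp)
      |>.hasFDerivAt
  ext i
  rw [fderiv_coord hd]
  fin_cases i
  · exact fderiv_coord_apply 0 p X
  · exact fderiv_coord_apply 1 p X
  · have h3 : HasFDerivAt (fun p : E 3 => standardForm q p 2) _ p := h2.pow 2
    change fderiv ℝ (fun p : E 3 => standardForm q p 2) p X = _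
    rw [h3.fderiv]
    simp [fderiv_coord_apply]
  · have h4 := ((hq.comp contDiff_fold).contDiffAt (x := p)).differentiableAt (by simp)
      |>.hasFDerivAt
    have h3 : HasFDerivAt (fun p : E 3 => standardForm q p 3) _ p := (h2.pow 3).mul h4
    change fderiv ℝ (fun p : E 3 => standardForm q p 3) p X = _
    rw [h3.fderiv]
    have h5 := fderiv_comp_fold hq p X
    rw [fderiv_apply_eq_sum] at h5
    simp only [add_apply, smul_apply, smul_eq_mul, fderiv_coord_apply]
    change _ * fderiv ℝ (fun p => q (fold p)) p X + _ = _
    rw [h5]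
    simp
    ring

/-- A normal vector field of the standard form. -/
def standardNormal (q : E 3 → ℝ) (p : E 3) : E 4 :=
  -- The first three components carry an explicit factor z, so that their z-derivatives on z = 0 can
  -- be read off from the cofactors.
  !₂[p 2 * (-(p 2 ^ 2 * fderiv ℝ q (fold p) (basisVec 0))),
    p 2 * (-(p 2 ^ 2 * fderiv ℝ q (fold p) (basisVec 1))),
    p 2 * (-(3 / 2 * q (fold p) + p 2 ^ 2 * fderiv ℝ q (fold p) (basisVec 2))), 1]

theorem contDiff_fderiv_fold (hq : ContDiff ℝ ∞ q) (v : E 3) :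
    ContDiff ℝ ∞ fun p => fderiv ℝ q (fold p) v :=
  ((hq.fderiv_right (m := ∞) (by simp)).comp contDiff_fold).clm_apply contDiff_const

theorem contDiff_standardNormal (hq : ContDiff ℝ ∞ q) : ContDiff ℝ ∞ (standardNormal q) := by
  have h2 := contDiff_coord (2 : Fin 3)
  refine contDiff_euclidean.2 fun i => ?_
  fin_cases i
  · exact h2.mul ((h2.pow 2).mul (contDiff_fderiv_fold hq _)).neg
  · exact h2.mul ((h2.pow 2).mul (contDiff_fderiv_fold hq _)).neg
  · exact h2.mul ((contDiff_const.mul (hq.comp contDiff_fold)).add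
      ((h2.pow 2).mul (contDiff_fderiv_fold hq _))).neg
  · exact contDiff_const

theorem standardNormal_ne_zero (q : E 3 → ℝ) (p : E 3) : standardNormal q p ≠ 0 := by
  intro h
  have := congrArg (fun x : E 4 => x 3) h
  simp [standardNormal] at this

theorem inner_standardNormal (hq : ContDiff ℝ ∞ q) (p X : E 3) :
    inner ℝ (fderiv ℝ (standardForm q) p X) (standardNormal q p) = 0 := by
  rw [fderiv_standardForm hq, PiLp.inner_apply, Fin.sum_univ_four]
  simp [standardNormal]
  ring

theorem isNormal_standardNormal (hq : ContDiff ℝ ∞ q) :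
    IsNormal (standardForm q) (standardNormal q) :=
  ⟨(contDiff_standardNormal hq).smoothNearZero,
    Eventually.of_forall (standardNormal_ne_zero q),
    Eventually.of_forall (inner_standardNormal hq)⟩

theorem IsNormal.exists_unit {f ν : E 3 → E 4} (h : IsNormal f ν) : ∃ μ, IsUnitNormal f μ := by
  refine ⟨fun p => ‖ν p‖⁻¹ • ν p, ?_, ?_, ?_⟩
  · filter_upwards [h.smooth, h.ne_zero] with p h1 h2
    exact ((h1.norm ℝ h2).inv (norm_ne_zero_iff.2 h2)).smul h1
  · filter_upwards [h.ne_zero] with p h2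
    rw [norm_smul, norm_inv, norm_norm, inv_mul_cancel₀ (norm_ne_zero_iff.2 h2)]
  · filter_upwards [h.orthogonal] with p h1 X
    rw [real_inner_smul_right, h1, mul_zero]

theorem IsNormal.exists_identifier {f ν : E 3 → E 4} (h : IsNormal f ν) :
    ∃ lam, IsSingularityIdentifier f lam := by
  obtain ⟨μ, hμ⟩ := h.exists_unit
  exact ⟨fun p => det4 (fderiv ℝ f p (basisVec 0)) (fderiv ℝ f p (basisVec 1))
    (fderiv ℝ f p (basisVec 2)) (μ p), μ, fun _ => 1, hμ, contDiff_const.smoothNearZero,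
    by simp, by simp⟩

theorem ker_fderiv_standardForm (hq : ContDiff ℝ ∞ q) {p : E 3} (hp : p 2 = 0) :
    LinearMap.ker (fderiv ℝ (standardForm q) p : E 3 →ₗ[ℝ] E 4) =
      Submodule.span ℝ {basisVec 2} := by
  ext X
  rw [LinearMap.mem_ker, ContinuousLinearMap.coe_coe, fderiv_standardForm hq, hp,
    Submodule.mem_span_singleton]
  constructor
  · intro h
    have h0 := congrArg (fun x : E 4 => x 0) h
    have h1 := congrArg (fun x : E 4 => x 1) h
    simp at h0 h1
    refine ⟨X 2, ?_⟩
    conv_rhs => rw [eq_sum_basisVec X]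
    simp [h0, h1]
  · rintro ⟨c, rfl⟩
    ext i; fin_cases i <;> simp [basisVec]

theorem singularSet_standardForm (hq : ContDiff ℝ ∞ q) :
    singularSet (standardForm q) = {p | p 2 = 0} := by
  ext p
  constructor
  · intro hp
    obtain ⟨v, hv, hv0⟩ := exists_ne_zero_of_mem_singularSet hp
    rw [fderiv_standardForm hq] at hv0
    by_contra h2
    have hp2 : p 2 ≠ 0 := h2
    refine hv ?_
    have k0 := congrArg (fun x : E 4 => x 0) hv0
    have k1 := congrArg (fun x : E 4 => x 1) hv0
    have k2 := congrArg (fun x : E 4 => x 2) hv0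
    simp [hp2] at k0 k1 k2
    ext i; fin_cases i
    · exact k0
    · exact k1
    · exact k2
  · intro hp
    refine mem_singularSet_of_eq_zero (v := basisVec 2) ?_ ?_
    · intro h
      have := congrArg (fun x : E 3 => x 2) h
      simp [basisVec] at this
    · have : basisVec 2 ∈ LinearMap.ker (fderiv ℝ (standardForm q) p : E 3 →ₗ[ℝ] E 4) := by
        rw [ker_fderiv_standardForm hq hp]; exact Submodule.mem_span_singleton_self _
      simpa using this

theorem injective_planeIncl : Function.Injective planeIncl := by
  refine (injective_iff_map_eq_zero _).2 fun u hu => ?_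
  rw [planeIncl_apply] at hu
  have h0 := congrArg (fun x : E 3 => x 0) hu
  have h1 := congrArg (fun x : E 3 => x 1) hu
  simp at h0 h1
  ext i; fin_cases i
  · exact h0
  · exact h1

theorem isSingularParametrization_planeIncl (hq : ContDiff ℝ ∞ q) :
    IsSingularParametrization (standardForm q) planeIncl := by
  refine ⟨⟨planeIncl.contDiff.smoothNearZero, map_zero _⟩, ?_, ?_⟩
  · rw [ContinuousLinearMap.fderiv]; exact injective_planeIncl
  · have hemb := LinearMap.isClosedEmbedding_of_injective (f := (planeIncl : E 2 →ₗ[ℝ] E 3))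
      (LinearMap.ker_eq_bot.2 injective_planeIncl)
    have h1 := hemb.isInducing.map_nhds_eq 0
    have h2 : Set.range (planeIncl : E 2 →ₗ[ℝ] E 3) = singularSet (standardForm q) := by
      rw [singularSet_standardForm hq]
      ext p
      constructor
      · rintro ⟨u, rfl⟩
        simp [planeIncl_apply]
      · intro hp
        refine ⟨!₂[p 0, p 1], ?_⟩
        rw [ContinuousLinearMap.coe_coe, planeIncl_apply]
        ext i; fin_cases i
        · rfl
        · rfl
        · exact (show p 2 = 0 from hp).symm
    rw [h2, map_zero] at h1
    exact h1

theorem exists_isChoice_standardForm (hq : ContDiff ℝ ∞ q) :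
    ∃ lam, IsChoice (standardForm q) (standardNormal q) lam (fun _ => basisVec 2) planeIncl := by
  obtain ⟨lam, hlam⟩ := (isNormal_standardNormal hq).exists_identifier
  refine ⟨lam, isNormal_standardNormal hq, hlam, ⟨contDiff_const.smoothNearZero, ?_⟩,
    isSingularParametrization_planeIncl hq⟩
  refine Eventually.of_forall fun p hp => ?_
  rw [singularSet_standardForm hq] at hp
  exact ker_fderiv_standardForm hq hp

/-- Continuity of h suffices at the zero of t; this spares computing derivatives of the cofactors in
`standardNormal`. -/
theorem hasDerivAt_id_mul {h : ℝ → ℝ} (hh : ContinuousAt h 0) :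
    HasDerivAt (fun t => t * h t) (h 0) 0 := by
  rw [hasDerivAt_iff_tendsto_slope_zero]
  refine (hh.tendsto.mono_left nhdsWithin_le_nhds).congr' ?_
  filter_upwards [self_mem_nhdsWithin] with t ht
  have : t ≠ 0 := ht
  simp [this]

theorem vderiv_standardNormal (hq : ContDiff ℝ ∞ q) (u : E 2) :
    vderiv (fun _ => basisVec 2) (standardNormal q) (planeIncl u) =
      !₂[0, 0, -(3 / 2 * q (planeIncl u)), 0] := by
  set p := planeIncl u with hp
  have hp2 : p 2 = 0 := by rw [hp, planeIncl_apply]; rfl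
  have hfold : fold p = p := by
    ext i; fin_cases i <;> simp [fold, hp2]
  have hd := (contDiff_standardNormal hq).contDiffAt.differentiableAt (x := p) (by simp)
  set γ := lineAt p (basisVec 2) with hγ
  have hγ0 : γ 0 = p := lineAt_zero _ _
  have hγ2 : ∀ t, γ t 2 = t := fun t => by simp [hγ, lineAt, hp2, basisVec]
  have hγc : Continuous γ := continuous_const.add (continuous_id.smul continuous_const)
  have hcurve : HasDerivAt (fun t => standardNormal q (γ t))
      (vderiv (fun _ => basisVec 2) (standardNormal q) p) 0 := by
    have h1 : HasFDerivAt (standardNormal q) (fderiv ℝ (standardNormal q) p) (γ 0) := by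
      rw [hγ0]; exact hd.hasFDerivAt
    have h2 := h1.comp_hasDerivAt 0 (smoothNearZero_lineAt p (basisVec 2)).hasDerivAt.self_of_nhds
    rw [deriv_lineAt] at h2
    exact h2
  have hcoord : ∀ i, HasDerivAt (fun t => standardNormal q (γ t) i)
      (vderiv (fun _ => basisVec 2) (standardNormal q) p i) 0 := fun i =>
    (EuclideanSpace.proj i : E 4 →L[ℝ] ℝ).hasFDerivAt.comp_hasDerivAt 0 hcurve
  have hc : ∀ v, Continuous fun t => fderiv ℝ q (fold (γ t)) v := fun v =>
    (contDiff_fderiv_fold hq v).continuous.comp hγc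
  have hcq : Continuous fun t => q (fold (γ t)) :=
    (hq.continuous.comp contDiff_fold.continuous).comp hγc
  ext i
  refine (hcoord i).unique ?_
  fin_cases i
  · have := hasDerivAt_id_mul (h := fun t => -(t ^ 2 * fderiv ℝ q (fold (γ t)) (basisVec 0)))
      (((continuous_pow 2).mul (hc _)).neg.continuousAt)
    simpa [standardNormal, hγ2] using this
  · have := hasDerivAt_id_mul (h := fun t => -(t ^ 2 * fderiv ℝ q (fold (γ t)) (basisVec 1)))
      (((continuous_pow 2).mul (hc _)).neg.continuousAt)
    simpa [standardNormal, hγ2] using this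
  · have := hasDerivAt_id_mul (h := fun t => -(3 / 2 * q (fold (γ t)) +
        t ^ 2 * fderiv ℝ q (fold (γ t)) (basisVec 2)))
      (((continuous_const.mul hcq).add ((continuous_pow 2).mul (hc _))).neg.continuousAt)
    simpa [standardNormal, hγ2, hγ0, hfold] using this
  · simpa [standardNormal] using hasDerivAt_const (0 : ℝ) (1 : ℝ)

/-- On z = 0 the four rows are e₀, e₁, e₃ and -(3/2) q e₂, and the transposition of the last two
cancels the sign. -/
theorem psi_standardForm (hq : ContDiff ℝ ∞ q) :
    psi (standardForm q) (standardNormal q) (fun _ => basisVec 2) planeIncl =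
      fun u => 3 / 2 * q (planeIncl u) := by
  funext u
  have hcomp : ∀ i, fderiv ℝ (standardForm q ∘ planeIncl) u (basisVec i) =
      fderiv ℝ (standardForm q) (planeIncl u) (planeIncl (basisVec i)) := fun i => by
    rw [(((contDiff_standardForm hq).contDiffAt.differentiableAt (by simp)).hasFDerivAt.comp u
      planeIncl.hasFDerivAt).fderiv]
    rfl
  rw [psi, hcomp, hcomp, vderiv_standardNormal hq, fderiv_standardForm hq, fderiv_standardForm hq,
    planeIncl_apply, planeIncl_apply, planeIncl_apply]
  simp [det4, standardNormal, basisVec, Matrix.det_succ_row_zero, Fin.sum_univ_succ, Fin.succAbove]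

theorem psiCondition_standardForm (hq : ContDiff ℝ ∞ q) :
    PsiCondition (standardForm q) (standardNormal q) (fun _ => basisVec 2) planeIncl ↔
      q 0 = 0 ∧ ∃ i : Fin 2, fderiv ℝ q 0 (planeIncl (basisVec i)) ≠ 0 := by
  rw [PsiCondition, psi_standardForm hq]
  have hd : HasFDerivAt q (fderiv ℝ q 0) (planeIncl 0) := by
    rw [map_zero]; exact (hq.contDiffAt.differentiableAt (by simp)).hasFDerivAt
  have h1 : HasFDerivAt (fun u => 3 / 2 * q (planeIncl u)) _ 0 :=
    (hd.comp 0 planeIncl.hasFDerivAt).const_mul (3 / 2)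
  rw [h1.fderiv]
  refine and_congr (by simp) ?_
  constructor
  · intro h
    by_contra! hall
    refine h ?_
    ext x
    have hx : x = x 0 • basisVec 0 + x 1 • basisVec 1 := by
      ext i; fin_cases i <;> simp [basisVec]
    rw [hx]
    simp only [map_add, map_smul, smul_apply, ContinuousLinearMap.comp_apply, hall, zero_apply]
    simp
  · rintro ⟨i, hi⟩ h
    have := congrArg (fun L : E 2 →L[ℝ] ℝ => L (basisVec i)) h
    simp at this
    exact hi this

/-! ### The model among the standard forms -/

theorem cuspidalCrossCapModel_eq :
    cuspidalCrossCapModel = standardForm fun p => p 1 := by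
  funext p
  ext i
  fin_cases i <;> simp [cuspidalCrossCapModel, standardForm, fold]
  ring

theorem injective_fderiv_of_coord {n : ℕ} {f : E n → E n} (hf : DifferentiableAt ℝ f 0)
    (h : ∀ X, (∀ i, fderiv ℝ (fun p => f p i) 0 X = 0) → X = 0) :
    Function.Injective (fderiv ℝ f 0) :=
  (injective_iff_map_eq_zero _).2 fun X hX => h X fun i => by
    rw [← fderiv_coord hf, hX]; rfl

/-- The function q(x, y, z²) replaces y as a source coordinate. It depends only on the first three
components of the standard form, so the same replacement is available in the target. -/
theorem aEquiv_model_of_second (hq : ContDiff ℝ ∞ q) (hq0 : q 0 = 0)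
    (h1 : fderiv ℝ q 0 (basisVec 1) ≠ 0) :
    AEquiv (standardForm q) cuspidalCrossCapModel := by
  have hfold0 : fold 0 = 0 := by ext i; fin_cases i <;> simp [fold]
  let φ : E 3 → E 3 := fun p => !₂[p 0, q (fold p), p 2]
  have hφs : ContDiff ℝ ∞ φ := by
    refine contDiff_euclidean.2 fun i => ?_
    fin_cases i
    · exact contDiff_coord 0
    · exact hq.comp contDiff_fold
    · exact contDiff_coord 2
  have hφ : IsDiffeoGerm φ := by
    refine IsMapGerm.isDiffeoGerm ⟨hφs.smoothNearZero, ?_⟩ ?_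
    · ext i; fin_cases i <;> simp [φ, hfold0, hq0]
    · refine injective_fderiv_of_coord (hφs.contDiffAt.differentiableAt (by simp)) fun X hX => ?_
      have k0 : X 0 = 0 := by rw [← fderiv_coord_apply 0 0 X]; exact hX 0
      have k2 : X 2 = 0 := by rw [← fderiv_coord_apply 2 0 X]; exact hX 2
      have k1 : fderiv ℝ (fun p => q (fold p)) 0 X = 0 := hX 1
      rw [fderiv_comp_fold hq, hfold0, fderiv_apply_eq_sum, k0, k2] at k1
      simp [h1] at k1
      ext i; fin_cases i <;> assumption
  let π : E 4 →L[ℝ] E 3 := (EuclideanSpace.proj 0 : E 4 →L[ℝ] ℝ).smulRight (basisVec 0) +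
    (EuclideanSpace.proj 1 : E 4 →L[ℝ] ℝ).smulRight (basisVec 1) +
    (EuclideanSpace.proj 2 : E 4 →L[ℝ] ℝ).smulRight (basisVec 2)
  have hπ : ∀ x, π x = !₂[x 0, x 1, x 2] := fun x => by
    ext i; fin_cases i <;> simp [π, basisVec]
  let Φ : E 4 → E 4 := fun x => !₂[x 0, q (π x), x 2, x 3]
  have hΦs : ContDiff ℝ ∞ Φ := by
    refine contDiff_euclidean.2 fun i => ?_
    fin_cases i
    · exact contDiff_coord 0
    · exact hq.comp π.contDiff
    · exact contDiff_coord 2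
    · exact contDiff_coord 3
  have hΦ : IsDiffeoGerm Φ := by
    refine IsMapGerm.isDiffeoGerm ⟨hΦs.smoothNearZero, ?_⟩ ?_
    · ext i; fin_cases i <;> simp [Φ, hq0]
    · refine injective_fderiv_of_coord (hΦs.contDiffAt.differentiableAt (by simp)) fun X hX => ?_
      have k0 : X 0 = 0 := by rw [← fderiv_coord_apply 0 0 X]; exact hX 0
      have k2 : X 2 = 0 := by rw [← fderiv_coord_apply 2 0 X]; exact hX 2
      have k3 : X 3 = 0 := by rw [← fderiv_coord_apply 3 0 X]; exact hX 3
      have k1 : fderiv ℝ (fun x => q (π x)) 0 X = 0 := hX 1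
      have hd : HasFDerivAt q (fderiv ℝ q 0) (π 0) := by
        rw [map_zero]; exact (hq.contDiffAt.differentiableAt (by simp)).hasFDerivAt
      have hd2 : HasFDerivAt (fun x => q (π x)) _ 0 := hd.comp 0 π.hasFDerivAt
      rw [hd2.fderiv, ContinuousLinearMap.comp_apply, hπ, fderiv_apply_eq_sum, k0, k2] at k1
      simp [h1] at k1
      ext i; fin_cases i <;> assumption
  refine ⟨φ, Φ, hφ, hΦ, Eventually.of_forall fun p => ?_⟩
  have : π (standardForm q p) = fold p := by rw [hπ]; rfl
  ext i
  fin_cases i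
  · rfl
  · exact congrArg q this
  · rfl
  · exact mul_comm _ _

/-- The coordinates x and y play the same role; this reduces ∂q/∂x ≠ 0 to ∂q/∂y ≠ 0. -/
theorem aEquiv_standardForm_swap (q : E 3 → ℝ) :
    AEquiv (standardForm q) (standardForm fun p => q !₂[p 1, p 0, p 2]) := by
  have hs : ContDiff ℝ ∞ fun p : E 3 => (!₂[p 1, p 0, p 2] : E 3) := by
    refine contDiff_euclidean.2 fun i => ?_
    fin_cases i
    exacts [contDiff_coord 1, contDiff_coord 0, contDiff_coord 2]
  have hs4 : ContDiff ℝ ∞ fun p : E 4 => (!₂[p 1, p 0, p 2, p 3] : E 4) := by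
    refine contDiff_euclidean.2 fun i => ?_
    fin_cases i
    exacts [contDiff_coord 1, contDiff_coord 0, contDiff_coord 2, contDiff_coord 3]
  have h3 : IsMapGerm fun p : E 3 => (!₂[p 1, p 0, p 2] : E 3) :=
    ⟨hs.smoothNearZero, by ext i; fin_cases i <;> simp⟩
  have h4 : IsMapGerm fun p : E 4 => (!₂[p 1, p 0, p 2, p 3] : E 4) :=
    ⟨hs4.smoothNearZero, by ext i; fin_cases i <;> simp⟩
  refine ⟨_, _, ⟨h3, _, h3, ?_, ?_⟩, ⟨h4, _, h4, ?_, ?_⟩, ?_⟩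
  all_goals refine Eventually.of_forall fun p => ?_
  all_goals ext i; fin_cases i <;> simp [standardForm, fold]

theorem aEquiv_model_of_psiCondition (hq : ContDiff ℝ ∞ q) (hq0 : q 0 = 0)
    (h : ∃ i : Fin 2, fderiv ℝ q 0 (planeIncl (basisVec i)) ≠ 0) :
    AEquiv (standardForm q) cuspidalCrossCapModel := by
  have e0 : planeIncl (basisVec 0) = basisVec 0 := by
    rw [planeIncl_apply]; ext i; fin_cases i <;> simp [basisVec]
  have e1 : planeIncl (basisVec 1) = basisVec 1 := by
    rw [planeIncl_apply]; ext i; fin_cases i <;> simp [basisVec]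
  rw [Fin.exists_fin_two, e0, e1] at h
  rcases h with h | h
  · let σ : E 3 →L[ℝ] E 3 := (EuclideanSpace.proj 1 : E 3 →L[ℝ] ℝ).smulRight (basisVec 0) +
      (EuclideanSpace.proj 0 : E 3 →L[ℝ] ℝ).smulRight (basisVec 1) +
      (EuclideanSpace.proj 2 : E 3 →L[ℝ] ℝ).smulRight (basisVec 2)
    have hσ : ∀ x, !₂[x 1, x 0, x 2] = σ x := fun x => by
      ext i; fin_cases i <;> simp [σ, basisVec]
    refine (aEquiv_standardForm_swap q).trans ?_
    simp only [hσ]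
    have hd : HasFDerivAt q (fderiv ℝ q 0) (σ 0) := by
      rw [map_zero]; exact (hq.contDiffAt.differentiableAt (by simp)).hasFDerivAt
    have hd2 : HasFDerivAt (fun x => q (σ x)) _ 0 := hd.comp 0 σ.hasFDerivAt
    refine aEquiv_model_of_second (hq.comp σ.contDiff) (by simpa using hq0) ?_
    have : σ (basisVec 1) = basisVec 0 := by
      rw [← hσ]; ext i; fin_cases i <;> simp [basisVec]
    rw [hd2.fderiv, ContinuousLinearMap.comp_apply, this]
    exact h
  · exact aEquiv_model_of_second hq hq0 h

end

/-! ### Reduction to the standard form -/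

/-- The projection of `ℝ³` to `ℝ²` that forgets the last coordinate. -/
def planeProj : E 3 →L[ℝ] E 2 :=
  (EuclideanSpace.proj 0 : E 3 →L[ℝ] ℝ).smulRight (basisVec 0) +
    (EuclideanSpace.proj 1 : E 3 →L[ℝ] ℝ).smulRight (basisVec 1)

theorem planeProj_apply (p : E 3) : planeProj p = !₂[p 0, p 1] := by
  ext i; fin_cases i <;> simp [planeProj, basisVec]

theorem planeIncl_planeProj (p : E 3) : planeIncl (planeProj p) = !₂[p 0, p 1, 0] := by
  rw [planeIncl_apply, planeProj_apply]; rfl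

theorem tendsto_planeIncl_planeProj :
    Tendsto (fun p => planeIncl (planeProj p)) (𝓝 0) (𝓝 0) := by
  have := (planeIncl.comp planeProj).continuous.tendsto 0
  rwa [map_zero] at this

/-- A function vanishing to second order along `z = 0` is divisible by `z²`. -/
theorem SmoothNearZero.exists_eq_sq_mul {b : E 3 → ℝ} (hb : SmoothNearZero b)
    (h0 : ∀ᶠ p in 𝓝 (0 : E 3), b (planeIncl (planeProj p)) = 0)
    (h1 : ∀ᶠ p in 𝓝 (0 : E 3), _root_.fderiv ℝ b (planeIncl (planeProj p)) (basisVec 2) = 0) :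
    ∃ c : E 3 → ℝ, ContDiff ℝ ∞ c ∧ ∀ᶠ p in 𝓝 (0 : E 3), b p = p 2 ^ 2 * c p := by
  obtain ⟨d, hd, hbd⟩ := hb.exists_hadamard (by
    filter_upwards [h0] with p hp
    rwa [planeIncl_planeProj] at hp)
  obtain ⟨c, hc, hdc⟩ := hd.smoothNearZero.exists_hadamard (by
    filter_upwards [h1, tendsto_planeIncl_planeProj.eventually hbd.eventually_nhds] with p hp hp2
    have k1 := ((contDiff_coord (2 : Fin 3)).contDiffAt
      (x := planeIncl (planeProj p))).differentiableAt (by simp) |>.hasFDerivAt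
    have k2 := (hd.contDiffAt (x := planeIncl (planeProj p))).differentiableAt (by simp)
      |>.hasFDerivAt
    have k3 := (k1.mul k2).congr_of_eventuallyEq hp2
    have k4 : planeIncl (planeProj p) 2 = 0 := by rw [planeIncl_planeProj]; rfl
    rw [k3.fderiv, add_apply, smul_apply, smul_apply, k4, fderiv_coord_apply] at hp
    rw [← planeIncl_planeProj]
    simpa [basisVec] using hp)
  refine ⟨c, hc, ?_⟩
  filter_upwards [hbd, hdc] with p k1 k2
  rw [k1, k2]; ring

/-- A germ that is tangent to the standard form to first order along `z = 0` and has nonzero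
second derivative there is equivalent to a standard form. -/
theorem aEquiv_standardForm_of_prenormal {f : E 3 → E 4} (hf : IsMapGerm f)
    (h0 : ∀ᶠ p in 𝓝 (0 : E 3), f (planeIncl (planeProj p)) = !₂[p 0, p 1, 0, 0])
    (h1 : ∀ᶠ p in 𝓝 (0 : E 3), fderiv ℝ f (planeIncl (planeProj p)) (basisVec 2) = 0)
    (h2 : 0 < deriv (deriv fun t : ℝ => f (t • basisVec 2) 2) 0) :
    ∃ q : E 3 → ℝ, ContDiff ℝ ∞ q ∧ AEquiv f (standardForm q) := by
  have hsmall : ∀ᶠ p in 𝓝 (0 : E 3), DifferentiableAt ℝ f (planeIncl (planeProj p)) := by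
    filter_upwards [tendsto_planeIncl_planeProj.eventually hf.smooth] with p hp
    exact hp.differentiableAt (by simp)
  have h1' : ∀ i, ∀ᶠ p in 𝓝 (0 : E 3),
      fderiv ℝ (fun p => f p i) (planeIncl (planeProj p)) (basisVec 2) = 0 := fun i => by
    filter_upwards [h1, hsmall] with p k1 k2
    rw [← fderiv_coord k2, k1]; rfl
  obtain ⟨A, hA, hfA⟩ := (hf.smooth.coord 2).exists_eq_sq_mul
    (by filter_upwards [h0] with p hp; rw [hp]; rfl) (h1' 2)
  obtain ⟨B, hB, hfB⟩ := (hf.smooth.coord 3).exists_eq_sq_mul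
    (by filter_upwards [h0] with p hp; rw [hp]; rfl) (h1' 3)
  have hline : SmoothNearZero fun t : ℝ => t • (basisVec 2 : E 3) :=
    (contDiff_id.smul contDiff_const).smoothNearZero
  have hlinet : Tendsto (fun t : ℝ => t • (basisVec 2 : E 3)) (𝓝 0) (𝓝 0) := by
    have := hline.continuousAt
    simpa [ContinuousAt] using this
  -- On the z-axis the third component is z²A, whose second derivative at 0 is 2A(0).
  have hA0 : 0 < A 0 := by
    have he : (fun t : ℝ => f (t • basisVec 2) 2) =ᶠ[𝓝 0]
        fun t => ContinuousLinearMap.mul ℝ ℝ (t ^ 2) (A (t • basisVec 2)) := by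
      filter_upwards [hlinet.eventually hfA] with t ht
      rw [ht]; simp [basisVec]
    have hsq : SmoothNearZero fun t : ℝ => t ^ 2 := (contDiff_id.pow 2).smoothNearZero
    have hd : deriv (fun t : ℝ => t ^ 2) = fun t => 2 * t := by funext t; simp
    have hdd : deriv (fun t : ℝ => 2 * t) 0 = 2 := by
      simp
    rw [he.deriv.deriv_eq, deriv_deriv_bilinear _ hsq
      (hA.smoothNearZero.comp hline (by simp)), hd, hdd] at h2
    simpa using h2
  have hApos : ∀ᶠ p in 𝓝 (0 : E 3), 0 < A p := hA.continuous.continuousAt.eventually (lt_mem_nhds hA0)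
  have hsqrt : SmoothNearZero fun p => √(A p) := by
    filter_upwards [hApos] with p hp using hA.contDiffAt.sqrt hp.ne'
  -- In these coordinates the first three components of f become x, y and z².
  let φ : E 3 → E 3 := fun p => !₂[f p 0, f p 1, p 2 * √(A p)]
  have hφg : IsMapGerm φ := by
    refine ⟨smoothNearZero_euclidean.2 fun i => ?_, ?_⟩
    · fin_cases i
      · exact hf.smooth.coord 0
      · exact hf.smooth.coord 1
      · exact (contDiff_coord 2).smoothNearZero.mul hsqrt
    · ext i; fin_cases i <;> simp [φ, hf.map_zero]
  have hf0 : ∀ X, fderiv ℝ f 0 X = !₂[X 0, X 1, 0, 0] := by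
    intro X
    have k1 : fderiv ℝ f 0 (basisVec 2) = 0 := by
      have := h1.self_of_nhds
      rwa [map_zero, map_zero] at this
    have k2 : HasFDerivAt f (fderiv ℝ f 0) (planeIncl (planeProj 0)) := by
      simpa using hf.hasFDerivAt
    have k3 := k2.comp 0 (planeIncl.hasFDerivAt.comp 0 planeProj.hasFDerivAt)
    let l : E 3 →L[ℝ] E 4 := (EuclideanSpace.proj 0 : E 3 →L[ℝ] ℝ).smulRight (basisVec 0) +
      (EuclideanSpace.proj 1 : E 3 →L[ℝ] ℝ).smulRight (basisVec 1)
    have hl : ∀ p, l p = !₂[p 0, p 1, 0, 0] := fun p => by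
      ext i; fin_cases i <;> simp [l, basisVec]
    have k4 := k3.unique (l.hasFDerivAt.congr_of_eventuallyEq (by
      filter_upwards [h0] with p hp
      rw [hl, ← hp]; rfl))
    have k5 := congrArg (fun L : E 3 →L[ℝ] E 4 => L X) k4
    simp only [ContinuousLinearMap.comp_apply, planeIncl_planeProj, hl] at k5
    rw [← k5]
    have hX : X = !₂[X 0, X 1, 0] + X 2 • basisVec 2 := by
      ext i; fin_cases i <;> simp [basisVec]
    conv_lhs => rw [hX, map_add, map_smul, k1, smul_zero, add_zero]
  have hφ : IsDiffeoGerm φ := by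
    refine hφg.isDiffeoGerm (injective_fderiv_of_coord hφg.smooth.differentiableAt fun X hX => ?_)
    have hfd := hf.smooth.differentiableAt
    have k0 : X 0 = 0 := by
      have : fderiv ℝ f 0 X 0 = 0 := by rw [fderiv_coord hfd]; exact hX 0
      rwa [hf0] at this
    have k1 : X 1 = 0 := by
      have : fderiv ℝ f 0 X 1 = 0 := by rw [fderiv_coord hfd]; exact hX 1
      rwa [hf0] at this
    have k2 : fderiv ℝ (fun p : E 3 => p 2 * √(A p)) 0 X = 0 := hX 2
    have d1 := ((contDiff_coord (2 : Fin 3)).contDiffAt (x := 0)).differentiableAt (by simp)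
      |>.hasFDerivAt
    have d2 : HasFDerivAt (fun p : E 3 => p 2 * √(A p)) _ 0 :=
      d1.mul hsqrt.differentiableAt.hasFDerivAt
    rw [d2.fderiv, add_apply, smul_apply, smul_apply, fderiv_coord_apply] at k2
    simp [(Real.sqrt_pos.2 hA0).ne'] at k2
    ext i; fin_cases i <;> assumption
  obtain ⟨-, θ, hθ, hθφ, hφθ⟩ := id hφ
  have hθd : IsDiffeoGerm θ := ⟨hθ, φ, hφg, hφθ, hθφ⟩
  -- the last component in the new coordinates
  have hBA : SmoothNearZero fun p => B (θ p) / A (θ p) := by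
    filter_upwards [hθ.smooth, hθ.tendsto.eventually hApos] with p k1 k2
    exact (hB.contDiffAt.comp p k1).div (hA.contDiffAt.comp p k1) k2.ne'
  obtain ⟨P, q, hP, hq, hPq⟩ := hBA.exists_even_odd
  refine ⟨q, hq, ?_⟩
  have hfθ : ∀ᶠ p in 𝓝 (0 : E 3), f (θ p) =
      !₂[p 0, p 1, p 2 ^ 2, p 2 ^ 2 * P (fold p) + p 2 ^ 3 * q (fold p)] := by
    filter_upwards [hφθ, hθ.tendsto.eventually hfA, hθ.tendsto.eventually hfB,
      hθ.tendsto.eventually hApos, hPq] with p k1 k2 k3 k4 k5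
    have e0 : f (θ p) 0 = p 0 := congrArg (fun x : E 3 => x 0) k1
    have e1 : f (θ p) 1 = p 1 := congrArg (fun x : E 3 => x 1) k1
    have e2 : θ p 2 * √(A (θ p)) = p 2 := congrArg (fun x : E 3 => x 2) k1
    have e3 : p 2 ^ 2 = θ p 2 ^ 2 * A (θ p) := by
      rw [← e2, mul_pow, Real.sq_sqrt k4.le]
    have e4 : B (θ p) = A (θ p) * (P (fold p) + p 2 * q (fold p)) := by
      rw [div_eq_iff k4.ne'] at k5
      rw [k5, mul_comm]; rfl
    ext i; fin_cases i
    · exact e0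
    · exact e1
    · change f (θ p) 2 = p 2 ^ 2
      rw [k2, e3]
    · change f (θ p) 3 = p 2 ^ 2 * P (fold p) + p 2 ^ 3 * q (fold p)
      rw [k3, e4, pow_succ (p 2) 2, e3]
      ring
  -- removing the even part
  let π : E 4 →L[ℝ] E 3 := (EuclideanSpace.proj 0 : E 4 →L[ℝ] ℝ).smulRight (basisVec 0) +
    (EuclideanSpace.proj 1 : E 4 →L[ℝ] ℝ).smulRight (basisVec 1) +
    (EuclideanSpace.proj 2 : E 4 →L[ℝ] ℝ).smulRight (basisVec 2)
  have hπ : ∀ x, π x = !₂[x 0, x 1, x 2] := fun x => by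
    ext i; fin_cases i <;> simp [π, basisVec]
  -- The term z²P(x, y, z²) is a function of the first three target coordinates. The shears fix
  -- these, so s = -1 and s = 1 are mutually inverse.
  have hshear : ∀ s : ℝ, ContDiff ℝ ∞ fun x : E 4 =>
      (!₂[x 0, x 1, x 2, x 3 + s * (x 2 * P (π x))] : E 4) := fun s => by
    refine contDiff_euclidean.2 fun i => ?_
    fin_cases i
    · exact contDiff_coord 0
    · exact contDiff_coord 1
    · exact contDiff_coord 2
    · exact (contDiff_coord 3).add (contDiff_const.mul ((contDiff_coord 2).mul (hP.comp π.contDiff)))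
  have hshearg : ∀ s : ℝ, IsMapGerm fun x : E 4 =>
      (!₂[x 0, x 1, x 2, x 3 + s * (x 2 * P (π x))] : E 4) := fun s =>
    ⟨(hshear s).smoothNearZero, by ext i; fin_cases i <;> simp⟩
  have hΦ : IsDiffeoGerm fun x : E 4 =>
      (!₂[x 0, x 1, x 2, x 3 + (-1) * (x 2 * P (π x))] : E 4) := by
    refine ⟨hshearg (-1), _, hshearg 1, ?_, ?_⟩
    all_goals refine Eventually.of_forall fun x => ?_
    all_goals ext i; fin_cases i <;> simp [hπ]
  have s1 : AEquiv f fun p => f (θ p) :=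
    (aEquiv_of_source (g := f) hθd).symm (hf.comp hθ)
  refine (s1.trans (aEquiv_of_target hΦ)).trans (AEquiv.of_eventuallyEq ?_)
  filter_upwards [hfθ] with p hp
  have hπp : π (f (θ p)) = fold p := by rw [hπ, hp]; rfl
  rw [hπp, hp]
  ext i; fin_cases i
  · rfl
  · rfl
  · rfl
  · simp [standardForm]

/-- Transversality of η to S(f) straightens S(f) to z = 0 and η to ∂_z along it; nonvanishing of
`frameDet` at 0 makes f∘Σ, d²f(η, η) and ν(0) a coordinate system of the target. The hypotheses of
`aEquiv_standardForm_of_prenormal` then hold. -/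
theorem IsChoice.exists_standardForm {f ν : E 3 → E 4} {lam : E 3 → ℝ} {η : E 3 → E 3}
    {sig : E 2 → E 3} (hf : IsMapGerm f) (h : IsChoice f ν lam η sig)
    (hnd : vderiv η lam 0 ≠ 0) :
    ∃ q : E 3 → ℝ, ContDiff ℝ ∞ q ∧ AEquiv f (standardForm q) := by
  have hsig0 := h.param.germ.map_zero
  have hsπ : IsMapGerm fun p : E 3 => sig (planeProj p) :=
    h.param.germ.comp ⟨planeProj.contDiff.smoothNearZero, map_zero _⟩
  have hηs : SmoothNearZero fun p : E 3 => η (sig (planeProj p)) :=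
    h.null.smooth.comp hsπ.smooth hsπ.map_zero
  -- A ruled parametrization is enough in place of the flow of η, since only the first derivative in
  -- z along z = 0 and the line through 0 are used.
  let Ψ : E 3 → E 3 := fun p => sig (planeProj p) + p 2 • η (sig (planeProj p))
  have hΨg : IsMapGerm Ψ := by
    refine ⟨?_, by simp [Ψ, hsig0]⟩
    filter_upwards [hsπ.smooth, hηs] with p k1 k2
    exact k1.add ((contDiff_coord 2).contDiffAt.smul k2)
  have hΨd : ∀ᶠ p in 𝓝 (0 : E 3), ∀ X, fderiv ℝ Ψ p X =
      fderiv ℝ (fun p => sig (planeProj p)) p X +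
        (p 2 • fderiv ℝ (fun p => η (sig (planeProj p))) p X + X 2 • η (sig (planeProj p))) := by
    filter_upwards [hsπ.smooth, hηs] with p k1 k2 X
    have d1 := (k1.differentiableAt (by simp)).hasFDerivAt
    have d2 := (k2.differentiableAt (by simp)).hasFDerivAt
    have d3 := ((contDiff_coord (2 : Fin 3)).contDiffAt (x := p)).differentiableAt (by simp)
      |>.hasFDerivAt
    have d4 : HasFDerivAt Ψ _ p := d1.add (d3.smul d2)
    rw [d4.fderiv]
    simp [fderiv_coord_apply]
  have hsπ' : ∀ᶠ p in 𝓝 (0 : E 3), ∀ X, fderiv ℝ (fun p => sig (planeProj p)) p X =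
      fderiv ℝ sig (planeProj p) (planeProj X) := by
    have ht : Tendsto planeProj (𝓝 0) (𝓝 0) := by
      have := planeProj.continuous.tendsto 0
      rwa [map_zero] at this
    filter_upwards [ht.eventually h.param.germ.smooth] with p hp X
    have d : HasFDerivAt (fun p => sig (planeProj p)) _ p :=
      (hp.differentiableAt (by simp)).hasFDerivAt.comp p planeProj.hasFDerivAt
    rw [d.fderiv]; rfl
  have hΨ : IsDiffeoGerm Ψ := by
    refine hΨg.isDiffeoGerm ((injective_iff_map_eq_zero _).2 fun X hX => ?_)
    rw [hΨd.self_of_nhds, hsπ'.self_of_nhds] at hX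
    simp only [map_zero, hsig0, PiLp.zero_apply, zero_smul, zero_add] at hX
    obtain ⟨k1, k2⟩ := h.transversal hf hnd hX
    rw [planeProj_apply] at k1
    have k3 := congrArg (fun x : E 2 => x 0) k1
    have k4 := congrArg (fun x : E 2 => x 1) k1
    simp at k3 k4
    ext i; fin_cases i <;> assumption
  -- coordinates of the target
  set h0 := fderiv ℝ (fderiv ℝ f) 0 (η 0) (η 0) with hh0
  let pr : E 4 →L[ℝ] E 2 := (EuclideanSpace.proj 0 : E 4 →L[ℝ] ℝ).smulRight (basisVec 0) +
    (EuclideanSpace.proj 1 : E 4 →L[ℝ] ℝ).smulRight (basisVec 1)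
  let lin : E 4 →L[ℝ] E 4 := (EuclideanSpace.proj 2 : E 4 →L[ℝ] ℝ).smulRight h0 +
    (EuclideanSpace.proj 3 : E 4 →L[ℝ] ℝ).smulRight (ν 0)
  have hpr : ∀ x, pr x = !₂[x 0, x 1] := fun x => by
    ext i; fin_cases i <;> simp [pr, basisVec]
  have hlin : ∀ x, lin x = x 2 • h0 + x 3 • ν 0 := fun x => by simp [lin]
  have hfs : IsMapGerm fun u => f (sig u) := hf.comp h.param.germ
  have hfspr : IsMapGerm fun x => f (sig (pr x)) :=
    hfs.comp ⟨pr.contDiff.smoothNearZero, map_zero _⟩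
  -- This is the inverse of the target coordinate change: Θ(x, y, 0, 0) = f(Σ(x, y)), and the last
  -- two axes point along d²f(η, η) and ν at 0.
  let Θ : E 4 → E 4 := fun x => f (sig (pr x)) + lin x
  have hΘg : IsMapGerm Θ := by
    refine ⟨?_, ?_⟩
    · filter_upwards [hfspr.smooth] with x k using k.add lin.contDiff.contDiffAt
    · simp only [Θ, map_zero, hsig0, hf.map_zero, add_zero]
  have hΘ0 : ∀ X, fderiv ℝ Θ 0 X = X 0 • fderiv ℝ f 0 (fderiv ℝ sig 0 (basisVec 0)) +
      X 1 • fderiv ℝ f 0 (fderiv ℝ sig 0 (basisVec 1)) + (X 2 • h0 + X 3 • ν 0) := by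
    intro X
    have d1 : HasFDerivAt (fun u => f (sig u)) ((fderiv ℝ f 0).comp (fderiv ℝ sig 0)) (pr 0) := by
      rw [map_zero]; exact hf.hasFDerivAt_comp h.param.germ
    have d2 : HasFDerivAt Θ _ 0 := (d1.comp 0 pr.hasFDerivAt).add lin.hasFDerivAt
    rw [d2.fderiv]
    have : pr X = X 0 • basisVec 0 + X 1 • basisVec 1 := by simp [pr]
    rw [add_apply, ContinuousLinearMap.comp_apply, this, hlin, map_add, map_smul, map_smul]
    rfl
  have hdet := h.frameDet_zero hf hnd
  rw [IsChoice.frameDet, hsig0, det4_ne_zero_iff, Fintype.linearIndependent_iff] at hdet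
  have hΘ : IsDiffeoGerm Θ := by
    refine hΘg.isDiffeoGerm ((injective_iff_map_eq_zero _).2 fun X hX => ?_)
    rw [hΘ0] at hX
    have := hdet (fun i => X i) (by
      simp only [Fin.sum_univ_four, Matrix.cons_val]
      rw [← hX]; module)
    ext i; exact this i
  obtain ⟨-, Λ, hΛ, hΛΘ, hΘΛ⟩ := id hΘ
  have hΛd : IsDiffeoGerm Λ := ⟨hΛ, Θ, hΘg, hΘΛ, hΛΘ⟩
  have hf1 : IsMapGerm fun p => f (Ψ p) := hf.comp hΨg
  have hf2 : IsMapGerm fun p => Λ (f (Ψ p)) := hΛ.comp hf1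
  have e1 : AEquiv f fun p => f (Ψ p) := (aEquiv_of_source (g := f) hΨ).symm hf1
  have e2 : AEquiv f fun p => Λ (f (Ψ p)) := e1.trans (aEquiv_of_target hΛd)
  have hΨι : ∀ p, Ψ (planeIncl (planeProj p)) = sig (planeProj p) := by
    intro p
    have k1 : planeProj (planeIncl (planeProj p)) = planeProj p := by
      rw [planeIncl_planeProj, planeProj_apply, planeProj_apply]; rfl
    have k2 : planeIncl (planeProj p) 2 = 0 := by rw [planeIncl_planeProj]; rfl
    simp only [Ψ, k1, k2, zero_smul, add_zero]
  refine (aEquiv_standardForm_of_prenormal hf2 ?_ ?_ ?_).imp fun q hq => ⟨hq.1, e2.trans hq.2⟩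
  · let l : E 3 →L[ℝ] E 4 := (EuclideanSpace.proj 0 : E 3 →L[ℝ] ℝ).smulRight (basisVec 0) +
      (EuclideanSpace.proj 1 : E 3 →L[ℝ] ℝ).smulRight (basisVec 1)
    have hl : ∀ p, l p = !₂[p 0, p 1, 0, 0] := fun p => by
      ext i; fin_cases i <;> simp [l, basisVec]
    have hlt : Tendsto l (𝓝 0) (𝓝 0) := by
      have := l.continuous.tendsto 0
      rwa [map_zero] at this
    filter_upwards [hlt.eventually hΛΘ] with p hp
    have k : Θ (l p) = f (sig (planeProj p)) := by
      simp only [Θ]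
      rw [hpr, hlin, hl, planeProj_apply]
      simp
    rw [hΨι, ← k, hp, hl]
  · have hP : Tendsto (fun p => sig (planeProj p)) (𝓝 0) (𝓝 0) := hsπ.tendsto
    have hpt : Tendsto planeProj (𝓝 0) (𝓝 0) := by
      have := planeProj.continuous.tendsto 0
      rwa [map_zero] at this
    filter_upwards [tendsto_planeIncl_planeProj.eventually hΨd,
      tendsto_planeIncl_planeProj.eventually hsπ', tendsto_planeIncl_planeProj.eventually hΨg.smooth,
      hP.eventually hf.smooth, (hf.tendsto.comp hP).eventually hΛ.smooth,
      hP.eventually h.null.eventually_ne_zero, hpt.eventually h.param.eventually_mem]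
      with p k1 k2 k3 k4 k5 k6 k7
    set ι := planeIncl (planeProj p) with hι
    have hpι : planeProj ι = planeProj p := by
      rw [hι, planeIncl_planeProj, planeProj_apply, planeProj_apply]; rfl
    have hι2 : ι 2 = 0 := by rw [hι, planeIncl_planeProj]; rfl
    have hp2 : planeProj (basisVec 2) = 0 := by
      rw [planeProj_apply]; ext i; fin_cases i <;> simp [basisVec]
    have d1 : fderiv ℝ Ψ ι (basisVec 2) = η (sig (planeProj p)) := by
      rw [k1, k2, hp2, hι2, hpι]
      simp [basisVec]
    have d2 : HasFDerivAt f (fderiv ℝ f (sig (planeProj p))) (Ψ ι) := by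
      rw [hΨι]; exact (k4.differentiableAt (by simp)).hasFDerivAt
    have d3 : HasFDerivAt Λ (fderiv ℝ Λ (f (sig (planeProj p)))) (f (Ψ ι)) := by
      rw [hΨι]; exact (k5.differentiableAt (by simp)).hasFDerivAt
    have d4 : HasFDerivAt (fun p => Λ (f (Ψ p))) _ ι :=
      d3.comp ι (d2.comp ι (k3.differentiableAt (by simp)).hasFDerivAt)
    rw [d4.fderiv, ContinuousLinearMap.comp_apply, ContinuousLinearMap.comp_apply, d1,
      (k6 k7).1, map_zero]
  · set γ := lineAt (0 : E 3) (η 0) with hγdef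
    have hγ : SmoothNearZero γ := smoothNearZero_lineAt 0 (η 0)
    have hγ0 : γ 0 = 0 := lineAt_zero 0 (η 0)
    have hγ' : deriv γ 0 = η 0 := by rw [hγdef, deriv_lineAt]
    have hγ'' : deriv (deriv γ) 0 = 0 := by rw [hγdef, deriv_lineAt]; simp
    have hp2 : planeProj (basisVec 2) = 0 := by
      rw [planeProj_apply]; ext i; fin_cases i <;> simp [basisVec]
    have hΨγ : ∀ t : ℝ, Ψ (t • basisVec 2) = γ t := fun t => by
      simp only [Ψ, map_smul, hp2, smul_zero, hsig0, hγdef, lineAt]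
      simp [basisVec]
    have c1 := deriv_deriv_comp_curve (f := f) (γ := γ) (by rw [hγ0]; exact hf.smooth) hγ
    have c2 := deriv_comp_curve_zero (f := f) (γ := γ) (by rw [hγ0]; exact hf.smooth) hγ
    have hfγ : SmoothNearZero fun t => f (γ t) := hf.smooth.comp hγ hγ0
    have c3 := deriv_deriv_comp_curve (f := Λ) (γ := fun t => f (γ t))
      (by simp only [hγ0, hf.map_zero]; exact hΛ.smooth) hfγ
    rw [hγ', hγ0, h.null_zero.1] at c2
    rw [hγ', hγ'', hγ0, map_zero, add_zero] at c1
    rw [c1, c2] at c3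
    simp only [hγ0, hf.map_zero, map_zero, zero_add] at c3
    -- The differential of Θ sends the third basis vector to d²f(η, η), so that of Λ sends it back.
    -- The required second derivative is therefore 1.
    have c4 : fderiv ℝ Λ 0 h0 = basisVec 2 := by
      have k := hΛ.hasFDerivAt_comp hΘg
      have k2 := k.unique ((hasFDerivAt_id (𝕜 := ℝ) (0 : E 4)).congr_of_eventuallyEq hΛΘ)
      have k3 := congrArg (fun L : E 4 →L[ℝ] E 4 => L (basisVec 2)) k2
      simp only [ContinuousLinearMap.comp_apply, hΘ0] at k3
      simpa [basisVec] using k3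
    rw [← hh0, c4] at c3
    have hsm : SmoothNearZero fun t => Λ (f (γ t)) :=
      hΛ.smooth.comp hfγ (by simp only [hγ0, hf.map_zero])
    have c5 : deriv (deriv fun t : ℝ => Λ (f (Ψ (t • basisVec 2))) 2) 0 = 1 := by
      simp only [hΨγ]
      have g1 : deriv (fun t => Λ (f (γ t)) 2) =ᶠ[𝓝 0] fun t => deriv (fun t => Λ (f (γ t))) t 2 := by
        filter_upwards [hsm.hasDerivAt] with t ht
        exact ((EuclideanSpace.proj 2 : E 4 →L[ℝ] ℝ).hasFDerivAt.comp_hasDerivAt t ht).deriv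
      have g2 : HasDerivAt (fun t => deriv (fun t => Λ (f (γ t))) t 2) _ 0 :=
        (EuclideanSpace.proj 2 : E 4 →L[ℝ] ℝ).hasFDerivAt.comp_hasDerivAt 0
          hsm.deriv.hasDerivAt.self_of_nhds
      rw [g1.deriv_eq, g2.deriv, c3]
      simp [basisVec]
    rw [c5]
    exact one_pos

end FrontalCriterion

end

/-! ### The criterion -/

theorem mainTheorem4 (f : E 3 → E 4) (hf : IsFrontal f)
    (ν : E 3 → E 4) (lam : E 3 → ℝ) (η : E 3 → E 3) (sig : E 2 → E 3)
    (hchoice : IsChoice f ν lam η sig) (hηlam : vderiv η lam 0 ≠ 0) :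
    (IsCuspidalCrossCapInterval f ↔ PsiCondition f ν η sig) ∧
    (∀ (g : E 3 → E 4), AEquiv f g →
      ∀ (ν' : E 3 → E 4) (lam' : E 3 → ℝ) (η' : E 3 → E 3) (sig' : E 2 → E 3),
        IsChoice g ν' lam' η' sig' →
          vderiv η' lam' 0 ≠ 0 ∧ (PsiCondition g ν' η' sig' ↔ PsiCondition f ν η sig)) := by
  have hfg := hf.1
  refine ⟨⟨fun h => ?_, fun h => ⟨hfg, ?_⟩⟩, fun g hg ν' lam' η' sig' h' =>
    hchoice.invariance hfg hηlam hg h'⟩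
  -- The model is the standard form with q = y, whose ψ visibly has a simple zero; invariance
  -- carries this to f.
  · have hq : ContDiff ℝ ∞ fun p : E 3 => p 1 := contDiff_coord 1
    obtain ⟨lam₀, hc⟩ := exists_isChoice_standardForm hq
    refine (hchoice.invariance hfg hηlam (cuspidalCrossCapModel_eq ▸ h.2) hc).2.1
      ((psiCondition_standardForm hq).2 ⟨rfl, 1, ?_⟩)
    rw [fderiv_coord_apply, planeIncl_apply]
    simp [basisVec]
  -- Invariance carries the condition on ψ to a standard form of f, where it becomes the condition
  -- on q that yields the model.
  · obtain ⟨q, hq, he⟩ := hchoice.exists_standardForm hfg hηlam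
    obtain ⟨lam₀, hc⟩ := exists_isChoice_standardForm hq
    obtain ⟨hq0, hdq⟩ := (psiCondition_standardForm hq).1
      ((hchoice.invariance hfg hηlam he hc).2.2 h)
    exact he.trans (aEquiv_model_of_psiCondition hq hq0 hdq)
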